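/- Let $\alpha>2$ and $\rho_{\rm init}>0$ be fixed. For each $n$ let $m=m(n)$ with $m(n)/n\to\alpha$, let $a_1,\dots,a_m$ be independent $\mathcal N(0,I_n)$ sensing vectors, let the target signal be $\xi=e_1\in\mathbb R^n$ (the first canonical basis vector), and let $y_i=|a_i^T\xi|$. Let $x_{\rm init}\in\mathbb R^n$ be a (possibly random) unit vector, independent of the sensing vectors, with $\xi^Tx_{\rm init}>0$ and cosine similarity $|x_{\rm init}^T\xi|/(\|x_{\rm init}\|_2\|\xi\|_2)=\rho_{\rm init}$ almost surely for all $n\ge 2$. Let $\widehat x$ be an optimal solution of the PhaseMax linear program $$\max_{x\in\mathbb R^n}\ x_{\rm init}^Tx\quad\text{subject to}\quad |a_i^Tx|\le y_i,\ 1\le i\le m.$$ Set $c_\alpha=1/\tan(\pi/\alpha)$ and, for $s\in[0,1]$, $$r_\alpha(s)=\sqrt{c_\alpha^2+1-s^2}-c_\alpha,\qquad g_\alpha(s)=-1-s^2+\frac{2\alpha\, r_\alpha(s)}{\pi}+\frac{2\alpha s}{\pi}\arctan\Big(\frac{s}{r_\alpha(s)+c_\alpha}\Big).$$ Then the function $s\mapsto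 \rho_{\rm init}s+\sqrt{(1-\rho_{\rm init}^2)g_\alpha(s)}$ has exactly one maximizer $s^*$ over $[0,1]$. Put $r^*=r_\alpha(s^*)$. With probability tending to one the linear program has an optimal solution, and for every choice $\widehat x$ of optimal solutions (arbitrary where there is none) the following limits hold in probability as $n\to\infty$, where $\widehat x=(\widehat x_1,\widetilde x)$ with $\widehat x_1\in\mathbb R$ and $\widetilde x\in\mathbb R^{n-1}$: $$\mathrm{NMSE}_n=\frac{\min\{\|\xi-\widehat x\|_2^2,\|\xi+\widehat x\|_2^2\}}{\|\xi\|_2^2}\to 1+(s^*)^2+(r^*)^2-2|s^*|,$$ $$\widehat x_1\to s^*,\qquad \|\widetilde x\|_2\to r^*,\qquad x_{\rm init}^T\widehat x\to\rho_{\rm init}s^*+\sqrt{(1-\rho_{\rm init}^2)\,g_\alpha(s^*)}.$$ -/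

import Mathlib

open MeasureTheory ProbabilityTheory Filter Topology
open scoped RealInnerProductSpace

namespace PhaseMax

noncomputable section

/-- The target signal: the first vector of the canonical basis of `ℝⁿ` (for `n ≥ 1`). -/
def signal (n : ℕ) : EuclideanSpace ℝ (Fin n) :=
  WithLp.toLp 2 fun i => if (i : ℕ) = 0 then 1 else 0

/-- The first coordinate `x₁` of a vector `x ∈ ℝⁿ` (for `n ≥ 1`). -/
def head {n : ℕ} (x : EuclideanSpace ℝ (Fin n)) : ℝ :=
  if h : 0 < n then x ⟨0, h⟩ else 0

/-- The Euclidean norm `‖x̃‖₂` of the vector of all the coordinates of `x` but the first. -/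
def tailNorm {n : ℕ} (x : EuclideanSpace ℝ (Fin n)) : ℝ :=
  √(∑ i : Fin n, if (i : ℕ) = 0 then 0 else x i ^ 2)

/-- The cosine similarity of `x` and `ξ`. -/
def cosSim {n : ℕ} (x ξ : EuclideanSpace ℝ (Fin n)) : ℝ :=
  |⟪x, ξ⟫| / (‖x‖ * ‖ξ‖)

/-- The normalized mean squared error of the estimate `x` of `ξ`, up to a global sign. -/
def nmse {n : ℕ} (ξ x : EuclideanSpace ℝ (Fin n)) : ℝ :=
  min (‖ξ - x‖ ^ 2) (‖ξ + x‖ ^ 2) / ‖ξ‖ ^ 2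

/-- The magnitude measurements `yᵢ = |aᵢᵀ ξ|`. -/
def measurements {m n : ℕ} (a : Fin m → EuclideanSpace ℝ (Fin n))
    (ξ : EuclideanSpace ℝ (Fin n)) : Fin m → ℝ :=
  fun i => |⟪a i, ξ⟫|

/-- The polytope `{x : |aᵢᵀ x| ≤ yᵢ for all i}`. -/
def feasible {m n : ℕ} (a : Fin m → EuclideanSpace ℝ (Fin n)) (y : Fin m → ℝ) :
    Set (EuclideanSpace ℝ (Fin n)) :=
  {x | ∀ i, |⟪a i, x⟫| ≤ y i}

/-- The set of optimal solutions of the PhaseMax linear program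
`max x₀ᵀ x` subject to `|aᵢᵀ x| ≤ yᵢ` for all `i`. -/
def solutions {m n : ℕ} (a : Fin m → EuclideanSpace ℝ (Fin n)) (y : Fin m → ℝ)
    (x₀ : EuclideanSpace ℝ (Fin n)) : Set (EuclideanSpace ℝ (Fin n)) :=
  {x | x ∈ feasible a y ∧ IsMaxOn (fun z => ⟪x₀, z⟫) (feasible a y) x}

/-- `c_α = 1 / tan (π / α)`. -/
def cAlpha (α : ℝ) : ℝ := 1 / Real.tan (Real.pi / α)

/-- `r_α(s) = √(c_α² + 1 - s²) - c_α`. -/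
def rAlpha (α s : ℝ) : ℝ := √(cAlpha α ^ 2 + 1 - s ^ 2) - cAlpha α

/-- `g_α(s) = -1 - s² + 2 α r_α(s) / π + (2 α s / π) atan (s / (r_α(s) + c_α))`. -/
def gAlpha (α s : ℝ) : ℝ :=
  -1 - s ^ 2 + 2 * α * rAlpha α s / Real.pi
    + 2 * α * s / Real.pi * Real.arctan (s / (rAlpha α s + cAlpha α))

/-- The limiting cost `ρ s + √((1 - ρ²) g_α(s))`. -/
def limitCost (ρ α s : ℝ) : ℝ := ρ * s + √((1 - ρ ^ 2) * gAlpha α s)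

/-- The set of maximizers of the limiting cost over `[0, 1]`. -/
def limitArgmax (ρ α : ℝ) : Set ℝ :=
  {s | s ∈ Set.Icc (0 : ℝ) 1 ∧ IsMaxOn (limitCost ρ α) (Set.Icc (0 : ℝ) 1) s}

end

end PhaseMax

/-!
The optimal solution of the linear program is located by a Gaussian comparison argument.

In an orthonormal basis that starts with the signal and with the direction `u` of the component of
the initial guess orthogonal to the signal, a point has coordinates `(s, t, w)`, its objective value
is `ρ s + √(1 - ρ²) t`, and the constraints read `|s q + t g + G w| ≤ |q|` entrywise, where the
vectors `q`, `g` and the matrix `G` are independent and standard Gaussian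
(`mem_feasible_sensing_iff`, `measurePreserving_sortEntries`). Feasibility is dual to a bilinear
form `lᵀ G w`, so that Gordon's inequality (`gordon_comparison`, `gordon_bilinear`), proved by
interpolation and Gaussian integration by parts, replaces `G w` by a Gaussian vector `‖w‖ h` at the
price of a term `‖w‖ ‖k‖` with an independent Gaussian vector `k`. The comparison works in both
directions: it bounds the probability that some point with `(s, t, ‖w‖)` in a given set is feasible
(`primMeasure_exists_feasible_le`) and, through separation of convex sets, the probability that no
point with given `(s, t)` and bounded `‖w‖` is feasible (`primMeasure_infeasible_le`).

By the law of large numbers the auxiliary constraint becomes `α E (|s q + t g + τ h| - |q|)₊² ≤ τ²`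
for `τ = ‖w‖`, which describes a convex set of points `(s, t, τ)`. The expectation depends on `s`
and `r = √(t² + τ²)` only and has a closed form (`meanSq_eq`), so that the constraint is
`t² ≤ r² - α E (|s q + r z| - |q|)₊²`. For fixed `s ∈ [0, 1]` the right-hand side is largest at
`r = r_α(s)` only, with the value `g_α(s)` (`margin_rAlpha`, `margin_le`, `eq_rAlpha_of_margin_eq`).
Hence the limiting problem is the maximization of `ρ s + √((1 - ρ²) g_α(s))`. Its objective is
concave, and an interval of maximizers would make `g_α` a quadratic polynomial there, which it is
not (`limitArgmax_subsingleton`).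

The points of norm `R`, and the points with an almost optimal value that are away from the predicted
limits, form a compact set on which the limiting constraint fails (`exists_badSet_infeasible`). With
probability tending to one none of them is feasible, while a feasible point with an almost optimal
value exists. On this event the feasible set, being star-shaped, lies in the ball of radius `R`,
solutions exist, and all of them are close to the predicted limits (`exists_good_event`).
-/

namespace PhaseMax

/-! ### Standard Gaussian measures on `ι → ℝ` and integration by parts -/

/-- The law of a family of independent standard Gaussian variables indexed by `ι`. -/
noncomputable def gaussPi (ι : Type*) [Fintype ι] : Measure (ι → ℝ) :=
  Measure.pi fun _ => gaussianReal 0 1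

instance (ι : Type*) [Fintype ι] : IsProbabilityMeasure (gaussPi ι) := by
  unfold gaussPi; infer_instance

section Density

variable {ι : Type*} [Fintype ι]

/-- The density of `gaussPi ι` with respect to Lebesgue measure. -/
noncomputable def gaussDensity (x : ι → ℝ) : ℝ := ∏ i, gaussianPDFReal 0 1 (x i)

lemma gaussDensity_nonneg (x : ι → ℝ) : 0 ≤ gaussDensity x :=
  Finset.prod_nonneg fun i _ => gaussianPDFReal_nonneg 0 1 (x i)

lemma measurable_gaussDensity : Measurable (gaussDensity (ι := ι)) :=
  Finset.measurable_fun_prod _ fun i _ =>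
    (measurable_gaussianPDFReal 0 1).comp (measurable_pi_apply i)

lemma gaussPi_eq_withDensity :
    gaussPi ι = volume.withDensity (fun x => ENNReal.ofReal (gaussDensity x)) := by
  refine Measure.pi_eq fun s hs => ?_
  rw [withDensity_apply _ (MeasurableSet.univ_pi hs)]
  have hr : (volume : Measure (ι → ℝ)).restrict (Set.univ.pi s) =
      Measure.pi fun i => (volume : Measure ℝ).restrict (s i) :=
    Measure.restrict_pi_pi _ _
  rw [hr, ← ofReal_integral_eq_lintegral_ofReal]
  · simp only [gaussDensity]
    rw [integral_fintype_prod_eq_prod (fun _ => gaussianPDFReal 0 1),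
      ENNReal.ofReal_prod_of_nonneg
        (fun i _ => integral_nonneg fun x => gaussianPDFReal_nonneg 0 1 x)]
    exact Finset.prod_congr rfl fun i _ =>
      (gaussianReal_apply_eq_integral 0 one_ne_zero (s i)).symm
  · exact Integrable.fintype_prod (f := fun _ => gaussianPDFReal 0 1)
      fun i => (integrable_gaussianPDFReal 0 1).restrict
  · exact ae_of_all _ gaussDensity_nonneg

lemma integral_gaussPi (f : (ι → ℝ) → ℝ) :
    ∫ x, f x ∂gaussPi ι = ∫ x, f x * gaussDensity x := by
  rw [gaussPi_eq_withDensity, integral_withDensity_eq_integral_toReal_smul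
    measurable_gaussDensity.ennreal_ofReal (ae_of_all _ fun _ => ENNReal.ofReal_lt_top)]
  simp [ENNReal.toReal_ofReal (gaussDensity_nonneg _), mul_comm]

lemma integrable_gaussPi_iff (f : (ι → ℝ) → ℝ) :
    Integrable f (gaussPi ι) ↔ Integrable fun x => f x * gaussDensity x := by
  rw [gaussPi_eq_withDensity, integrable_withDensity_iff_integrable_smul'
    measurable_gaussDensity.ennreal_ofReal (ae_of_all _ fun _ => ENNReal.ofReal_lt_top)]
  simp [ENNReal.toReal_ofReal (gaussDensity_nonneg _), mul_comm]

lemma integrable_coord (i : ι) : Integrable (fun x : ι → ℝ => x i) (gaussPi ι) := by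
  have h := (measurePreserving_eval (fun _ : ι => gaussianReal 0 1) i)
  exact h.integrable_comp_of_integrable
    ((memLp_id_gaussianReal (μ := 0) (v := 1) 1).integrable (by simp))

lemma integrable_linear (L : ι → ℝ) :
    Integrable (fun x : ι → ℝ => ∑ i, L i * x i) (gaussPi ι) :=
  integrable_finsetSum _ fun i _ => (integrable_coord i).const_mul _

lemma gaussDensity_eq (x : ι → ℝ) :
    gaussDensity x = (√(2 * Real.pi))⁻¹ ^ Fintype.card ι * Real.exp (-(∑ i, x i ^ 2) / 2) := by
  simp only [gaussDensity, gaussianPDFReal, Finset.prod_mul_distrib, ← Real.exp_sum]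
  simp [Finset.prod_const, Finset.sum_div, Finset.sum_neg_distrib, neg_div]

lemma hasLineDerivAt_gaussDensity (x L : ι → ℝ) :
    HasLineDerivAt ℝ gaussDensity (-(∑ i, L i * x i) * gaussDensity x) x L := by
  have h : ∀ i, HasDerivAt (fun t : ℝ => (x i + t * L i) ^ 2) (2 * (L i * x i)) 0 := fun i =>
    ((((hasDerivAt_id (0 : ℝ)).mul_const (L i)).const_add (x i)).pow 2).congr_deriv
      (by simp; ring)
  have h2 : HasDerivAt (fun t : ℝ => -(∑ i, (x i + t * L i) ^ 2) / 2)
      (-(∑ i, L i * x i)) 0 :=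
    (((HasDerivAt.fun_sum fun i (_ : i ∈ Finset.univ) => h i).neg).div_const 2).congr_deriv
      (by rw [← Finset.mul_sum]; ring)
  have h3 := (h2.exp).const_mul ((√(2 * Real.pi))⁻¹ ^ Fintype.card ι)
  have h4 : (fun t : ℝ => gaussDensity (x + t • L)) = fun t : ℝ =>
      (√(2 * Real.pi))⁻¹ ^ Fintype.card ι * Real.exp (-(∑ i, (x i + t * L i) ^ 2) / 2) := by
    ext t; rw [gaussDensity_eq]; simp
  unfold HasLineDerivAt
  rw [h4]
  refine h3.congr_deriv ?_
  rw [gaussDensity_eq]; simp; ring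

/-- Gaussian integration by parts in the direction `L`. -/
theorem integral_linear_mul {f f' : (ι → ℝ) → ℝ} (L : ι → ℝ) {C : ℝ}
    (hfc : Continuous f) (hfc' : Continuous f')
    (hf : ∀ x, HasLineDerivAt ℝ f (f' x) x L) (hC : ∀ x, |f x| ≤ C) (hC' : ∀ x, |f' x| ≤ C) :
    ∫ x, (∑ i, L i * x i) * f x ∂gaussPi ι = ∫ x, f' x ∂gaussPi ι := by
  have h1 : Integrable f (gaussPi ι) :=
    Integrable.of_bound hfc.aestronglyMeasurable C (ae_of_all _ hC)
  have h2 : Integrable f' (gaussPi ι) :=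
    Integrable.of_bound hfc'.aestronglyMeasurable C (ae_of_all _ hC')
  have h3 : Integrable (fun x => (∑ i, L i * x i) * f x) (gaussPi ι) :=
    (integrable_linear L).mul_bdd hfc.aestronglyMeasurable (ae_of_all _ hC)
  have key := integral_bilinear_hasLineDerivAt_right_eq_neg_left_of_integrable
    (μ := (volume : Measure (ι → ℝ))) (f := f) (f' := f') (g := gaussDensity)
    (g' := fun x => -(∑ i, L i * x i) * gaussDensity x) (v := L)
    (B := ContinuousLinearMap.mul ℝ ℝ) ((integrable_gaussPi_iff _).1 h2)
    (by
      have := ((integrable_gaussPi_iff _).1 h3).neg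
      refine this.congr (ae_of_all _ fun x => ?_)
      simp; ring)
    ((integrable_gaussPi_iff _).1 h1) (fun x _ => hf x)
    (fun x _ => hasLineDerivAt_gaussDensity x L)
  simp only [ContinuousLinearMap.mul_apply'] at key
  rw [integral_gaussPi, integral_gaussPi, ← neg_neg (∫ x, f' x * gaussDensity x), ← key,
    ← integral_neg]
  congr 1; ext x; ring

end Density

/-! ### Comparison of Gaussian processes by interpolation -/

/-- Twice continuously differentiable functions that are bounded together with their first two
derivatives. -/
structure BddC2 {E : Type*} [NormedAddCommGroup E] [NormedSpace ℝ E] (F : E → ℝ) : Prop where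
  contDiff : ContDiff ℝ 2 F
  bound : ∀ k : ℕ, k ≤ 2 → ∃ C : ℝ, ∀ x, ‖iteratedFDeriv ℝ k F x‖ ≤ C

namespace BddC2

variable {E : Type*} [NormedAddCommGroup E] [NormedSpace ℝ E] {F G : E → ℝ}

lemma const (c : ℝ) : BddC2 (fun _ : E => c) := by
  refine ⟨contDiff_const, fun k _ => ?_⟩
  rcases Nat.eq_zero_or_pos k with rfl | hk
  · exact ⟨|c|, fun x => by simp⟩
  · exact ⟨0, fun x => by simp [iteratedFDeriv_const_of_ne hk.ne' c]⟩

lemma sub (hF : BddC2 F) (hG : BddC2 G) : BddC2 (fun x => F x - G x) := by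
  refine ⟨hF.contDiff.sub hG.contDiff, fun k hk => ?_⟩
  obtain ⟨C, hC⟩ := hF.bound k hk
  obtain ⟨D, hD⟩ := hG.bound k hk
  have hk' : (k : WithTop ℕ∞) ≤ 2 := by exact_mod_cast hk
  refine ⟨C + D, fun x => ?_⟩
  have : (fun x => F x - G x) = F - G := rfl
  rw [this, iteratedFDeriv_sub_apply (hF.contDiff.contDiffAt.of_le hk')
    (hG.contDiff.contDiffAt.of_le hk')]
  exact (norm_sub_le _ _).trans (add_le_add (hC x) (hD x))

lemma mul (hF : BddC2 F) (hG : BddC2 G) : BddC2 (fun x => F x * G x) := by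
  refine ⟨hF.contDiff.mul hG.contDiff, fun k hk => ?_⟩
  choose! C hC using hF.bound
  choose! D hD using hG.bound
  have hk' : (k : WithTop ℕ∞) ≤ 2 := by exact_mod_cast hk
  refine ⟨∑ i ∈ Finset.range (k + 1), (k.choose i) * C i * D (k - i), fun x => ?_⟩
  refine (norm_iteratedFDeriv_mul_le hF.contDiff hG.contDiff x hk').trans ?_
  refine Finset.sum_le_sum fun i hi => ?_
  have hi' : i ≤ k := Nat.lt_succ_iff.1 (Finset.mem_range.1 hi)
  have h1 := hC i (hi'.trans hk) x
  have h2 := hD (k - i) ((Nat.sub_le _ _).trans hk) x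
  have h3 : 0 ≤ C i := (norm_nonneg _).trans h1
  gcongr

lemma prod {ι : Type*} (s : Finset ι) {f : ι → E → ℝ} (hf : ∀ i ∈ s, BddC2 (f i)) :
    BddC2 (fun x => ∏ i ∈ s, f i x) := by
  classical
  induction s using Finset.induction_on with
  | empty => simpa using const 1
  | insert a s ha ih =>
    simp only [Finset.prod_insert ha]
    exact (hf a (Finset.mem_insert_self a s)).mul
      (ih fun i hi => hf i (Finset.mem_insert_of_mem hi))

lemma comp_clm {E' : Type*} [NormedAddCommGroup E'] [NormedSpace ℝ E'] (hF : BddC2 F)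
    (L : E' →L[ℝ] E) : BddC2 (fun x => F (L x)) := by
  refine ⟨hF.contDiff.comp L.contDiff, fun k hk => ?_⟩
  obtain ⟨C, hC⟩ := hF.bound k hk
  have hk' : (k : WithTop ℕ∞) ≤ 2 := by exact_mod_cast hk
  refine ⟨C * ∏ _i : Fin k, ‖L‖, fun x => ?_⟩
  have := L.iteratedFDeriv_comp_right hF.contDiff x hk'
  rw [show (fun x => F (L x)) = F ∘ L from rfl, this]
  refine (ContinuousMultilinearMap.norm_compContinuousLinearMap_le _ _).trans ?_
  gcongr
  exact hC _

lemma exists_bound (hF : BddC2 F) : ∃ C : ℝ, 0 ≤ C ∧ (∀ x, |F x| ≤ C) ∧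
    (∀ x, ‖fderiv ℝ F x‖ ≤ C) ∧ ∀ x, ‖fderiv ℝ (fderiv ℝ F) x‖ ≤ C := by
  obtain ⟨C₀, h₀⟩ := hF.bound 0 (by norm_num)
  obtain ⟨C₁, h₁⟩ := hF.bound 1 (by norm_num)
  obtain ⟨C₂, h₂⟩ := hF.bound 2 le_rfl
  refine ⟨max (max C₀ C₁) (max C₂ 0), le_max_of_le_right (le_max_right _ _), fun x => ?_,
    fun x => ?_, fun x => ?_⟩
  · have := h₀ x
    rw [norm_iteratedFDeriv_zero, Real.norm_eq_abs] at this
    exact this.trans ((le_max_left _ _).trans (le_max_left _ _))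
  · have := h₁ x
    rw [norm_iteratedFDeriv_one] at this
    exact this.trans ((le_max_right _ _).trans (le_max_left _ _))
  · have := h₂ x
    rw [← norm_iteratedFDeriv_fderiv, norm_iteratedFDeriv_one] at this
    exact this.trans ((le_max_left _ _).trans (le_max_right _ _))

end BddC2

/-- The smooth step from `0` at `c` to `1` at `c + ε`. -/
noncomputable def smoothStep (c ε y : ℝ) : ℝ := Real.smoothTransition ((y - c) / ε)

lemma bddC2_smoothStep (c : ℝ) {ε : ℝ} (hε : 0 < ε) : BddC2 (smoothStep c ε) := by
  have hcd : ContDiff ℝ 2 (smoothStep c ε) := by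
    unfold smoothStep
    exact Real.smoothTransition.contDiff.comp (by fun_prop)
  refine ⟨hcd, fun k hk => ?_⟩
  have hk' : (k : WithTop ℕ∞) ≤ 2 := by exact_mod_cast hk
  obtain ⟨C, hC⟩ := isCompact_Icc.exists_bound_of_continuousOn (s := Set.Icc c (c + ε))
    (hcd.continuous_iteratedFDeriv (m := k) hk').continuousOn
  -- outside `[c, c + ε]` the step is locally constant
  have hout : ∀ y : ℝ, y ∉ Set.Icc c (c + ε) → ∃ b : ℝ, |b| ≤ 1 ∧
      smoothStep c ε =ᶠ[𝓝 y] fun _ => b := by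
    intro y hy
    rw [Set.mem_Icc, not_and_or, not_le, not_le] at hy
    rcases hy with hy | hy
    · refine ⟨0, by simp, ?_⟩
      filter_upwards [gt_mem_nhds hy] with z hz
      exact Real.smoothTransition.zero_of_nonpos
        (div_nonpos_of_nonpos_of_nonneg (by linarith) hε.le)
    · refine ⟨1, by simp, ?_⟩
      filter_upwards [lt_mem_nhds hy] with z hz
      exact Real.smoothTransition.one_of_one_le ((one_le_div hε).2 (by linarith))
  refine ⟨max C 1, fun y => ?_⟩
  by_cases hy : y ∈ Set.Icc c (c + ε)
  · exact (hC y hy).trans (le_max_left _ _)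
  · obtain ⟨b, hb, he⟩ := hout y hy
    rw [(he.iteratedFDeriv ℝ k).eq_of_nhds]
    refine le_trans ?_ (le_max_right _ _)
    rcases Nat.eq_zero_or_pos k with rfl | hk
    · simpa using hb
    · simp [iteratedFDeriv_const_of_ne hk.ne' b]

lemma smoothStep_nonneg (c ε y : ℝ) : 0 ≤ smoothStep c ε y := Real.smoothTransition.nonneg _

lemma smoothStep_le_one (c ε y : ℝ) : smoothStep c ε y ≤ 1 := Real.smoothTransition.le_one _

lemma smoothStep_mono (c : ℝ) {ε : ℝ} (hε : 0 < ε) : Monotone (smoothStep c ε) := fun _ _ h =>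
  Real.smoothTransition.monotone (by gcongr)

section Interpolation

variable {N P : Type*} [Fintype N] [Fintype P]

lemma integrable_mulVec_norm (a : Matrix P N ℝ) :
    Integrable (fun x : N → ℝ => ‖a.mulVec x‖) (gaussPi N) := by
  have h : Integrable (fun x : N → ℝ => ∑ p, |∑ n, a p n * x n|) (gaussPi N) :=
    integrable_finsetSum _ fun p _ => (integrable_linear (a p)).abs
  refine h.mono' (by fun_prop) (ae_of_all _ fun x => ?_)
  rw [norm_norm]
  refine (pi_norm_le_iff_of_nonneg (Finset.sum_nonneg fun _ _ => abs_nonneg _)).2 fun p => ?_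
  exact Finset.single_le_sum (f := fun p => |∑ n, a p n * x n|) (fun _ _ => abs_nonneg _)
    (Finset.mem_univ p)

lemma fderiv_apply_eq_sum [DecidableEq P] (T : (P → ℝ) →L[ℝ] ℝ) (v : P → ℝ) :
    T v = ∑ p, v p * T (Pi.single p 1) := by
  conv_lhs => rw [pi_eq_sum_univ' v]
  simp [map_sum]

/-- The derivative of the expectation of `F` along the path `cos θ • a + sin θ • b` of Gaussian
vectors, computed by Gaussian integration by parts. -/
lemma hasDerivAt_integral_interp [DecidableEq P] (a b : Matrix P N ℝ) {F : (P → ℝ) → ℝ}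
    (hF : BddC2 F) (θ : ℝ) :
    HasDerivAt (fun θ : ℝ => ∫ x, F ((Real.cos θ • a + Real.sin θ • b).mulVec x) ∂gaussPi N)
      (∑ p, ∑ q, ((-Real.sin θ • a + Real.cos θ • b) p ⬝ᵥ (Real.cos θ • a + Real.sin θ • b) q) *
        ∫ x, fderiv ℝ (fderiv ℝ F) ((Real.cos θ • a + Real.sin θ • b).mulVec x)
          (Pi.single q 1) (Pi.single p 1) ∂gaussPi N) θ := by
  obtain ⟨C, hC0, hC, hC1, hC2⟩ := hF.exists_bound
  have hFd : Differentiable ℝ F := hF.contDiff.differentiable (by norm_num)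
  have hF1 : ContDiff ℝ 1 (fderiv ℝ F) := hF.contDiff.fderiv_right (by norm_num)
  have hFdd : Differentiable ℝ (fderiv ℝ F) := hF1.differentiable (by norm_num)
  have hF2 : Continuous (fderiv ℝ (fderiv ℝ F)) := hF1.continuous_fderiv (by norm_num)
  set M : ℝ → Matrix P N ℝ := fun θ => Real.cos θ • a + Real.sin θ • b with hM
  set M' : ℝ → Matrix P N ℝ := fun θ => -Real.sin θ • a + Real.cos θ • b with hM'
  have hMd : ∀ (x : N → ℝ) (t : ℝ), HasDerivAt (fun t => (M t).mulVec x) ((M' t).mulVec x) t := by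
    intro x t
    have h := ((Real.hasDerivAt_cos t).smul_const (a.mulVec x)).add
      ((Real.hasDerivAt_sin t).smul_const (b.mulVec x))
    have e : (fun t => (M t).mulVec x) =
        (fun t => Real.cos t • a.mulVec x) + fun t => Real.sin t • b.mulVec x := by
      ext t; simp [M, Matrix.add_mulVec, Matrix.smul_mulVec]
    rw [e]
    refine h.congr_deriv ?_
    simp [M', Matrix.add_mulVec, Matrix.smul_mulVec, Matrix.neg_mulVec]
  have hcont : ∀ t, Continuous fun x : N → ℝ => (M t).mulVec x := fun t => by fun_prop
  have hcont' : ∀ t, Continuous fun x : N → ℝ => (M' t).mulVec x := fun t => by fun_prop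
  have key := (hasDerivAt_integral_of_dominated_loc_of_deriv_le (μ := gaussPi N) (𝕜 := ℝ)
    (F := fun t x => F ((M t).mulVec x))
    (F' := fun t x => fderiv ℝ F ((M t).mulVec x) ((M' t).mulVec x))
    (bound := fun x => C * (‖a.mulVec x‖ + ‖b.mulVec x‖)) (x₀ := θ) (s := Set.univ) univ_mem
    (Eventually.of_forall fun t => (hFd.continuous.comp (hcont t)).aestronglyMeasurable)
    (Integrable.of_bound (hFd.continuous.comp (hcont θ)).aestronglyMeasurable C
      (ae_of_all _ fun x => hC _))
    ((hF1.continuous.comp (hcont θ)).clm_apply (hcont' θ)).aestronglyMeasurable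
    (ae_of_all _ fun x t _ => ?_)
    (((integrable_mulVec_norm a).add (integrable_mulVec_norm b)).const_mul C)
    (ae_of_all _ fun x t _ => ?_)).2
  · refine key.congr_deriv ?_
    have e1 : ∀ x : N → ℝ, fderiv ℝ F ((M θ).mulVec x) ((M' θ).mulVec x) =
        ∑ p, (∑ n, M' θ p n * x n) * fderiv ℝ F ((M θ).mulVec x) (Pi.single p 1) := fun x =>
      fderiv_apply_eq_sum _ _
    have hc1 : ∀ p, Continuous fun x : N → ℝ => fderiv ℝ F ((M θ).mulVec x) (Pi.single p 1) :=
      fun p => (hF1.continuous.comp (hcont θ)).clm_apply continuous_const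
    have hn : ∀ p : P, ‖(Pi.single p 1 : P → ℝ)‖ ≤ 1 := fun p => by simp [Pi.norm_single]
    have hb1 : ∀ p (x : N → ℝ), |fderiv ℝ F ((M θ).mulVec x) (Pi.single p 1)| ≤ C := fun p x =>
      ((fderiv ℝ F ((M θ).mulVec x)).le_opNorm _).trans
        ((mul_le_mul (hC1 _) (hn p) (norm_nonneg _) hC0).trans (mul_one C).le)
    simp only [e1]
    rw [integral_finsetSum _ fun p _ => (integrable_linear (M' θ p)).mul_bdd
      (hc1 p).aestronglyMeasurable (ae_of_all _ (hb1 p))]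
    refine Finset.sum_congr rfl fun p _ => ?_
    have hc2 : ∀ q, Continuous fun x : N → ℝ =>
        fderiv ℝ (fderiv ℝ F) ((M θ).mulVec x) (Pi.single q 1) (Pi.single p 1) := fun q =>
      ((hF2.comp (hcont θ)).clm_apply continuous_const).clm_apply continuous_const
    have hb2 : ∀ q (x : N → ℝ),
        |fderiv ℝ (fderiv ℝ F) ((M θ).mulVec x) (Pi.single q 1) (Pi.single p 1)| ≤ C := by
      intro q x
      refine ((fderiv ℝ (fderiv ℝ F) ((M θ).mulVec x) (Pi.single q 1)).le_opNorm _).trans ?_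
      have := ((fderiv ℝ (fderiv ℝ F) ((M θ).mulVec x)).le_opNorm (Pi.single q 1)).trans
        ((mul_le_mul (hC2 _) (hn q) (norm_nonneg _) hC0).trans (mul_one C).le)
      exact (mul_le_mul this (hn p) (norm_nonneg _) hC0).trans (mul_one C).le
    have hD : ∀ x : N → ℝ, HasLineDerivAt ℝ
        (fun x : N → ℝ => fderiv ℝ F ((M θ).mulVec x) (Pi.single p 1))
        (∑ q, (M' θ p ⬝ᵥ M θ q) *
          fderiv ℝ (fderiv ℝ F) ((M θ).mulVec x) (Pi.single q 1) (Pi.single p 1)) x (M' θ p) := by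
      intro x
      have h1 : HasFDerivAt (fun x : N → ℝ => (M θ).mulVec x)
          (LinearMap.toContinuousLinearMap (M θ).mulVecLin) x :=
        (LinearMap.toContinuousLinearMap (M θ).mulVecLin).hasFDerivAt
      have h2 := ((hFdd ((M θ).mulVec x)).hasFDerivAt.comp x h1).clm_apply
        (hasFDerivAt_const (Pi.single p 1 : P → ℝ) x)
      have h3 := h2.hasLineDerivAt (M' θ p)
      convert! h3 using 1
      have h4 := congrArg (fun T => T (Pi.single p 1)) (map_sum
        (fderiv ℝ (fderiv ℝ F) ((M θ).mulVec x))
        (fun q => (M' θ p ⬝ᵥ M θ q) • (Pi.single q 1 : P → ℝ)) Finset.univ)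
      simp only [map_smul, sum_apply, smul_apply,
        smul_eq_mul] at h4
      rw [← h4]
      have h5 : ∑ q, (M' θ p ⬝ᵥ M θ q) • (Pi.single q 1 : P → ℝ) = (M θ).mulVec (M' θ p) := by
        ext q
        simp [Finset.sum_apply, Pi.single_apply, Matrix.mulVec, dotProduct_comm]
      simp [h5]
    have hc3 : Continuous fun x : N → ℝ => ∑ q, (M' θ p ⬝ᵥ M θ q) *
        fderiv ℝ (fderiv ℝ F) ((M θ).mulVec x) (Pi.single q 1) (Pi.single p 1) :=
      continuous_finsetSum _ fun q _ => (hc2 q).const_mul _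
    rw [integral_linear_mul (C := max C (∑ q, |M' θ p ⬝ᵥ M θ q| * C)) (M' θ p) (hc1 p) hc3 hD
      (fun x => (hb1 p x).trans (le_max_left _ _)) (fun x => ?_),
      integral_finsetSum _ fun q _ => (Integrable.of_bound (hc2 q).aestronglyMeasurable C
        (ae_of_all _ (hb2 q))).const_mul _]
    · exact Finset.sum_congr rfl fun q _ => integral_const_mul _ _
    · refine le_trans ?_ (le_max_right _ _)
      refine (Finset.abs_sum_le_sum_abs _ _).trans (Finset.sum_le_sum fun q _ => ?_)
      rw [abs_mul]
      exact mul_le_mul_of_nonneg_left (hb2 q x) (abs_nonneg _)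
  · refine (ContinuousLinearMap.le_opNorm _ _).trans ?_
    refine mul_le_mul (hC1 _) ?_ (norm_nonneg _) hC0
    simp only [M', Matrix.add_mulVec, Matrix.smul_mulVec]
    refine (norm_add_le _ _).trans (add_le_add ?_ ?_)
    · rw [norm_smul, norm_neg]
      exact mul_le_of_le_one_left (norm_nonneg _) (Real.abs_sin_le_one t)
    · rw [norm_smul]
      exact mul_le_of_le_one_left (norm_nonneg _) (Real.abs_cos_le_one t)
  · exact (hFd ((M t).mulVec x)).hasFDerivAt.comp_hasDerivAt t (hMd x t)

end Interpolation

lemma deriv_nonneg_of_nonneg_right {ψ : ℝ → ℝ} {d : ℝ} (h : HasDerivAt ψ d 0) (h0 : ψ 0 = 0)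
    (hψ : ∀ t, 0 ≤ t → 0 ≤ ψ t) : 0 ≤ d := by
  have h1 := (hasDerivAt_iff_tendsto_slope.1 h).mono_left
    (nhdsWithin_mono (0 : ℝ) (fun x (hx : x ∈ Set.Ioi (0 : ℝ)) => ne_of_gt hx))
  refine ge_of_tendsto h1 ?_
  filter_upwards [self_mem_nhdsWithin] with t ht
  rw [slope_def_field, h0, sub_zero, sub_zero]
  exact div_nonneg (hψ t (le_of_lt ht)) (le_of_lt ht)

/-- The mixed second derivative of a function with nonnegative mixed second differences is
nonnegative. -/
lemma fderiv_fderiv_nonneg {E : Type*} [NormedAddCommGroup E] [NormedSpace ℝ E] {F : E → ℝ}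
    (hF : ContDiff ℝ 2 F) {u v : E}
    (h : ∀ (z : E) (s t : ℝ), 0 ≤ s → 0 ≤ t → F (z + s • u) + F (z + t • v) ≤ F (z + s • u + t • v) + F z)
    (z : E) : 0 ≤ fderiv ℝ (fderiv ℝ F) z u v := by
  have hFd : Differentiable ℝ F := hF.differentiable (by norm_num)
  have hF1 : ContDiff ℝ 1 (fderiv ℝ F) := hF.fderiv_right (by norm_num)
  have hFdd : Differentiable ℝ (fderiv ℝ F) := hF1.differentiable (by norm_num)
  have hline : ∀ z w : E, ∀ t : ℝ, HasDerivAt (fun t : ℝ => z + t • w) w t := fun z w t => by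
    simpa using ((hasDerivAt_id t).smul_const w).const_add z
  have hFl : ∀ z w : E, HasDerivAt (fun t : ℝ => F (z + t • w)) (fderiv ℝ F z w) 0 := by
    intro z w
    have := (hFd (z + (0 : ℝ) • w)).hasFDerivAt.comp_hasDerivAt (0 : ℝ) (hline z w 0)
    rw [zero_smul, add_zero] at this
    exact this
  have step : ∀ s : ℝ, 0 ≤ s → 0 ≤ fderiv ℝ F (z + s • u) v - fderiv ℝ F z v := by
    intro s hs
    refine deriv_nonneg_of_nonneg_right
      (ψ := fun t : ℝ => F (z + s • u + t • v) - F (z + t • v) - (F (z + s • u) - F z))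
      (((hFl (z + s • u) v).sub (hFl z v)).sub_const (F (z + s • u) - F z)) (by simp) fun t ht => ?_
    have := h z s t hs ht
    linarith
  have hd : HasDerivAt (fun s : ℝ => fderiv ℝ F (z + s • u) v)
      (fderiv ℝ (fderiv ℝ F) z u v) 0 := by
    have h1 : HasDerivAt (fun s : ℝ => fderiv ℝ F (z + s • u)) (fderiv ℝ (fderiv ℝ F) z u) 0 := by
      have := (hFdd (z + (0 : ℝ) • u)).hasFDerivAt.comp_hasDerivAt (0 : ℝ) (hline z u 0)
      rw [zero_smul, add_zero] at this
      exact this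
    exact (ContinuousLinearMap.apply ℝ ℝ v).hasFDerivAt.comp_hasDerivAt (0 : ℝ) h1
  exact deriv_nonneg_of_nonneg_right (ψ := fun s : ℝ => fderiv ℝ F (z + s • u) v - fderiv ℝ F z v)
    (hd.sub_const (fderiv ℝ F z v)) (by simp) step

lemma minMaxTest_factor_mem {I J : Type*} [Fintype J] (c : I → J → ℝ) (ε : ℝ) (z : I × J → ℝ) (i : I) :
    0 ≤ (1 - ∏ j, (1 - smoothStep (c i j) ε (z (i, j)))) ∧
      (1 - ∏ j, (1 - smoothStep (c i j) ε (z (i, j)))) ≤ 1 := by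
  have h0 : ∀ j, 0 ≤ 1 - smoothStep (c i j) ε (z (i, j)) := fun j =>
    sub_nonneg.2 (smoothStep_le_one _ _ _)
  have h1 : ∀ j, 1 - smoothStep (c i j) ε (z (i, j)) ≤ 1 := fun j =>
    sub_le_self _ (smoothStep_nonneg _ _ _)
  exact ⟨sub_nonneg.2 (Finset.prod_le_one (fun j _ => h0 j) fun j _ => h1 j),
    sub_le_self _ (Finset.prod_nonneg fun j _ => h0 j)⟩

section Comparison

variable {I J N : Type*} [Fintype I] [Fintype J] [Fintype N]

/-- A smooth version of the indicator of `{z | ∀ i, ∃ j, c i j ≤ z (i, j)}`. -/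
noncomputable def minMaxTest (c : I → J → ℝ) (ε : ℝ) (z : I × J → ℝ) : ℝ :=
  ∏ i, (1 - ∏ j, (1 - smoothStep (c i j) ε (z (i, j))))

lemma bddC2_minMaxTest (c : I → J → ℝ) {ε : ℝ} (hε : 0 < ε) : BddC2 (minMaxTest c ε) := by
  refine BddC2.prod _ fun i _ => (BddC2.const 1).sub (BddC2.prod _ fun j _ =>
    (BddC2.const 1).sub ?_)
  exact (bddC2_smoothStep (c i j) hε).comp_clm
    (ContinuousLinearMap.proj (R := ℝ) (φ := fun _ : I × J => ℝ) (i, j))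

lemma minMaxTest_nonneg (c : I → J → ℝ) (ε : ℝ) (z : I × J → ℝ) : 0 ≤ minMaxTest c ε z :=
  Finset.prod_nonneg fun i _ => (minMaxTest_factor_mem c ε z i).1

lemma minMaxTest_le_one (c : I → J → ℝ) (ε : ℝ) (z : I × J → ℝ) : minMaxTest c ε z ≤ 1 :=
  Finset.prod_le_one (fun i _ => (minMaxTest_factor_mem c ε z i).1)
    fun i _ => (minMaxTest_factor_mem c ε z i).2

lemma minMaxTest_eq_one (c : I → J → ℝ) {ε : ℝ} (hε : 0 < ε) {z : I × J → ℝ}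
    (hz : ∀ i, ∃ j, c i j + ε ≤ z (i, j)) : minMaxTest c ε z = 1 := by
  refine Finset.prod_eq_one fun i _ => ?_
  obtain ⟨j, hj⟩ := hz i
  rw [Finset.prod_eq_zero (Finset.mem_univ j), sub_zero]
  rw [smoothStep, Real.smoothTransition.one_of_one_le ((one_le_div hε).2 (by linarith)), sub_self]

lemma minMaxTest_eq_zero (c : I → J → ℝ) {ε : ℝ} (hε : 0 < ε) {z : I × J → ℝ}
    (hz : ¬ ∀ i, ∃ j, c i j ≤ z (i, j)) : minMaxTest c ε z = 0 := by
  push Not at hz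
  obtain ⟨i, hi⟩ := hz
  refine Finset.prod_eq_zero (Finset.mem_univ i) ?_
  rw [Finset.prod_eq_one, sub_self]
  intro j _
  rw [smoothStep, Real.smoothTransition.zero_of_nonpos
    (div_nonpos_of_nonpos_of_nonneg (by linarith [hi j]) hε.le), sub_zero]

/-- The mixed second differences of `minMaxTest` in coordinates of two different blocks are
nonnegative: it is a product over the blocks of monotone nonnegative functions. -/
lemma minMaxTest_supermodular [DecidableEq I] [DecidableEq J] (c : I → J → ℝ) {ε : ℝ} (hε : 0 < ε)
    {p q : I × J} (hpq : p.1 ≠ q.1) (z : I × J → ℝ) {s t : ℝ} (hs : 0 ≤ s) (ht : 0 ≤ t) :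
    minMaxTest c ε (z + s • Pi.single p 1) + minMaxTest c ε (z + t • Pi.single q 1) ≤
      minMaxTest c ε (z + s • Pi.single p 1 + t • Pi.single q 1) + minMaxTest c ε z := by
  set φ : I → (I × J → ℝ) → ℝ := fun i z => 1 - ∏ j, (1 - smoothStep (c i j) ε (z (i, j))) with hφ
  have hmono : ∀ i z w, z ≤ w → φ i z ≤ φ i w := by
    intro i z w hzw
    refine sub_le_sub_left (Finset.prod_le_prod
      (fun j _ => sub_nonneg.2 (smoothStep_le_one _ _ _)) fun j _ => ?_) _
    exact sub_le_sub_left (smoothStep_mono _ hε (hzw (i, j))) _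
  have hloc : ∀ i (z w : I × J → ℝ), (∀ j, z (i, j) = w (i, j)) → φ i z = φ i w := by
    intro i z w h
    simp only [hφ, h]
  have hne : ∀ (p : I × J) (i : I), i ≠ p.1 → ∀ (z : I × J → ℝ) (s : ℝ),
      φ i (z + s • Pi.single p 1) = φ i z := by
    intro p i hi z s
    refine hloc i _ _ fun j => ?_
    have : (i, j) ≠ p := fun h => hi (by rw [← h])
    simp [Pi.single_eq_of_ne this]
  let R : (I × J → ℝ) → ℝ := fun z => ∏ i ∈ (Finset.univ.erase p.1).erase q.1, φ i z
  have hfac : ∀ z, minMaxTest c ε z =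
      φ p.1 z * (φ q.1 z * R z) := by
    intro z
    simp only [R]
    rw [Finset.mul_prod_erase _ (fun i => φ i z)
      (Finset.mem_erase.2 ⟨hpq.symm, Finset.mem_univ _⟩),
      Finset.mul_prod_erase _ (fun i => φ i z) (Finset.mem_univ _)]
    rfl
  have hRp : ∀ z s, R (z + s • Pi.single p 1) = R z := fun z s =>
    Finset.prod_congr rfl fun i hi =>
      hne p i (Finset.ne_of_mem_erase (Finset.mem_of_mem_erase hi)) z s
  have hRq : ∀ z s, R (z + s • Pi.single q 1) = R z := fun z s =>
    Finset.prod_congr rfl fun i hi => hne q i (Finset.ne_of_mem_erase hi) z s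
  have hR0 : 0 ≤ R z := Finset.prod_nonneg fun i _ => (minMaxTest_factor_mem c ε z i).1
  have e1 : φ p.1 (z + s • Pi.single p 1 + t • Pi.single q 1) = φ p.1 (z + s • Pi.single p 1) :=
    hne q p.1 hpq _ _
  have e2 : φ q.1 (z + s • Pi.single p 1 + t • Pi.single q 1) = φ q.1 (z + t • Pi.single q 1) := by
    rw [add_right_comm]; exact hne p q.1 hpq.symm _ _
  simp only [hfac, hRp, hRq, e1, e2, hne q p.1 hpq, hne p q.1 hpq.symm]
  have hsp : z ≤ z + s • (Pi.single p 1 : I × J → ℝ) :=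
    le_add_of_nonneg_right (smul_nonneg hs (Pi.single_nonneg.2 zero_le_one))
  have htq : z ≤ z + t • (Pi.single q 1 : I × J → ℝ) :=
    le_add_of_nonneg_right (smul_nonneg ht (Pi.single_nonneg.2 zero_le_one))
  have h1 := sub_nonneg.2 (hmono p.1 _ _ hsp)
  have h2 := sub_nonneg.2 (hmono q.1 _ _ htq)
  have := mul_nonneg (mul_nonneg h1 h2) hR0
  nlinarith [this]

/-- **Gordon's comparison inequality** for families `a`, `b` of Gaussian variables indexed by
`I × J`, realized as linear forms on a Gaussian space with `a` independent of `b`: if the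
covariances agree inside each block `{i} × J` and those of `a` dominate across blocks, then
`min_i max_j a` is stochastically larger than `min_i max_j b`. -/
theorem gordon_comparison (a b : Matrix (I × J) N ℝ) (hab : ∀ p q, a p ⬝ᵥ b q = 0)
    (hblock : ∀ i j l, a (i, j) ⬝ᵥ a (i, l) = b (i, j) ⬝ᵥ b (i, l))
    (hcross : ∀ p q, b p ⬝ᵥ b q ≤ a p ⬝ᵥ a q) (c : I → J → ℝ) {ε : ℝ} (hε : 0 < ε) :
    gaussPi N {x | ∀ i, ∃ j, c i j + ε ≤ b.mulVec x (i, j)} ≤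
      gaussPi N {x | ∀ i, ∃ j, c i j ≤ a.mulVec x (i, j)} := by
  classical
  set F := minMaxTest c ε
  have hF : BddC2 F := bddC2_minMaxTest c hε
  set f : ℝ → ℝ := fun θ => ∫ x, F ((Real.cos θ • a + Real.sin θ • b).mulVec x) ∂gaussPi N with hf
  have hder := fun θ => hasDerivAt_integral_interp a b hF θ
  have hanti : AntitoneOn f (Set.Icc 0 (Real.pi / 2)) := by
    refine antitoneOn_of_deriv_nonpos (convex_Icc _ _)
      (fun θ _ => (hder θ).continuousAt.continuousWithinAt)
      (fun θ _ => (hder θ).differentiableAt.differentiableWithinAt) fun θ hθ => ?_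
    rw [interior_Icc] at hθ
    rw [(hder θ).deriv]
    have hs : 0 ≤ Real.sin θ :=
      Real.sin_nonneg_of_nonneg_of_le_pi hθ.1.le (by linarith [hθ.2, Real.pi_pos])
    have hc : 0 ≤ Real.cos θ :=
      Real.cos_nonneg_of_neg_pi_div_two_le_of_le (by linarith [hθ.1, Real.pi_pos]) hθ.2.le
    refine Finset.sum_nonpos fun p _ => Finset.sum_nonpos fun q _ => ?_
    have hcov : (-Real.sin θ • a + Real.cos θ • b) p ⬝ᵥ (Real.cos θ • a + Real.sin θ • b) q =
        Real.sin θ * Real.cos θ * (b p ⬝ᵥ b q - a p ⬝ᵥ a q) := by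
      have e1 : (-Real.sin θ • a + Real.cos θ • b) p = -Real.sin θ • a p + Real.cos θ • b p := rfl
      have e2 : (Real.cos θ • a + Real.sin θ • b) q = Real.cos θ • a q + Real.sin θ • b q := rfl
      have e3 : b p ⬝ᵥ a q = 0 := by rw [dotProduct_comm]; exact hab q p
      rw [e1, e2]
      simp only [add_dotProduct, dotProduct_add, smul_dotProduct, dotProduct_smul, hab, e3,
        smul_eq_mul]
      ring
    rw [hcov]
    by_cases hpq : p.1 = q.1
    · have : b p ⬝ᵥ b q - a p ⬝ᵥ a q = 0 := by
        obtain ⟨i, j⟩ := p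
        obtain ⟨k, l⟩ := q
        obtain rfl : i = k := hpq
        rw [hblock, sub_self]
      simp [this]
    · refine mul_nonpos_of_nonpos_of_nonneg (mul_nonpos_of_nonneg_of_nonpos (mul_nonneg hs hc)
        (sub_nonpos.2 (hcross p q))) (integral_nonneg fun x => ?_)
      refine fderiv_fderiv_nonneg (u := Pi.single q 1) (v := Pi.single p 1) hF.contDiff
        (fun z s t hs ht => ?_) _
      exact minMaxTest_supermodular c hε (Ne.symm hpq) z hs ht
  have hle : f (Real.pi / 2) ≤ f 0 := hanti ⟨le_rfl, by positivity⟩ ⟨by positivity, le_rfl⟩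
    (by positivity)
  simp only [hf, Real.cos_pi_div_two, Real.sin_pi_div_two, Real.cos_zero, Real.sin_zero,
    zero_smul, one_smul, zero_add, add_zero] at hle
  have hmeas : ∀ (d : I → J → ℝ) (M : Matrix (I × J) N ℝ),
      MeasurableSet {x : N → ℝ | ∀ i, ∃ j, d i j ≤ M.mulVec x (i, j)} := by
    intro d M
    simp only [Set.ofPred_forall, Set.ofPred_exists]
    refine MeasurableSet.iInter fun i => MeasurableSet.iUnion fun j => ?_
    refine measurableSet_le measurable_const ?_
    have : Continuous fun x : N → ℝ => M.mulVec x (i, j) := by fun_prop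
    exact this.measurable
  have hint : ∀ M : Matrix (I × J) N ℝ, Integrable (fun x => F (M.mulVec x)) (gaussPi N) := by
    intro M
    refine Integrable.of_bound (C := 1) (Continuous.aestronglyMeasurable
      (hF.contDiff.continuous.comp (by fun_prop))) (ae_of_all _ fun x => ?_)
    rw [Real.norm_eq_abs, abs_of_nonneg (minMaxTest_nonneg _ _ _)]
    exact minMaxTest_le_one _ _ _
  have h1 : (gaussPi N).real {x | ∀ i, ∃ j, c i j + ε ≤ b.mulVec x (i, j)} ≤
      ∫ x, F (b.mulVec x) ∂gaussPi N := by
    rw [← integral_indicator_one (hmeas (fun i j => c i j + ε) b)]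
    refine integral_mono ((integrable_const 1).indicator (hmeas _ b)) (hint b) fun x => ?_
    by_cases hx : x ∈ {x | ∀ i, ∃ j, c i j + ε ≤ b.mulVec x (i, j)}
    · rw [Set.indicator_of_mem hx]
      exact (minMaxTest_eq_one c hε hx).ge
    · rw [Set.indicator_of_notMem hx]
      exact minMaxTest_nonneg _ _ _
  have h2 : ∫ x, F (a.mulVec x) ∂gaussPi N ≤
      (gaussPi N).real {x | ∀ i, ∃ j, c i j ≤ a.mulVec x (i, j)} := by
    rw [← integral_indicator_one (hmeas c a)]
    refine integral_mono (hint a) ((integrable_const 1).indicator (hmeas _ a)) fun x => ?_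
    by_cases hx : x ∈ {x | ∀ i, ∃ j, c i j ≤ a.mulVec x (i, j)}
    · rw [Set.indicator_of_mem hx]
      exact minMaxTest_le_one _ _ _
    · rw [Set.indicator_of_notMem hx]
      exact (minMaxTest_eq_zero c hε hx).le
  exact (ENNReal.toReal_le_toReal (measure_ne_top _ _) (measure_ne_top _ _)).1
    (h1.trans (hle.trans h2))

end Comparison

/-! ### Gordon's inequality for bilinear forms -/

lemma measurePreserving_gaussPi_sum (ι κ : Type*) [Fintype ι] [Fintype κ] :
    MeasurePreserving (fun x : ι ⊕ κ → ℝ => (fun i => x (Sum.inl i), fun k => x (Sum.inr k)))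
      (gaussPi (ι ⊕ κ)) ((gaussPi ι).prod (gaussPi κ)) :=
  measurePreserving_sumPiEquivProdPi (X := fun _ : ι ⊕ κ => ℝ) fun _ => gaussianReal 0 1

lemma half_le_gaussPi_nonpos : (2 : ENNReal)⁻¹ ≤ gaussPi Unit {x | x () ≤ 0} := by
  have h1 : gaussPi Unit {x | x () ≤ 0} = gaussianReal 0 1 (Set.Iic 0) := by
    have h := measurePreserving_eval (fun _ : Unit => gaussianReal 0 1) ()
    exact (h.measure_preimage measurableSet_Iic.nullMeasurableSet)
  have h2 : gaussianReal 0 1 (Set.Ici 0) = gaussianReal 0 1 (Set.Iic 0) := by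
    have h := gaussianReal_map_neg (μ := 0) (v := 1)
    rw [neg_zero] at h
    conv_rhs => rw [← h]
    rw [Measure.map_apply measurable_neg measurableSet_Iic]
    congr 1; ext x; simp
  have h3 : (1 : ENNReal) ≤ gaussianReal 0 1 (Set.Iic 0) + gaussianReal 0 1 (Set.Ici 0) := by
    rw [← measure_univ (μ := gaussianReal 0 1), ← Set.Iic_union_Ici (a := (0 : ℝ))]
    exact measure_union_le _ _
  rw [h1]
  rw [h2, ← two_mul] at h3
  rwa [ENNReal.inv_le_iff_le_mul (by simp) (by simp)]

section Bilinear

variable {α β : Type*} [Fintype α] [Fintype β]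

/-- The coefficients of `xᵀ G y + ‖x‖ ‖y‖ γ` in the independent Gaussian family `(G, γ, h, k)`. -/
noncomputable def gordonPrimal (x : EuclideanSpace ℝ α) (y : EuclideanSpace ℝ β) :
    ((α × β) ⊕ Unit) ⊕ (α ⊕ β) → ℝ :=
  Sum.elim (Sum.elim (fun p => x p.1 * y p.2) fun _ => ‖x‖ * ‖y‖) 0

/-- The coefficients of `‖y‖ xᵀ h + ‖x‖ yᵀ k` in the independent Gaussian family
`(G, γ, h, k)`. -/
noncomputable def gordonAux (x : EuclideanSpace ℝ α) (y : EuclideanSpace ℝ β) :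
    ((α × β) ⊕ Unit) ⊕ (α ⊕ β) → ℝ :=
  Sum.elim 0 (Sum.elim (fun a => ‖y‖ * x a) fun b => ‖x‖ * y b)

lemma inner_eq_sum {ι : Type*} [Fintype ι] (x y : EuclideanSpace ℝ ι) :
    ⟪x, y⟫ = ∑ i, x i * y i := by
  simp [PiLp.inner_apply, mul_comm]

lemma gordonPrimal_dot (x x' : EuclideanSpace ℝ α) (y y' : EuclideanSpace ℝ β) :
    gordonPrimal x y ⬝ᵥ gordonPrimal x' y' =
      ⟪x, x'⟫ * ⟪y, y'⟫ + ‖x‖ * ‖y‖ * (‖x'‖ * ‖y'‖) := by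
  simp only [gordonPrimal, dotProduct, Fintype.sum_sum_type, Fintype.sum_prod_type, Sum.elim_inl,
    Sum.elim_inr, inner_eq_sum, Finset.sum_mul_sum]
  simp [mul_mul_mul_comm]

lemma gordonAux_dot (x x' : EuclideanSpace ℝ α) (y y' : EuclideanSpace ℝ β) :
    gordonAux x y ⬝ᵥ gordonAux x' y' =
      ‖y‖ * ‖y'‖ * ⟪x, x'⟫ + ‖x‖ * ‖x'‖ * ⟪y, y'⟫ := by
  simp only [gordonAux, dotProduct, Fintype.sum_sum_type, Sum.elim_inl,
    Sum.elim_inr, inner_eq_sum, Finset.mul_sum]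
  simp [mul_mul_mul_comm]

lemma gordonPrimal_dot_aux (x x' : EuclideanSpace ℝ α) (y y' : EuclideanSpace ℝ β) :
    gordonPrimal x y ⬝ᵥ gordonAux x' y' = 0 := by
  simp [gordonPrimal, gordonAux, dotProduct, Fintype.sum_sum_type]

/-- The bilinear form `xᵀ G y`. -/
noncomputable def bilin (G : α × β → ℝ) (x : EuclideanSpace ℝ α) (y : EuclideanSpace ℝ β) : ℝ :=
  ∑ p : α × β, x p.1 * y p.2 * G p

/-- The Gaussian form `‖y‖ xᵀ h + ‖x‖ yᵀ k` with which Gordon's inequality compares `xᵀ G y`. -/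
noncomputable def auxForm (h : α → ℝ) (k : β → ℝ) (x : EuclideanSpace ℝ α)
    (y : EuclideanSpace ℝ β) : ℝ :=
  ‖y‖ * (∑ a, x a * h a) + ‖x‖ * ∑ b, y b * k b

/-- Gordon's inequality for finite families. With the extra independent term `‖x‖ ‖y‖ γ` the two
processes have equal variances, and the difference of their covariances is
`(‖x‖ ‖x'‖ - ⟪x, x'⟫) (‖y‖ ‖y'‖ - ⟪y, y'⟫)`. The extra term is then removed by conditioning on
`γ ≤ 0`, an event of probability one half. -/
lemma gordon_bilinear_finite {I J : Type*} [Fintype I] [Fintype J]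
    (x : I → J → EuclideanSpace ℝ α) (y : I → J → EuclideanSpace ℝ β)
    (hxy : ∀ i j l, x i j = x i l ∨ y i j = y i l) (c : I → J → ℝ) {ε : ℝ} (hε : 0 < ε) :
    gaussPi (α × β) {G | ∃ i, ∀ j, bilin G (x i j) (y i j) < c i j} ≤
      2 * ((gaussPi α).prod (gaussPi β))
        {hk | ∃ i, ∀ j, auxForm hk.1 hk.2 (x i j) (y i j) < c i j + ε} := by
  set a : Matrix (I × J) (((α × β) ⊕ Unit) ⊕ (α ⊕ β)) ℝ :=
    fun p => gordonPrimal (x p.1 p.2) (y p.1 p.2) with ha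
  set b : Matrix (I × J) (((α × β) ⊕ Unit) ⊕ (α ⊕ β)) ℝ :=
    fun p => gordonAux (x p.1 p.2) (y p.1 p.2) with hb
  have key := gordon_comparison a b (fun p q => gordonPrimal_dot_aux _ _ _ _)
    (fun i j l => by
      simp only [ha, hb, gordonPrimal_dot, gordonAux_dot]
      rcases hxy i j l with h | h <;> rw [h] <;> simp only [real_inner_self_eq_norm_mul_norm] <;>
        ring)
    (fun p q => by
      simp only [ha, hb, gordonPrimal_dot, gordonAux_dot]
      have h1 := sub_nonneg.2 (real_inner_le_norm (x p.1 p.2) (x q.1 q.2))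
      have h2 := sub_nonneg.2 (real_inner_le_norm (y p.1 p.2) (y q.1 q.2))
      nlinarith [mul_nonneg h1 h2]) c hε
  have hae : ∀ z i j, a.mulVec z (i, j) =
      bilin (fun p => z (Sum.inl (Sum.inl p))) (x i j) (y i j) +
        ‖x i j‖ * ‖y i j‖ * z (Sum.inl (Sum.inr ())) := by
    intro z i j
    simp [ha, Matrix.mulVec, dotProduct, Fintype.sum_sum_type, gordonPrimal, bilin]
  have hbe : ∀ z i j, b.mulVec z (i, j) =
      auxForm (fun p => z (Sum.inr (Sum.inl p))) (fun p => z (Sum.inr (Sum.inr p)))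
        (x i j) (y i j) := by
    intro z i j
    simp [hb, Matrix.mulVec, dotProduct, Fintype.sum_sum_type, gordonAux, auxForm,
      Finset.mul_sum, mul_assoc]
  have hmeas : ∀ (d : I → J → ℝ)
      (M : Matrix (I × J) (((α × β) ⊕ Unit) ⊕ (α ⊕ β)) ℝ),
      MeasurableSet {x : (((α × β) ⊕ Unit) ⊕ (α ⊕ β)) → ℝ | ∀ i, ∃ j, d i j ≤ M.mulVec x (i, j)} := by
    intro d M
    simp only [Set.ofPred_forall, Set.ofPred_exists]
    refine MeasurableSet.iInter fun i => MeasurableSet.iUnion fun j => ?_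
    refine measurableSet_le measurable_const ?_
    have : Continuous fun x : (((α × β) ⊕ Unit) ⊕ (α ⊕ β)) → ℝ => M.mulVec x (i, j) := by fun_prop
    exact this.measurable
  have hcompl := (prob_compl_le_one_sub_of_le_prob key (hmeas c a)).trans_eq
    (prob_compl_eq_one_sub (hmeas (fun i j => c i j + ε) b)).symm
  have mp := measurePreserving_gaussPi_sum ((α × β) ⊕ Unit) (α ⊕ β)
  have mpa := (measurePreserving_gaussPi_sum (α × β) Unit).comp
    ((measurePreserving_fst (μ := gaussPi ((α × β) ⊕ Unit)) (ν := gaussPi (α ⊕ β))).comp mp)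
  have mpb := (measurePreserving_gaussPi_sum α β).comp
    ((measurePreserving_snd (μ := gaussPi ((α × β) ⊕ Unit)) (ν := gaussPi (α ⊕ β))).comp mp)
  have hmB : MeasurableSet {hk : (α → ℝ) × (β → ℝ) |
      ∃ i, ∀ j, auxForm hk.1 hk.2 (x i j) (y i j) < c i j + ε} := by
    simp only [Set.ofPred_forall, Set.ofPred_exists]
    refine MeasurableSet.iUnion fun i => MeasurableSet.iInter fun j => ?_
    refine measurableSet_lt (Continuous.measurable ?_) measurable_const
    unfold auxForm
    fun_prop
  have hmG : MeasurableSet {G : α × β → ℝ | ∃ i, ∀ j, bilin G (x i j) (y i j) < c i j} := by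
    simp only [Set.ofPred_forall, Set.ofPred_exists]
    refine MeasurableSet.iUnion fun i => MeasurableSet.iInter fun j => ?_
    refine measurableSet_lt (Continuous.measurable ?_) measurable_const
    unfold bilin
    fun_prop
  have hmU : MeasurableSet {u : Unit → ℝ | u () ≤ 0} :=
    measurableSet_le (measurable_pi_apply ()) measurable_const
  have hB : gaussPi (((α × β) ⊕ Unit) ⊕ (α ⊕ β))
      {z | ∀ i, ∃ j, c i j + ε ≤ b.mulVec z (i, j)}ᶜ = ((gaussPi α).prod (gaussPi β))
        {hk | ∃ i, ∀ j, auxForm hk.1 hk.2 (x i j) (y i j) < c i j + ε} := by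
    rw [← mpb.measure_preimage hmB.nullMeasurableSet]
    congr 1; ext z
    simp [hbe]
  have hA : gaussPi (α × β) {G | ∃ i, ∀ j, bilin G (x i j) (y i j) < c i j} *
      gaussPi Unit {u | u () ≤ 0} ≤ gaussPi (((α × β) ⊕ Unit) ⊕ (α ⊕ β))
      {z | ∀ i, ∃ j, c i j ≤ a.mulVec z (i, j)}ᶜ := by
    rw [← Measure.prod_prod, ← mpa.measure_preimage (hmG.prod hmU).nullMeasurableSet]
    refine measure_mono fun z hz => ?_
    obtain ⟨⟨i, hi⟩, hu⟩ := hz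
    simp only [Set.mem_compl_iff, Set.mem_ofPred_eq, not_forall, not_exists, not_le]
    refine ⟨i, fun j => ?_⟩
    rw [hae]
    have h1 := hi j
    have h2 : z (Sum.inl (Sum.inr ())) ≤ 0 := hu
    have h3 := mul_nonpos_of_nonneg_of_nonpos
      (mul_nonneg (norm_nonneg (x i j)) (norm_nonneg (y i j))) h2
    simp only [Function.comp] at h1
    linarith
  have hfin := (mul_le_mul_right half_le_gaussPi_nonpos _).trans (hA.trans (hcompl.trans_eq hB))
  rw [mul_comm, ENNReal.inv_mul_le_iff (by simp) (by simp)] at hfin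
  exact hfin

/-- Gordon's inequality for `min_i max_j xᵢⱼᵀ G yᵢⱼ`, over countable families in which one of the
two vectors depends on `i` only. The factor `2` is the price of removing the independent term
`‖x‖ ‖y‖ γ` from the bilinear process. -/
theorem gordon_bilinear (x : ℕ → ℕ → EuclideanSpace ℝ α) (y : ℕ → ℕ → EuclideanSpace ℝ β)
    (hxy : ∀ i j l, x i j = x i l ∨ y i j = y i l) (c : ℕ → ℕ → ℝ) {ε : ℝ} (hε : 0 < ε) :
    gaussPi (α × β) {G | ∃ i, ∀ j, bilin G (x i j) (y i j) < c i j} ≤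
      2 * ((gaussPi α).prod (gaussPi β))
        {hk | ∃ i, ∀ j, auxForm hk.1 hk.2 (x i j) (y i j) < c i j + ε} := by
  set ν := (gaussPi α).prod (gaussPi β)
  have hM : ∀ M : ℕ, gaussPi (α × β) {G | ∃ i < M, ∀ j, bilin G (x i j) (y i j) < c i j} ≤
      2 * ν {hk | ∃ i, ∀ j, auxForm hk.1 hk.2 (x i j) (y i j) < c i j + ε} := by
    intro M
    set S : ℕ → Set ((α → ℝ) × (β → ℝ)) := fun N =>
      {hk | ∃ i < M, ∀ j < N, auxForm hk.1 hk.2 (x i j) (y i j) < c i j + ε} with hS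
    have hSanti : Antitone S := fun N N' hN hk ⟨i, hi, h⟩ => ⟨i, hi, fun j hj => h j (hj.trans_le hN)⟩
    have hSm : ∀ N, MeasurableSet (S N) := by
      intro N
      have hcont : ∀ i j, Continuous fun hk : (α → ℝ) × (β → ℝ) =>
          auxForm hk.1 hk.2 (x i j) (y i j) := by
        intro i j; unfold auxForm; fun_prop
      have : S N = ⋃ i ∈ Finset.range M, ⋂ j ∈ Finset.range N,
          {hk | auxForm hk.1 hk.2 (x i j) (y i j) < c i j + ε} := by
        ext hk; simp [hS]
      rw [this]
      exact Finset.measurableSet_biUnion _ fun i _ => Finset.measurableSet_biInter _ fun j _ =>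
        measurableSet_lt (hcont i j).measurable measurable_const
    have hN : ∀ N : ℕ, gaussPi (α × β) {G | ∃ i < M, ∀ j, bilin G (x i j) (y i j) < c i j} ≤
        2 * ν (S N) := by
      intro N
      have := gordon_bilinear_finite (I := Fin M) (J := Fin N) (fun i j => x i j) (fun i j => y i j)
        (fun i j l => hxy i j l) (fun i j => c i j) hε
      refine (measure_mono ?_).trans (this.trans ?_)
      · rintro G ⟨i, hi, h⟩
        exact ⟨⟨i, hi⟩, fun j => h j⟩
      · gcongr
        rintro hk ⟨i, h⟩
        exact ⟨i, i.2, fun j hj => h ⟨j, hj⟩⟩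
    have hlim := tendsto_measure_iInter_atTop (μ := ν) (s := S)
      (fun N => (hSm N).nullMeasurableSet) hSanti ⟨0, measure_ne_top _ _⟩
    have h2 := ge_of_tendsto' (ENNReal.Tendsto.const_mul hlim (Or.inr (by simp))) hN
    refine h2.trans ?_
    gcongr
    intro hk hhk
    by_contra hcon
    simp only [Set.mem_ofPred_eq, not_exists, not_forall, not_lt] at hcon
    choose J hJ using hcon
    -- one `N` beyond the finitely many witnesses `J i`, `i < M`
    obtain ⟨i, hi, h⟩ := Set.mem_iInter.1 hhk ((Finset.range M).sup J + 1)
    exact absurd (h (J i) (Nat.lt_succ_of_le (Finset.le_sup (Finset.mem_range.2 hi))))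
      (not_lt.2 (hJ i))
  set T : ℕ → Set (α × β → ℝ) := fun M =>
    {G | ∃ i < M, ∀ j, bilin G (x i j) (y i j) < c i j} with hT
  have hTmono : Monotone T := fun N N' hN G ⟨i, hi, h⟩ => ⟨i, hi.trans_le hN, h⟩
  have hlim := tendsto_measure_iUnion_atTop (μ := gaussPi (α × β)) hTmono
  refine le_trans (measure_mono ?_) (le_of_tendsto' hlim hM)
  rintro G ⟨i, h⟩
  exact Set.mem_iUnion.2 ⟨i + 1, i, Nat.lt_succ_self i, h⟩

end Bilinear

/-! ### The mean square violation of a random constraint -/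

/-- The amount by which `|v|` exceeds `|q|`. -/
def overshoot (q v : ℝ) : ℝ := max (|v| - |q|) 0

lemma overshoot_nonneg (q v : ℝ) : 0 ≤ overshoot q v := le_max_right _ _

/-- The mean square violation `E (|s q + r z| - |q|)₊²` of the constraint `|s q + r z| ≤ |q|`, for
independent standard Gaussian `q` and `z`. -/
noncomputable def meanSq (s r : ℝ) : ℝ :=
  ∫ z : ℝ × ℝ, overshoot z.1 (s * z.1 + r * z.2) ^ 2 ∂(gaussianReal 0 1).prod (gaussianReal 0 1)

lemma integral_gaussian_prod (f : ℝ × ℝ → ℝ) :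
    ∫ z, f z ∂(gaussianReal 0 1).prod (gaussianReal 0 1) =
      ∫ z : ℝ × ℝ, (2 * Real.pi)⁻¹ * Real.exp (-(z.1 ^ 2 + z.2 ^ 2) / 2) * f z := by
  rw [gaussianReal_of_var_ne_zero 0 one_ne_zero,
    prod_withDensity (measurable_gaussianPDF 0 1) (measurable_gaussianPDF 0 1),
    integral_withDensity_eq_integral_toReal_smul]
  · refine integral_congr_ae (ae_of_all _ fun z => ?_)
    simp only [ENNReal.toReal_mul, toReal_gaussianPDF, gaussianPDFReal, smul_eq_mul]
    congr 1
    rw [mul_mul_mul_comm, ← Real.exp_add, ← mul_inv, Real.mul_self_sqrt (by positivity)]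
    simp only [NNReal.coe_one, mul_one, sub_zero]
    congr 2
    ring
  · exact ((measurable_gaussianPDF 0 1).comp measurable_fst).mul
      ((measurable_gaussianPDF 0 1).comp measurable_snd)
  · exact ae_of_all _ fun z => ENNReal.mul_lt_top gaussianPDF_lt_top gaussianPDF_lt_top

/-- The Gaussian mean of a function homogeneous of degree two, in polar coordinates. -/
lemma integral_gaussian_prod_of_homogeneous (f : ℝ × ℝ → ℝ)
    (hf : ∀ R : ℝ, 0 < R → ∀ x y : ℝ, f (R * x, R * y) = R ^ 2 * f (x, y)) :
    ∫ z, f z ∂(gaussianReal 0 1).prod (gaussianReal 0 1) =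
      Real.pi⁻¹ * ∫ θ in (-Real.pi)..Real.pi, f (Real.cos θ, Real.sin θ) := by
  rw [integral_gaussian_prod, ← integral_comp_polarCoord_symm, polarCoord_target]
  have h1 : ∀ p ∈ Set.Ioi (0 : ℝ) ×ˢ Set.Ioo (-Real.pi) Real.pi,
      p.1 • ((2 * Real.pi)⁻¹ * Real.exp (-((polarCoord.symm p).1 ^ 2 + (polarCoord.symm p).2 ^ 2) / 2)
        * f (polarCoord.symm p)) =
      (p.1 ^ (3 : ℝ) * Real.exp (-(1 / 2) * p.1 ^ (2 : ℝ))) *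
        ((2 * Real.pi)⁻¹ * f (Real.cos p.2, Real.sin p.2)) := by
    rintro ⟨R, θ⟩ ⟨hR, -⟩
    simp only [polarCoord_symm_apply, smul_eq_mul]
    rw [hf R hR]
    have e : -((R * Real.cos θ) ^ 2 + (R * Real.sin θ) ^ 2) / 2 = -(1 / 2) * R ^ (2 : ℝ) := by
      rw [Real.rpow_two]
      linear_combination (-R ^ 2 / 2) * Real.cos_sq_add_sin_sq θ
    rw [e, show (3 : ℝ) = ((3 : ℕ) : ℝ) by norm_num, Real.rpow_natCast]
    ring
  rw [setIntegral_congr_fun (measurableSet_Ioi.prod measurableSet_Ioo) h1]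
  rw [Measure.volume_eq_prod, setIntegral_prod_mul
    (fun R : ℝ => R ^ (3 : ℝ) * Real.exp (-(1 / 2) * R ^ (2 : ℝ)))
    (fun θ : ℝ => (2 * Real.pi)⁻¹ * f (Real.cos θ, Real.sin θ))]
  rw [integral_rpow_mul_exp_neg_mul_rpow (by norm_num) (by norm_num) (by norm_num),
    integral_const_mul, ← integral_Ioc_eq_integral_Ioo,
    ← intervalIntegral.integral_of_le (by linarith [Real.pi_pos])]
  have e1 : Real.Gamma ((3 + 1) / 2) = 1 := by
    rw [show ((3 : ℝ) + 1) / 2 = 2 by norm_num, Real.Gamma_two]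
  have e2 : (1 / 2 : ℝ) ^ (-(3 + 1) / 2 : ℝ) = 4 := by
    rw [show (-(3 + 1) / 2 : ℝ) = ((-2 : ℤ) : ℝ) by norm_num, Real.rpow_intCast]; norm_num
  rw [e1, e2]
  field_simp
  ring

/-- The function `(r² + u²) arccot (u / r) - r u`. -/
noncomputable def sectorFn (r u : ℝ) : ℝ :=
  (r ^ 2 + u ^ 2) * (Real.pi / 2 - Real.arctan (u / r)) - r * u

lemma integral_sector {r : ℝ} (hr : 0 < r) (u : ℝ) :
    ∫ θ in (-(Real.pi / 2))..(Real.pi / 2), max (r * Real.sin θ - u * Real.cos θ) 0 ^ 2 =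
      sectorFn r u / 2 := by
  set a := Real.arctan (u / r) with ha
  have ha1 : -(Real.pi / 2) < a := Real.neg_pi_div_two_lt_arctan _
  have ha2 : a < Real.pi / 2 := Real.arctan_lt_pi_div_two _
  have hu : u = r * Real.tan a := by rw [ha, Real.tan_arctan]; field_simp
  have hca : 0 < Real.cos a := Real.cos_arctan_pos _
  have hsgn : ∀ θ, r * Real.sin θ - u * Real.cos θ = r / Real.cos a * Real.sin (θ - a) := by
    intro θ
    rw [hu, Real.tan_eq_sin_div_cos, Real.sin_sub]
    field_simp
  have hcont : Continuous fun θ => max (r * Real.sin θ - u * Real.cos θ) 0 ^ 2 := by fun_prop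
  rw [← intervalIntegral.integral_add_adjacent_intervals (b := a) (hcont.intervalIntegrable _ _)
    (hcont.intervalIntegrable _ _)]
  have hleft : ∫ θ in (-(Real.pi / 2))..a, max (r * Real.sin θ - u * Real.cos θ) 0 ^ 2 = 0 := by
    rw [intervalIntegral.integral_congr (g := fun _ => (0 : ℝ))]
    · simp
    · intro θ hθ
      rw [Set.uIcc_of_le ha1.le] at hθ
      have h1 : Real.sin (θ - a) ≤ 0 :=
        Real.sin_nonpos_of_nonpos_of_neg_pi_le (by linarith [hθ.2]) (by linarith [hθ.1])
      beta_reduce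
      rw [max_eq_right, zero_pow two_ne_zero]
      rw [hsgn]
      exact mul_nonpos_of_nonneg_of_nonpos (by positivity) h1
  have hright : ∫ θ in a..(Real.pi / 2), max (r * Real.sin θ - u * Real.cos θ) 0 ^ 2 =
      ∫ θ in a..(Real.pi / 2), (r * Real.sin θ - u * Real.cos θ) ^ 2 := by
    refine intervalIntegral.integral_congr fun θ hθ => ?_
    rw [Set.uIcc_of_le ha2.le] at hθ
    have h1 : 0 ≤ Real.sin (θ - a) :=
      Real.sin_nonneg_of_nonneg_of_le_pi (by linarith [hθ.1]) (by linarith [hθ.2])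
    rw [max_eq_left]
    rw [hsgn]
    positivity
  have hprim : ∀ θ ∈ Set.uIcc a (Real.pi / 2), HasDerivAt
      (fun θ => r ^ 2 * ((θ - Real.sin θ * Real.cos θ) / 2)
        + u ^ 2 * ((θ + Real.sin θ * Real.cos θ) / 2) - r * u * Real.sin θ ^ 2)
      ((r * Real.sin θ - u * Real.cos θ) ^ 2) θ := by
    intro θ _
    have hsc := (Real.hasDerivAt_sin θ).mul (Real.hasDerivAt_cos θ)
    have h := ((((hasDerivAt_id θ).sub hsc).div_const 2).const_mul (r ^ 2)).add
      ((((hasDerivAt_id θ).add hsc).div_const 2).const_mul (u ^ 2)) |>.sub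
      (((Real.hasDerivAt_sin θ).pow 2).const_mul (r * u))
    refine h.congr_deriv ?_
    simp only [Nat.cast_ofNat]
    linear_combination (-(r ^ 2 + u ^ 2) / 2) * Real.sin_sq_add_cos_sq θ
  rw [hleft, zero_add, hright, intervalIntegral.integral_eq_sub_of_hasDerivAt hprim
    (Continuous.intervalIntegrable (by fun_prop) _ _)]
  rw [Real.sin_pi_div_two, Real.cos_pi_div_two, sectorFn, ← ha]
  have hs : Real.sin a * r = u * Real.cos a := by
    rw [hu, Real.tan_eq_sin_div_cos]; field_simp
  linear_combination (r / 2 * Real.cos a + u / 2 * Real.sin a) * hs +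
    (r * u / 2) * Real.sin_sq_add_cos_sq a

/-- The closed form of the mean square violation. -/
lemma meanSq_eq {s r : ℝ} (hr : 0 < r) :
    meanSq s r = Real.pi⁻¹ * (sectorFn r (1 - s) + sectorFn r (1 + s)) := by
  unfold meanSq
  rw [integral_gaussian_prod_of_homogeneous]
  swap
  · intro R hR x y
    have : overshoot (R * x) (s * (R * x) + r * (R * y)) = R * overshoot x (s * x + r * y) := by
      unfold overshoot
      rw [show s * (R * x) + r * (R * y) = R * (s * x + r * y) by ring, abs_mul, abs_mul,
        abs_of_pos hR, ← mul_sub, mul_max_of_nonneg _ _ hR.le, mul_zero]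
    simp only [this]; ring
  congr 1
  set ψ : ℝ → ℝ := fun θ =>
    overshoot (Real.cos θ) (s * Real.cos θ + r * Real.sin θ) ^ 2 with hψ
  have hcont : Continuous ψ := by unfold ψ overshoot; fun_prop
  have hper : Function.Periodic ψ Real.pi := by
    intro θ
    simp only [hψ, overshoot, Real.cos_add_pi, Real.sin_add_pi, abs_neg]
    rw [show s * -Real.cos θ + r * -Real.sin θ = -(s * Real.cos θ + r * Real.sin θ) by ring,
      abs_neg]
  have h1 : ∫ θ in (-Real.pi)..Real.pi, ψ θ =
      2 * ∫ θ in (-(Real.pi / 2))..(Real.pi / 2), ψ θ := by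
    rw [← intervalIntegral.integral_add_adjacent_intervals (b := 0)
      (hcont.intervalIntegrable _ _) (hcont.intervalIntegrable _ _)]
    have e1 := hper.intervalIntegral_add_eq (-Real.pi) (-(Real.pi / 2))
    have e2 := hper.intervalIntegral_add_eq 0 (-(Real.pi / 2))
    rw [neg_add_cancel] at e1
    rw [zero_add] at e2
    rw [show -(Real.pi / 2) + Real.pi = Real.pi / 2 by ring] at e1 e2
    rw [e1, e2]; ring
  have h2 : ∫ θ in (-(Real.pi / 2))..(Real.pi / 2), ψ θ =
      ∫ θ in (-(Real.pi / 2))..(Real.pi / 2),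
        (max (r * Real.sin θ - (1 - s) * Real.cos θ) 0 ^ 2 +
          max (r * Real.sin (-θ) - (1 + s) * Real.cos (-θ)) 0 ^ 2) := by
    refine intervalIntegral.integral_congr fun θ hθ => ?_
    rw [Set.uIcc_of_le (by linarith [Real.pi_pos])] at hθ
    have hc : 0 ≤ Real.cos θ := Real.cos_nonneg_of_neg_pi_div_two_le_of_le hθ.1 hθ.2
    simp only [hψ, overshoot, Real.sin_neg, Real.cos_neg, abs_of_nonneg hc]
    rcases le_total 0 (s * Real.cos θ + r * Real.sin θ) with h | h
    · rw [abs_of_nonneg h, max_eq_right (b := (0 : ℝ))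
        (a := r * -Real.sin θ - (1 + s) * Real.cos θ) (by nlinarith)]
      rw [show s * Real.cos θ + r * Real.sin θ - Real.cos θ =
        r * Real.sin θ - (1 - s) * Real.cos θ by ring]
      ring
    · rw [abs_of_nonpos h, max_eq_right (b := (0 : ℝ))
        (a := r * Real.sin θ - (1 - s) * Real.cos θ) (by nlinarith)]
      rw [show -(s * Real.cos θ + r * Real.sin θ) - Real.cos θ =
        r * -Real.sin θ - (1 + s) * Real.cos θ by ring]
      ring
  have hc2 : ∀ u : ℝ, Continuous fun θ => max (r * Real.sin θ - u * Real.cos θ) 0 ^ 2 := fun u => by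
    fun_prop
  have h3 : ∫ θ in (-(Real.pi / 2))..(Real.pi / 2),
      max (r * Real.sin (-θ) - (1 + s) * Real.cos (-θ)) 0 ^ 2 = sectorFn r (1 + s) / 2 := by
    rw [intervalIntegral.integral_comp_neg
      (fun θ => max (r * Real.sin θ - (1 + s) * Real.cos θ) 0 ^ 2), neg_neg, integral_sector hr]
  have hc3 : Continuous fun θ => max (r * Real.sin (-θ) - (1 + s) * Real.cos (-θ)) 0 ^ 2 := by
    fun_prop
  rw [h1, h2, intervalIntegral.integral_add ((hc2 _).intervalIntegrable _ _)
    (hc3.intervalIntegrable _ _), h3, integral_sector hr]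
  ring

lemma overshoot_le_abs (q v : ℝ) : overshoot q v ≤ |v| :=
  max_le (by linarith [abs_nonneg q]) (abs_nonneg v)

lemma overshoot_convex (q v w : ℝ) {a b : ℝ} (ha : 0 ≤ a) (hb : 0 ≤ b) (hab : a + b = 1) :
    overshoot q (a * v + b * w) ≤ a * overshoot q v + b * overshoot q w := by
  unfold overshoot
  refine max_le ?_ (by positivity)
  have h1 : |a * v + b * w| ≤ a * |v| + b * |w| := by
    refine (abs_add_le _ _).trans ?_
    rw [abs_mul, abs_mul, abs_of_nonneg ha, abs_of_nonneg hb]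
  have h2 := mul_le_mul_of_nonneg_left (le_max_left (|v| - |q|) 0) ha
  have h3 := mul_le_mul_of_nonneg_left (le_max_left (|w| - |q|) 0) hb
  have h4 : |q| = a * |q| + b * |q| := by rw [← add_mul, hab, one_mul]
  linarith

lemma abs_overshoot_sub_le (q v w : ℝ) : |overshoot q v - overshoot q w| ≤ |v - w| := by
  unfold overshoot
  refine (abs_max_sub_max_le_abs _ _ _).trans ?_
  rw [sub_sub_sub_cancel_right]
  exact abs_abs_sub_abs_le_abs_sub _ _

/-- The law of a triple of independent standard Gaussian variables. -/
noncomputable def gauss3 : Measure (ℝ × ℝ × ℝ) :=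
  (gaussianReal 0 1).prod ((gaussianReal 0 1).prod (gaussianReal 0 1))

instance : IsProbabilityMeasure gauss3 := by unfold gauss3; infer_instance

/-- The linear combination `s q + t g + τ h` of the entries of a row, `p = (s, t, τ)`. -/
def rowVal (p z : ℝ × ℝ × ℝ) : ℝ := p.1 * z.1 + p.2.1 * z.2.1 + p.2.2 * z.2.2

/-- The violation of the constraint `|s q + t g + τ h| ≤ |q|`. -/
def rowOver (p z : ℝ × ℝ × ℝ) : ℝ := overshoot z.1 (rowVal p z)

/-- The mean square violation of the constraint `|s q + t g + τ h| ≤ |q|`. -/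
noncomputable def rowSq (p : ℝ × ℝ × ℝ) : ℝ := ∫ z, rowOver p z ^ 2 ∂gauss3

lemma continuous_rowOver (p : ℝ × ℝ × ℝ) : Continuous (rowOver p) := by
  unfold rowOver rowVal overshoot; fun_prop

lemma rowOver_nonneg (p z : ℝ × ℝ × ℝ) : 0 ≤ rowOver p z := overshoot_nonneg _ _

lemma memLp_gauss3_fst (k : NNReal) : MemLp (fun z : ℝ × ℝ × ℝ => z.1) k gauss3 :=
  (memLp_id_gaussianReal (μ := 0) (v := 1) k).comp_measurePreserving measurePreserving_fst

lemma memLp_gauss3_snd (k : NNReal) : MemLp (fun z : ℝ × ℝ × ℝ => z.2.1) k gauss3 :=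
  (memLp_id_gaussianReal (μ := 0) (v := 1) k).comp_measurePreserving
    ((measurePreserving_fst (μ := gaussianReal 0 1) (ν := gaussianReal 0 1)).comp
      measurePreserving_snd)

lemma memLp_gauss3_thd (k : NNReal) : MemLp (fun z : ℝ × ℝ × ℝ => z.2.2) k gauss3 :=
  (memLp_id_gaussianReal (μ := 0) (v := 1) k).comp_measurePreserving
    ((measurePreserving_snd (μ := gaussianReal 0 1) (ν := gaussianReal 0 1)).comp
      measurePreserving_snd)

lemma memLp_rowOver (k : NNReal) (p : ℝ × ℝ × ℝ) : MemLp (rowOver p) k gauss3 := by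
  have h : MemLp (rowVal p) k gauss3 :=
    (((memLp_gauss3_fst k).const_mul p.1).add ((memLp_gauss3_snd k).const_mul p.2.1)).add
      ((memLp_gauss3_thd k).const_mul p.2.2)
  refine h.mono (continuous_rowOver p).aestronglyMeasurable (ae_of_all _ fun z => ?_)
  rw [Real.norm_eq_abs, abs_of_nonneg (rowOver_nonneg p z)]
  exact overshoot_le_abs _ _

lemma memLp_rowOver_sq (p : ℝ × ℝ × ℝ) : MemLp (fun z => rowOver p z ^ 2) 2 gauss3 := by
  have h := (memLp_rowOver 4 p)
  refine (memLp_two_iff_integrable_sq ((continuous_rowOver p).pow 2).aestronglyMeasurable).2 ?_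
  have h2 := h.integrable_norm_pow (p := 4) (by norm_num)
  refine h2.congr (ae_of_all _ fun z => ?_)
  change ‖rowOver p z‖ ^ 4 = (rowOver p z ^ 2) ^ 2
  rw [Real.norm_eq_abs, abs_of_nonneg (rowOver_nonneg p z), ← pow_mul]

lemma rowSq_nonneg (p : ℝ × ℝ × ℝ) : 0 ≤ rowSq p := integral_nonneg fun _ => sq_nonneg _

/-- Rotation invariance: only the norm of `(t, τ)` matters. -/
lemma rowSq_eq_meanSq (s t τ : ℝ) : rowSq (s, t, τ) = meanSq s √(t ^ 2 + τ ^ 2) := by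
  set κ : Measure ℝ := gaussianReal 0 (NNReal.mk (t ^ 2 + τ ^ 2) (by positivity)) with hκ
  have hX : ∀ c : ℝ, Measure.map (fun x => c * x) (gaussianReal 0 1) =
      gaussianReal 0 (NNReal.mk (c ^ 2) (sq_nonneg c)) := fun c => by
    rw [gaussianReal_map_const_mul, mul_zero, mul_one]
  have mp2 : MeasurePreserving (fun z : ℝ => √(t ^ 2 + τ ^ 2) * z) (gaussianReal 0 1) κ := by
    refine ⟨by fun_prop, ?_⟩
    rw [hX, hκ]
    congr 1
    exact NNReal.eq (Real.sq_sqrt (by positivity))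
  have mp1 : MeasurePreserving (fun x : ℝ × ℝ => t * x.1 + τ * x.2)
      ((gaussianReal 0 1).prod (gaussianReal 0 1)) κ := by
    refine ⟨by fun_prop, ?_⟩
    have hind : IndepFun (fun x : ℝ × ℝ => t * x.1) (fun x : ℝ × ℝ => τ * x.2)
        ((gaussianReal 0 1).prod (gaussianReal 0 1)) :=
      indepFun_prod (X := fun x : ℝ => t * x) (Y := fun x : ℝ => τ * x) (by fun_prop)
        (by fun_prop)
    have h1 : Measure.map (fun x : ℝ × ℝ => t * x.1)
        ((gaussianReal 0 1).prod (gaussianReal 0 1)) =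
        gaussianReal 0 (NNReal.mk (t ^ 2) (sq_nonneg t)) := by
      have h := (measurePreserving_fst (μ := gaussianReal 0 1) (ν := gaussianReal 0 1)).map_eq
      have h' := congrArg (Measure.map fun x : ℝ => t * x) h
      rw [Measure.map_map (by fun_prop) measurable_fst, hX] at h'
      exact h'
    have h2 : Measure.map (fun x : ℝ × ℝ => τ * x.2)
        ((gaussianReal 0 1).prod (gaussianReal 0 1)) =
        gaussianReal 0 (NNReal.mk (τ ^ 2) (sq_nonneg τ)) := by
      have h := (measurePreserving_snd (μ := gaussianReal 0 1) (ν := gaussianReal 0 1)).map_eq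
      have h' := congrArg (Measure.map fun x : ℝ => τ * x) h
      rw [Measure.map_map (by fun_prop) measurable_snd, hX] at h'
      exact h'
    have h3 := gaussianReal_add_gaussianReal_of_indepFun hind h1 h2
    rw [add_zero] at h3
    exact h3
  have key : ∀ {X : Type} [MeasurableSpace X] {μ : Measure X} [SFinite μ] {φ : X → ℝ},
      MeasurePreserving φ μ κ →
      ∫ z : ℝ × X, overshoot z.1 (s * z.1 + φ z.2) ^ 2 ∂(gaussianReal 0 1).prod μ =
        ∫ z : ℝ × ℝ, overshoot z.1 (s * z.1 + z.2) ^ 2 ∂(gaussianReal 0 1).prod κ := by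
    intro X _ μ _ φ hφ
    have h := (MeasurePreserving.id (gaussianReal 0 1)).prod hφ
    rw [← h.map_eq, integral_map h.measurable.aemeasurable]
    · rfl
    · refine Continuous.aestronglyMeasurable ?_
      unfold overshoot; fun_prop
  have e1 : rowSq (s, t, τ) = ∫ z : ℝ × ℝ × ℝ, overshoot z.1
      (s * z.1 + (t * z.2.1 + τ * z.2.2)) ^ 2 ∂gauss3 := by
    simp only [rowSq, rowOver, rowVal, add_assoc]
  rw [e1, meanSq]
  exact (key mp1).trans (key mp2).symm

/-- Minkowski's inequality in the form needed for convexity. -/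
lemma sqrt_integral_sq_le {X : Type*} [MeasurableSpace X] {μ : Measure X} {f f₁ f₂ : X → ℝ}
    {a b : ℝ} (ha : 0 ≤ a) (hb : 0 ≤ b) (hf : ∀ x, 0 ≤ f x)
    (hf₁ : ∀ x, 0 ≤ f₁ x) (hf₂ : ∀ x, 0 ≤ f₂ x) (h₁ : MemLp f₁ 2 μ) (h₂ : MemLp f₂ 2 μ)
    (hle : ∀ x, f x ≤ a * f₁ x + b * f₂ x) :
    √(∫ x, f x ^ 2 ∂μ) ≤ a * √(∫ x, f₁ x ^ 2 ∂μ) + b * √(∫ x, f₂ x ^ 2 ∂μ) := by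
  have hi₁ : 0 ≤ ∫ x, f₁ x ^ 2 ∂μ := integral_nonneg fun _ => sq_nonneg _
  have hi₂ : 0 ≤ ∫ x, f₂ x ^ 2 ∂μ := integral_nonneg fun _ => sq_nonneg _
  have hcs : ∫ x, f₁ x * f₂ x ∂μ ≤ √(∫ x, f₁ x ^ 2 ∂μ) * √(∫ x, f₂ x ^ 2 ∂μ) := by
    have h := integral_mul_le_Lp_mul_Lq_of_nonneg (μ := μ) (f := f₁) (g := f₂)
      Real.HolderConjugate.two_two (ae_of_all _ hf₁) (ae_of_all _ hf₂)
      (by simpa using h₁) (by simpa using h₂)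
    simpa [Real.sqrt_eq_rpow] using h
  have hint : Integrable (fun x => (a * f₁ x + b * f₂ x) ^ 2) μ :=
    ((h₁.const_mul a).add (h₂.const_mul b)).integrable_sq
  have hexp : ∫ x, (a * f₁ x + b * f₂ x) ^ 2 ∂μ =
      a ^ 2 * ∫ x, f₁ x ^ 2 ∂μ + b ^ 2 * ∫ x, f₂ x ^ 2 ∂μ + 2 * a * b * ∫ x, f₁ x * f₂ x ∂μ := by
    have i₁ : Integrable (fun x => a ^ 2 * f₁ x ^ 2) μ := h₁.integrable_sq.const_mul _
    have i₂ : Integrable (fun x => b ^ 2 * f₂ x ^ 2) μ := h₂.integrable_sq.const_mul _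
    have i₃ : Integrable (fun x => 2 * a * b * (f₁ x * f₂ x)) μ :=
      (h₁.integrable_mul h₂).const_mul _
    have i₄ : Integrable (fun x => a ^ 2 * f₁ x ^ 2 + b ^ 2 * f₂ x ^ 2) μ := i₁.add i₂
    rw [← integral_const_mul, ← integral_const_mul, ← integral_const_mul,
      ← integral_add i₁ i₂, ← integral_add i₄ i₃]
    refine integral_congr_ae (ae_of_all _ fun x => ?_)
    beta_reduce
    ring
  have hmono : ∫ x, f x ^ 2 ∂μ ≤ ∫ x, (a * f₁ x + b * f₂ x) ^ 2 ∂μ :=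
    integral_mono_of_nonneg (ae_of_all _ fun _ => sq_nonneg _) hint
      (ae_of_all _ fun x => pow_le_pow_left₀ (hf x) (hle x) 2)
  rw [Real.sqrt_le_left (by positivity)]
  refine hmono.trans ?_
  rw [hexp]
  have hab : 0 ≤ 2 * a * b := by positivity
  nlinarith [mul_le_mul_of_nonneg_left hcs hab, Real.sq_sqrt hi₁, Real.sq_sqrt hi₂]

lemma convexOn_sqrt_rowSq : ConvexOn ℝ Set.univ fun p => √(rowSq p) := by
  refine ⟨convex_univ, fun p _ p' _ a b ha hb hab => ?_⟩
  refine sqrt_integral_sq_le ha hb (rowOver_nonneg _) (rowOver_nonneg _) (rowOver_nonneg _)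
    (memLp_rowOver 2 p) (memLp_rowOver 2 p') fun z => ?_
  refine le_trans (le_of_eq ?_) (overshoot_convex z.1 (rowVal p z) (rowVal p' z) ha hb hab)
  simp only [rowOver, rowVal, Prod.fst_add, Prod.snd_add, Prod.smul_fst, Prod.smul_snd,
    smul_eq_mul]
  congr 1; ring

lemma continuous_sqrt_rowSq : Continuous fun p => √(rowSq p) :=
  continuousOn_univ.1 (convexOn_sqrt_rowSq.continuousOn isOpen_univ)

lemma continuous_rowSq : Continuous rowSq := by
  have : rowSq = fun p => √(rowSq p) ^ 2 := by
    ext p; rw [Real.sq_sqrt (rowSq_nonneg p)]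
  rw [this]
  exact continuous_sqrt_rowSq.pow 2

lemma meanSq_eq_rowSq {s r : ℝ} (hr : 0 ≤ r) : meanSq s r = rowSq (s, r, 0) := by
  rw [rowSq_eq_meanSq, zero_pow two_ne_zero, add_zero, Real.sqrt_sq hr]

lemma meanSq_nonneg (s r : ℝ) : 0 ≤ meanSq s r := integral_nonneg fun _ => sq_nonneg _

lemma meanSq_neg {s r : ℝ} (hr : 0 ≤ r) : meanSq (-s) r = meanSq s r := by
  rcases hr.eq_or_lt with rfl | hr
  · simp [meanSq, overshoot, abs_neg]
  · rw [meanSq_eq hr, meanSq_eq hr, sub_neg_eq_add, ← sub_eq_add_neg, add_comm]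

lemma meanSq_zero {s : ℝ} (hs : |s| ≤ 1) : meanSq s 0 = 0 := by
  have : ∀ z : ℝ × ℝ, overshoot z.1 (s * z.1 + 0 * z.2) ^ 2 = 0 := fun z => by
    rw [overshoot, max_eq_right, zero_pow two_ne_zero]
    rw [zero_mul, add_zero, abs_mul]
    nlinarith [abs_nonneg z.1]
  simp only [meanSq, this, integral_zero]

lemma integral_sq_gaussian : ∫ x : ℝ, x ^ 2 ∂gaussianReal 0 1 = 1 := by
  have h := variance_id_gaussianReal (μ := 0) (v := 1)
  rw [variance_of_integral_eq_zero aemeasurable_id (by simp)] at h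
  simpa using h

lemma meanSq_pos {s : ℝ} (hs : 1 < s) : 0 < meanSq s 0 := by
  have h1 : ∀ z : ℝ × ℝ, overshoot z.1 (s * z.1 + 0 * z.2) ^ 2 = (s - 1) ^ 2 * z.1 ^ 2 := fun z => by
    rw [overshoot, zero_mul, add_zero, abs_mul, abs_of_pos (by linarith : 0 < s), max_eq_left
      (by nlinarith [abs_nonneg z.1])]
    rw [← sq_abs z.1]; ring
  simp only [meanSq, h1]
  rw [integral_const_mul, integral_fun_fst (fun x : ℝ => x ^ 2), integral_sq_gaussian]
  simp only [probReal_univ, smul_eq_mul, mul_one]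
  have : 0 < s - 1 := by linarith
  positivity

/-! ### The limiting optimization problem -/

section Calculus

variable {α : ℝ}

lemma pi_div_mem (hα : 2 < α) : 0 < Real.pi / α ∧ Real.pi / α < Real.pi / 2 :=
  ⟨div_pos Real.pi_pos (by linarith), div_lt_div_of_pos_left Real.pi_pos two_pos hα⟩

lemma cAlpha_pos (hα : 2 < α) : 0 < cAlpha α :=
  one_div_pos.2 (Real.tan_pos_of_pos_of_lt_pi_div_two (pi_div_mem hα).1 (pi_div_mem hα).2)

lemma arctan_inv_cAlpha (hα : 2 < α) : Real.arctan (1 / cAlpha α) = Real.pi / α := by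
  rw [cAlpha, one_div_one_div]
  exact Real.arctan_tan (by linarith [(pi_div_mem hα).1, Real.pi_pos]) (pi_div_mem hα).2

lemma rAlpha_nonneg (hα : 2 < α) {s : ℝ} (hs : s ∈ Set.Icc (0 : ℝ) 1) : 0 ≤ rAlpha α s := by
  have hc := cAlpha_pos hα
  rw [rAlpha, sub_nonneg]
  refine Real.le_sqrt_of_sq_le ?_
  nlinarith [hs.1, hs.2]

lemma rAlpha_pos (hα : 2 < α) {s : ℝ} (h0 : 0 ≤ s) (h1 : s < 1) : 0 < rAlpha α s := by
  have hc := cAlpha_pos hα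
  rw [rAlpha, sub_pos]
  refine Real.lt_sqrt_of_sq_lt ?_
  nlinarith

lemma rAlpha_one (hα : 2 < α) : rAlpha α 1 = 0 := by
  rw [rAlpha, one_pow, add_sub_cancel_right, Real.sqrt_sq (cAlpha_pos hα).le, sub_self]

lemma rAlpha_add (α s : ℝ) : rAlpha α s + cAlpha α = √(cAlpha α ^ 2 + 1 - s ^ 2) :=
  sub_add_cancel _ _

lemma rAlpha_quadratic (hα : 2 < α) {s : ℝ} (hs : s ∈ Set.Icc (0 : ℝ) 1) :
    rAlpha α s ^ 2 + 2 * cAlpha α * rAlpha α s = 1 - s ^ 2 := by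
  have hc := cAlpha_pos hα
  have h : (rAlpha α s + cAlpha α) ^ 2 = cAlpha α ^ 2 + 1 - s ^ 2 := by
    rw [rAlpha_add, Real.sq_sqrt]
    nlinarith [hs.1, hs.2]
  linarith

/-- The angle `arccot ((1 - s) / r) + arccot ((1 + s) / r)`, whose comparison with `π / α` decides
whether `r² - α E (|s q + r z| - |q|)₊²` increases at `r`. -/
noncomputable def angle (s r : ℝ) : ℝ :=
  Real.pi - Real.arctan ((1 - s) / r) - Real.arctan ((1 + s) / r)

lemma angle_strictMono {s : ℝ} (hs : s ∈ Set.Icc (0 : ℝ) 1) {r r' : ℝ} (hr : 0 < r) (h : r < r') :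
    angle s r < angle s r' := by
  have h1 : (1 - s) / r' ≤ (1 - s) / r :=
    div_le_div_of_nonneg_left (by linarith [hs.2]) hr h.le
  have h2 : (1 + s) / r' < (1 + s) / r :=
    div_lt_div_of_pos_left (by linarith [hs.1]) hr h
  have h3 := Real.arctan_mono h1
  have h4 := Real.arctan_strictMono h2
  unfold angle
  linarith

lemma angle_rAlpha (hα : 2 < α) {s : ℝ} (h0 : 0 ≤ s) (h1 : s < 1) :
    angle s (rAlpha α s) = Real.pi / α := by
  have hc := cAlpha_pos hα
  have hr := rAlpha_pos hα h0 h1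
  have hq := rAlpha_quadratic hα ⟨h0, h1.le⟩
  set r := rAlpha α s
  set c := cAlpha α
  have hprod : (1 - s) / r * ((1 + s) / r) = 1 + 2 * c / r := by
    field_simp
    linarith
  have hgt : 1 < (1 - s) / r * ((1 + s) / r) := by
    rw [hprod]; linarith [show 0 < 2 * c / r by positivity]
  have hadd := Real.arctan_add_eq_add_pi hgt (div_pos (by linarith) hr)
  have harg : ((1 - s) / r + (1 + s) / r) / (1 - (1 - s) / r * ((1 + s) / r)) = -(1 / c) := by
    rw [hprod]
    field_simp
    ring
  rw [harg, Real.arctan_neg, arctan_inv_cAlpha hα] at hadd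
  unfold angle
  linarith

lemma pi_div_lt_angle_one (hα : 2 < α) {r : ℝ} : Real.pi / α < angle 1 r := by
  unfold angle
  rw [sub_self, zero_div, Real.arctan_zero]
  linarith [Real.arctan_lt_pi_div_two ((1 + 1) / r), (pi_div_mem hα).2]

lemma hasDerivAt_sectorFn (u : ℝ) {r : ℝ} (hr : 0 < r) :
    HasDerivAt (fun r => sectorFn r u) (2 * r * (Real.pi / 2 - Real.arctan (u / r))) r := by
  have h1 : HasDerivAt (fun r : ℝ => u / r) (-u / r ^ 2) r := by
    refine ((hasDerivAt_const r u).div (hasDerivAt_id r) hr.ne').congr_deriv ?_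
    simp
  have h2 := (h1.arctan).const_sub (Real.pi / 2)
  have h3 := ((((hasDerivAt_id r).pow 2).add_const (u ^ 2)).mul h2).sub
    ((hasDerivAt_id r).mul_const u)
  refine h3.congr_deriv ?_
  simp only [id, Nat.cast_ofNat, Pi.pow_apply]
  field_simp
  ring

/-- The function `r² - α E (|s q + r z| - |q|)₊²`. For a given radius `r` of the tail it is the
largest possible squared component of the tail in the direction of the initial guess. -/
noncomputable def margin (α s r : ℝ) : ℝ := r ^ 2 - α * meanSq s r

lemma continuousOn_margin (α s : ℝ) : ContinuousOn (margin α s) (Set.Ici 0) := by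
  have h : ContinuousOn (fun r : ℝ => r ^ 2 - α * rowSq (s, r, 0)) (Set.Ici 0) :=
    (Continuous.sub (by fun_prop)
      (continuous_const.mul (continuous_rowSq.comp (by fun_prop)))).continuousOn
  exact h.congr fun r hr => by rw [margin, meanSq_eq_rowSq hr]

lemma hasDerivAt_margin (α s : ℝ) {r : ℝ} (hr : 0 < r) :
    HasDerivAt (margin α s) (2 * r * (1 - α / Real.pi * angle s r)) r := by
  have h := ((hasDerivAt_id r).pow 2).sub
    ((((hasDerivAt_sectorFn (1 - s) hr).add (hasDerivAt_sectorFn (1 + s) hr)).const_mul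
      Real.pi⁻¹).const_mul α)
  refine (h.congr_of_eventuallyEq ?_).congr_deriv ?_
  · filter_upwards [lt_mem_nhds hr] with x hx
    simp [margin, meanSq_eq hx]
  · simp only [angle, id, Nat.cast_ofNat]
    field_simp
    ring

lemma strictAntiOn_margin (hα : 2 < α) {s : ℝ} (hs : s ∈ Set.Icc (0 : ℝ) 1) :
    StrictAntiOn (margin α s) (Set.Ici (rAlpha α s)) := by
  have hr0 := rAlpha_nonneg hα hs
  refine strictAntiOn_of_deriv_neg (convex_Ici _)
    ((continuousOn_margin α s).mono (Set.Ici_subset_Ici.2 hr0)) fun r hr => ?_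
  rw [interior_Ici] at hr
  have hr' : 0 < r := hr0.trans_lt hr
  rw [(hasDerivAt_margin α s hr').deriv]
  have hang : Real.pi / α < angle s r := by
    rcases hs.2.eq_or_lt with rfl | h1
    · exact pi_div_lt_angle_one hα
    · rw [← angle_rAlpha hα hs.1 h1]
      exact angle_strictMono hs (rAlpha_pos hα hs.1 h1) hr
  have hpos := Real.pi_pos
  have : 1 < α / Real.pi * angle s r := by
    rw [div_lt_iff₀ (by linarith)] at hang
    rw [div_mul_eq_mul_div, one_lt_div hpos]
    linarith
  nlinarith

lemma strictMonoOn_margin (hα : 2 < α) {s : ℝ} (h0 : 0 ≤ s) (h1 : s < 1) :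
    StrictMonoOn (margin α s) (Set.Icc 0 (rAlpha α s)) := by
  refine strictMonoOn_of_deriv_pos (convex_Icc _ _)
    ((continuousOn_margin α s).mono Set.Icc_subset_Ici_self) fun r hr => ?_
  rw [interior_Icc] at hr
  rw [(hasDerivAt_margin α s hr.1).deriv]
  have hang : angle s r < Real.pi / α := by
    rw [← angle_rAlpha hα h0 h1]
    exact angle_strictMono ⟨h0, h1.le⟩ hr.1 hr.2
  have hpos := Real.pi_pos
  have : α / Real.pi * angle s r < 1 := by
    rw [lt_div_iff₀ (by linarith)] at hang
    rw [div_mul_eq_mul_div, div_lt_one hpos]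
    linarith
  have := hr.1
  nlinarith

/-- `r_α(s)` is the maximizer of `margin α s`, where the angle equals `π / α`, and `g_α(s)` is the
maximal value. -/
lemma margin_rAlpha (hα : 2 < α) {s : ℝ} (hs : s ∈ Set.Icc (0 : ℝ) 1) :
    margin α s (rAlpha α s) = gAlpha α s := by
  have hc := cAlpha_pos hα
  have hpi := Real.pi_pos
  rcases hs.2.eq_or_lt with rfl | h1
  · rw [margin, gAlpha, rAlpha_one hα, meanSq_zero (by simp), zero_add, arctan_inv_cAlpha hα]
    field_simp
    ring
  · have hr := rAlpha_pos hα hs.1 h1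
    have hq := rAlpha_quadratic hα hs
    have hang := angle_rAlpha hα hs.1 h1
    rw [margin, gAlpha, meanSq_eq hr]
    set r := rAlpha α s
    set c := cAlpha α
    have hdiff : Real.arctan ((1 + s) / r) + Real.arctan (-((1 - s) / r)) =
        Real.arctan (s / (r + c)) := by
      rw [Real.arctan_add]
      · congr 1
        have e : 1 - (1 + s) / r * -((1 - s) / r) = 2 * (r + c) / r := by
          field_simp; linarith
        rw [e]
        field_simp
        ring
      · have : 0 ≤ (1 + s) / r * ((1 - s) / r) :=
          mul_nonneg (div_nonneg (by linarith [hs.1]) hr.le) (div_nonneg (by linarith) hr.le)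
        linarith
    rw [Real.arctan_neg] at hdiff
    rw [← hdiff, sectorFn, sectorFn]
    unfold angle at hang
    set A := Real.arctan ((1 - s) / r)
    set B := Real.arctan ((1 + s) / r)
    have hang' : α * (Real.pi - A - B) = Real.pi := by
      rw [hang]; field_simp
    field_simp
    linear_combination (-2 * (r ^ 2 + 1 + s ^ 2)) * hang'

lemma margin_le (hα : 2 < α) {s r : ℝ} (hs : s ∈ Set.Icc (0 : ℝ) 1) (hr : 0 ≤ r) :
    margin α s r ≤ gAlpha α s := by
  rw [← margin_rAlpha hα hs]
  rcases le_total (rAlpha α s) r with h | h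
  · exact (strictAntiOn_margin hα hs).antitoneOn Set.self_mem_Ici h h
  · rcases hs.2.eq_or_lt with rfl | h1
    · rw [rAlpha_one hα] at h ⊢
      rw [le_antisymm h hr]
    · exact (strictMonoOn_margin hα hs.1 h1).monotoneOn ⟨hr, h⟩ ⟨hr.trans h, le_rfl⟩ h

lemma eq_rAlpha_of_margin_eq (hα : 2 < α) {s r : ℝ} (hs : s ∈ Set.Icc (0 : ℝ) 1) (hr : 0 ≤ r)
    (h : gAlpha α s ≤ margin α s r) : r = rAlpha α s := by
  rw [← margin_rAlpha hα hs] at h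
  rcases lt_trichotomy r (rAlpha α s) with h' | h' | h'
  · rcases hs.2.eq_or_lt with rfl | h1
    · rw [rAlpha_one hα] at h'; linarith
    · exact absurd h (not_le.2 ((strictMonoOn_margin hα hs.1 h1) ⟨hr, h'.le⟩
        ⟨hr.trans h'.le, le_rfl⟩ h'))
  · exact h'
  · exact absurd h (not_le.2 ((strictAntiOn_margin hα hs) Set.self_mem_Ici h'.le h'))

lemma gAlpha_nonneg (hα : 2 < α) {s : ℝ} (hs : s ∈ Set.Icc (0 : ℝ) 1) : 0 ≤ gAlpha α s := by
  refine le_trans (le_of_eq ?_) (margin_le hα hs le_rfl)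
  rw [margin, meanSq_zero (abs_le.2 ⟨by linarith [hs.1], hs.2⟩)]
  ring

lemma gAlpha_one (hα : 2 < α) : gAlpha α 1 = 0 := by
  rw [← margin_rAlpha hα ⟨zero_le_one, le_rfl⟩, rAlpha_one hα, margin, meanSq_zero (by simp)]
  ring

lemma gAlpha_le_sq (hα : 2 < α) {s : ℝ} (hs : s ∈ Set.Icc (0 : ℝ) 1) :
    gAlpha α s ≤ rAlpha α s ^ 2 := by
  rw [← margin_rAlpha hα hs, margin]
  have := mul_nonneg (by linarith : (0 : ℝ) ≤ α) (meanSq_nonneg s (rAlpha α s))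
  linarith

lemma sq_add_pos_of_mem (hα : 2 < α) {s : ℝ} (hs : s ∈ Set.Icc (0 : ℝ) 1) :
    0 < cAlpha α ^ 2 + 1 - s ^ 2 := by
  have hc := cAlpha_pos hα
  nlinarith [hs.1, hs.2, sq_nonneg (cAlpha α)]

lemma continuousOn_gAlpha (hα : 2 < α) : ContinuousOn (gAlpha α) (Set.Icc 0 1) := by
  have hR : Continuous fun s => rAlpha α s := by unfold rAlpha; fun_prop
  unfold gAlpha
  refine ContinuousOn.add (by fun_prop) (ContinuousOn.mul (by fun_prop) ?_)
  refine Real.continuous_arctan.comp_continuousOn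
    (ContinuousOn.div continuousOn_id (by fun_prop) fun s hs => ?_)
  rw [rAlpha_add]
  exact (Real.sqrt_pos.2 (sq_add_pos_of_mem hα hs)).ne'

lemma hasDerivAt_gAlpha (hα : 2 < α) {s : ℝ} (hs : s ∈ Set.Icc (0 : ℝ) 1) :
    HasDerivAt (gAlpha α) (2 * α / Real.pi *
      Real.arctan (s / √(cAlpha α ^ 2 + 1 - s ^ 2)) - 2 * s) s ∧
    HasDerivAt (fun s => Real.arctan (s / √(cAlpha α ^ 2 + 1 - s ^ 2)))
      (1 / √(cAlpha α ^ 2 + 1 - s ^ 2)) s := by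
  have hpos := sq_add_pos_of_mem hα hs
  have hc := cAlpha_pos hα
  have hR := Real.sqrt_pos.2 hpos
  have hRsq := Real.sq_sqrt hpos.le
  have h1 : HasDerivAt (fun s => √(cAlpha α ^ 2 + 1 - s ^ 2))
      (-s / √(cAlpha α ^ 2 + 1 - s ^ 2)) s := by
    refine ((((hasDerivAt_id s).pow 2).const_sub (cAlpha α ^ 2 + 1)).sqrt hpos.ne').congr_deriv ?_
    simp only [id, Nat.cast_ofNat]
    simp
    ring
  have h2 : HasDerivAt (fun s => Real.arctan (s / √(cAlpha α ^ 2 + 1 - s ^ 2)))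
      (1 / √(cAlpha α ^ 2 + 1 - s ^ 2)) s := by
    refine (((hasDerivAt_id s).div h1 hR.ne').arctan).congr_deriv ?_
    simp only [id, Pi.div_apply]
    set R := √(cAlpha α ^ 2 + 1 - s ^ 2)
    have h3 : s ^ 2 = cAlpha α ^ 2 + 1 - R ^ 2 := by linarith
    have h4 : 0 < cAlpha α ^ 2 + 1 := by positivity
    have h5 : 1 + (s / R) ^ 2 = (cAlpha α ^ 2 + 1) / R ^ 2 := by
      rw [div_pow, h3]; field_simp; ring
    have h6 : 1 * R - s * (-s / R) = (cAlpha α ^ 2 + 1) / R := by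
      field_simp; linarith
    rw [h5, h6]
    field_simp
  refine ⟨?_, h2⟩
  have h7 := (((((hasDerivAt_id s).pow 2).const_sub (-1)).add
    (((h1.sub_const (cAlpha α)).const_mul (2 * α)).div_const Real.pi)).add
    ((((hasDerivAt_id s).const_mul (2 * α)).div_const Real.pi).mul h2))
  refine (h7.congr_of_eventuallyEq (Eventually.of_forall fun x => ?_)).congr_deriv ?_
  · simp [gAlpha, rAlpha]
  · simp only [id, Nat.cast_ofNat]
    have := Real.pi_pos
    field_simp
    ring

end Calculus

section LimitProblem

variable {α : ℝ}

/-- The point of the limiting feasible set above `s` with the largest component along the initial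
guess. -/
noncomputable def extremePoint (α s : ℝ) : ℝ × ℝ × ℝ :=
  (s, √(gAlpha α s), √(rAlpha α s ^ 2 - gAlpha α s))

lemma mul_rowSq_extremePoint (hα : 2 < α) {s : ℝ} (hs : s ∈ Set.Icc (0 : ℝ) 1) :
    α * rowSq (extremePoint α s) = √(rAlpha α s ^ 2 - gAlpha α s) ^ 2 := by
  have h1 := sub_nonneg.2 (gAlpha_le_sq hα hs)
  rw [extremePoint, rowSq_eq_meanSq, Real.sq_sqrt (gAlpha_nonneg hα hs), Real.sq_sqrt h1,
    add_sub_cancel, Real.sqrt_sq (rAlpha_nonneg hα hs)]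
  have := margin_rAlpha hα hs
  rw [margin] at this
  linarith

/-- Convexity of the limiting feasible set, in a quantitative form. -/
lemma sqrt_mul_rowSq_combo (hα : 2 < α) {p p' : ℝ × ℝ × ℝ} {a b : ℝ} (ha : 0 ≤ a) (hb : 0 ≤ b)
    (hab : a + b = 1) :
    √(α * rowSq (a • p + b • p')) ≤ a * √(α * rowSq p) + b * √(α * rowSq p') := by
  have hα0 : 0 ≤ α := by linarith
  have h := convexOn_sqrt_rowSq.2 (Set.mem_univ p) (Set.mem_univ p') ha hb hab
  simp only [smul_eq_mul] at h
  simp only [Real.sqrt_mul hα0]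
  nlinarith [mul_le_mul_of_nonneg_left h (Real.sqrt_nonneg α)]

lemma sqrt_mul_rowSq_le {p : ℝ × ℝ × ℝ} {τ : ℝ} (hτ : 0 ≤ τ)
    (h : α * rowSq p ≤ τ ^ 2) : √(α * rowSq p) ≤ τ := by
  rw [Real.sqrt_le_left hτ]
  exact h

/-- In terms of the radius `√(t² + τ²)` the limiting constraint is a bound on `t`. -/
lemma sq_le_margin {s t τ : ℝ} (h : α * rowSq (s, t, τ) ≤ τ ^ 2) :
    t ^ 2 ≤ margin α s √(t ^ 2 + τ ^ 2) := by
  rw [margin, ← rowSq_eq_meanSq, Real.sq_sqrt (by positivity)]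
  linarith

/-- The region below `√g_α` is a projection of the convex limiting feasible set. -/
lemma concaveOn_sqrt_gAlpha (hα : 2 < α) :
    ConcaveOn ℝ (Set.Icc 0 1) fun s => √(gAlpha α s) := by
  refine ⟨convex_Icc 0 1, fun x hx y hy a b ha hb hab => ?_⟩
  have hz := convex_Icc (0 : ℝ) 1 hx hy ha hb hab
  have h := sqrt_mul_rowSq_combo hα (p := extremePoint α x) (p' := extremePoint α y) ha hb hab
  rw [mul_rowSq_extremePoint hα hx, mul_rowSq_extremePoint hα hy,
    Real.sqrt_sq (Real.sqrt_nonneg _), Real.sqrt_sq (Real.sqrt_nonneg _)] at h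
  have h0 : 0 ≤ a * √(rAlpha α x ^ 2 - gAlpha α x) + b * √(rAlpha α y ^ 2 - gAlpha α y) := by
    positivity
  rw [Real.sqrt_le_left h0] at h
  have h2 := (sq_le_margin h).trans (margin_le hα hz (Real.sqrt_nonneg _))
  exact Real.le_sqrt_of_sq_le h2

lemma limitCost_eq {ρ : ℝ} (hρ : ρ ≤ 1) (hρ0 : 0 < ρ) (s : ℝ) :
    limitCost ρ α s = ρ * s + √(1 - ρ ^ 2) * √(gAlpha α s) := by
  rw [limitCost, Real.sqrt_mul (by nlinarith)]

/-- Two maximizers would make `√g_α` affine between them, so that the second derivative of `g_α`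
would be constant there. -/
lemma limitArgmax_subsingleton (hα : 2 < α) {ρ : ℝ} (hρ : ρ ≤ 1) (hρ0 : 0 < ρ) {x y : ℝ}
    (hx : x ∈ limitArgmax ρ α) (hy : y ∈ limitArgmax ρ α) (hxy : x < y) : False := by
  obtain ⟨hx1, hx2⟩ := hx
  obtain ⟨hy1, hy2⟩ := hy
  have hρ1 : 0 ≤ 1 - ρ ^ 2 := by nlinarith
  set κ := √(1 - ρ ^ 2) with hκ
  have hκ0 : 0 ≤ κ := Real.sqrt_nonneg _
  have heq : limitCost ρ α x = limitCost ρ α y := le_antisymm (hy2 hx1) (hx2 hy1)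
  set V := limitCost ρ α x with hV
  have hsub : Set.Icc x y ⊆ Set.Icc 0 1 := Set.Icc_subset_Icc hx1.1 hy1.2
  have hconc : ConcaveOn ℝ (Set.Icc 0 1) (limitCost ρ α) := by
    have h1 : ConcaveOn ℝ (Set.Icc (0 : ℝ) 1) fun s => ρ * s :=
      (LinearMap.mulLeft ℝ ρ).concaveOn (convex_Icc 0 1)
    have h2 := h1.add ((concaveOn_sqrt_gAlpha hα).smul hκ0)
    refine h2.congr fun s _ => ?_
    simp [limitCost_eq hρ hρ0, hκ]
  have hconst : ∀ s ∈ Set.Icc x y, limitCost ρ α s = V := by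
    intro s hs
    refine le_antisymm (hx2 (hsub hs)) ?_
    have := hconc.ge_on_segment hx1 hy1 (by rwa [segment_eq_Icc hxy.le])
    rwa [← heq, min_self] at this
  have hsq : ∀ s ∈ Set.Icc x y, κ ^ 2 * gAlpha α s = (V - ρ * s) ^ 2 := by
    intro s hs
    have h := hconst s hs
    rw [limitCost_eq hρ hρ0] at h
    rw [← h, add_sub_cancel_left, mul_pow, Real.sq_sqrt (gAlpha_nonneg hα (hsub hs))]
  -- differentiate both sides twice on the open interval
  have hd1 : ∀ s ∈ Set.Ioo x y, κ ^ 2 * (2 * α / Real.pi *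
      Real.arctan (s / √(cAlpha α ^ 2 + 1 - s ^ 2)) - 2 * s) = -2 * ρ * (V - ρ * s) := by
    intro s hs
    have h1 := (hasDerivAt_gAlpha hα (hsub (Set.Ioo_subset_Icc_self hs))).1.const_mul (κ ^ 2)
    have h2 : HasDerivAt (fun s => (V - ρ * s) ^ 2) (-2 * ρ * (V - ρ * s)) s := by
      refine ((((hasDerivAt_id s).const_mul ρ).const_sub V).pow 2).congr_deriv ?_
      simp only [id, Nat.cast_ofNat]
      ring
    refine h1.unique (h2.congr_of_eventuallyEq ?_)
    filter_upwards [isOpen_Ioo.mem_nhds hs] with z hz using hsq z (Set.Ioo_subset_Icc_self hz)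
  have hd2 : ∀ s ∈ Set.Ioo x y, κ ^ 2 * (2 * α / Real.pi *
      (1 / √(cAlpha α ^ 2 + 1 - s ^ 2)) - 2) = 2 * ρ ^ 2 := by
    intro s hs
    have h1 := ((((hasDerivAt_gAlpha hα (hsub (Set.Ioo_subset_Icc_self hs))).2.const_mul
      (2 * α / Real.pi)).sub ((hasDerivAt_id s).const_mul 2)).const_mul (κ ^ 2))
    have h2 : HasDerivAt (fun s => -2 * ρ * (V - ρ * s)) (2 * ρ ^ 2) s := by
      refine ((((hasDerivAt_id s).const_mul ρ).const_sub V).const_mul (-2 * ρ)).congr_deriv ?_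
      ring
    rw [mul_one] at h1
    refine h1.unique (h2.congr_of_eventuallyEq ?_)
    filter_upwards [isOpen_Ioo.mem_nhds hs] with z hz using hd1 z hz
  obtain ⟨s, hs1, hs2⟩ := exists_between hxy
  obtain ⟨s', hs1', hs2'⟩ := exists_between hs2
  have e1 := hd2 s ⟨hs1, hs2⟩
  have e2 := hd2 s' ⟨hs1.trans hs1', hs2'⟩
  have hκ2 : κ ^ 2 ≠ 0 := by
    intro h0
    rw [h0, zero_mul] at e1
    nlinarith
  have hs0 : 0 ≤ s := hx1.1.trans hs1.le
  have hpos := sq_add_pos_of_mem hα (hsub ⟨(hs1.trans hs1').le, hs2'.le⟩)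
  have hlt : √(cAlpha α ^ 2 + 1 - s' ^ 2) < √(cAlpha α ^ 2 + 1 - s ^ 2) :=
    Real.sqrt_lt_sqrt hpos.le (by nlinarith)
  have hlt2 := one_div_lt_one_div_of_lt (Real.sqrt_pos.2 hpos) hlt
  have h3 := mul_left_cancel₀ hκ2 (e1.trans e2.symm)
  have h4 : 0 < 2 * α / Real.pi := div_pos (by linarith) Real.pi_pos
  have h5 := mul_lt_mul_of_pos_left hlt2 h4
  linarith

lemma exists_limitArgmax_eq (hα : 2 < α) {ρ : ℝ} (hρ : ρ ≤ 1) (hρ0 : 0 < ρ) :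
    ∃ s, limitArgmax ρ α = {s} := by
  have hc : ContinuousOn (limitCost ρ α) (Set.Icc 0 1) := by
    unfold limitCost
    exact (by fun_prop : ContinuousOn (fun s => ρ * s) _).add
      (Real.continuous_sqrt.comp_continuousOn (continuousOn_const.mul (continuousOn_gAlpha hα)))
  obtain ⟨s, hs, hmax⟩ := isCompact_Icc.exists_isMaxOn ⟨0, by simp⟩ hc
  refine ⟨s, Set.eq_singleton_iff_unique_mem.2 ⟨⟨hs, hmax⟩, fun y hy => ?_⟩⟩
  rcases lt_trichotomy y s with h | h | h
  · exact (limitArgmax_subsingleton hα hρ hρ0 hy ⟨hs, hmax⟩ h).elim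
  · exact h
  · exact (limitArgmax_subsingleton hα hρ hρ0 ⟨hs, hmax⟩ hy h).elim

lemma rowSq_neg (s t τ : ℝ) : rowSq (-s, t, τ) = rowSq (s, t, τ) := by
  rw [rowSq_eq_meanSq, rowSq_eq_meanSq, meanSq_neg (Real.sqrt_nonneg _)]

/-- A limiting feasible point with `s > 1`, scaled towards the origin, would give one with `s = 1`.
There `g_α(1) = 0` leaves only the signal itself, and `s > 1` is infeasible with zero tail. -/
lemma le_one_of_feasible (hα : 2 < α) {s t τ : ℝ} (hτ : 0 ≤ τ)
    (h : α * rowSq (s, t, τ) ≤ τ ^ 2) : s ≤ 1 := by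
  by_contra! hs
  have hs0 : 0 < s := by linarith
  have h1 := sqrt_mul_rowSq_le hτ h
  have hz : rowSq (0, 0, 0) = 0 := by
    rw [rowSq_eq_meanSq]; simpa using meanSq_zero (s := 0) (by simp)
  have hinv : s⁻¹ ≤ 1 := inv_le_one_of_one_le₀ hs.le
  have h2 := sqrt_mul_rowSq_combo hα (p := (s, t, τ)) (p' := (0, 0, 0)) (a := s⁻¹) (b := 1 - s⁻¹)
    (by positivity) (by linarith) (by ring)
  have e : s⁻¹ • (s, t, τ) + (1 - s⁻¹) • ((0, 0, 0) : ℝ × ℝ × ℝ) = (1, s⁻¹ * t, s⁻¹ * τ) := by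
    simp [hs0.ne']
  rw [e, hz, mul_zero, Real.sqrt_zero, mul_zero, add_zero] at h2
  have h3 : √(α * rowSq (1, s⁻¹ * t, s⁻¹ * τ)) ≤ s⁻¹ * τ :=
    h2.trans (mul_le_mul_of_nonneg_left h1 (by positivity))
  rw [Real.sqrt_le_left (by positivity)] at h3
  have h4 := sq_le_margin h3
  have hone : (1 : ℝ) ∈ Set.Icc (0 : ℝ) 1 := ⟨zero_le_one, le_rfl⟩
  have h5 := eq_rAlpha_of_margin_eq hα hone (Real.sqrt_nonneg _)
    ((gAlpha_one hα).le.trans ((sq_nonneg _).trans h4))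
  rw [rAlpha_one hα, Real.sqrt_eq_zero (by positivity)] at h5
  have hst : s⁻¹ ≠ 0 := by positivity
  have ht0 : t = 0 := by
    have : (s⁻¹ * t) ^ 2 = 0 := by nlinarith [sq_nonneg (s⁻¹ * t), sq_nonneg (s⁻¹ * τ)]
    simpa [hst] using this
  have hτ0 : τ = 0 := by
    have : (s⁻¹ * τ) ^ 2 = 0 := by nlinarith [sq_nonneg (s⁻¹ * t), sq_nonneg (s⁻¹ * τ)]
    simpa [hst] using this
  rw [ht0, hτ0, rowSq_eq_meanSq] at h
  have h6 := meanSq_pos hs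
  simp only [ne_eq, OfNat.ofNat_ne_zero, not_false_eq_true, zero_pow, add_zero,
    Real.sqrt_zero] at h
  nlinarith

lemma abs_le_one_of_feasible (hα : 2 < α) {s t τ : ℝ} (hτ : 0 ≤ τ)
    (h : α * rowSq (s, t, τ) ≤ τ ^ 2) : |s| ≤ 1 := by
  refine abs_le'.2 ⟨le_one_of_feasible hα hτ h, ?_⟩
  exact le_one_of_feasible (t := t) hα hτ (by rwa [rowSq_neg])

lemma rowSq_abs (s t τ : ℝ) : rowSq (|s|, t, τ) = rowSq (s, t, τ) := by
  rcases abs_choice s with h | h <;> rw [h]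
  exact rowSq_neg s t τ

/-- The limiting problem: `limitCost` at its maximizer bounds the objective on the limiting
feasible set, with equality at one value of `s` and of the radius only. -/
lemma objective_le (hα : 2 < α) {ρ : ℝ} (hρ : ρ ≤ 1) (hρ0 : 0 < ρ) {s₀ : ℝ}
    (hs₀ : limitArgmax ρ α = {s₀}) {s t τ : ℝ} (hτ : 0 ≤ τ)
    (h : α * rowSq (s, t, τ) ≤ τ ^ 2) :
    ρ * s + √(1 - ρ ^ 2) * t ≤ limitCost ρ α s₀ ∧
      (limitCost ρ α s₀ ≤ ρ * s + √(1 - ρ ^ 2) * t →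
        s = s₀ ∧ √(t ^ 2 + τ ^ 2) = rAlpha α s₀) := by
  have hmem : s₀ ∈ limitArgmax ρ α := by rw [hs₀]; rfl
  have hs1 := abs_le_one_of_feasible hα hτ h
  have hS : |s| ∈ Set.Icc (0 : ℝ) 1 := ⟨abs_nonneg s, hs1⟩
  have hm : t ^ 2 ≤ margin α |s| √(t ^ 2 + τ ^ 2) := sq_le_margin (by rwa [rowSq_abs])
  have hg := margin_le hα hS (Real.sqrt_nonneg (t ^ 2 + τ ^ 2))
  have ht : t ≤ √(gAlpha α |s|) := Real.le_sqrt_of_sq_le (hm.trans hg)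
  have hκ : 0 ≤ √(1 - ρ ^ 2) := Real.sqrt_nonneg _
  have hle1 : ρ * s ≤ ρ * |s| := mul_le_mul_of_nonneg_left (le_abs_self s) hρ0.le
  have hle2 := mul_le_mul_of_nonneg_left ht hκ
  have hle3 : limitCost ρ α |s| ≤ limitCost ρ α s₀ := hmem.2 hS
  have hL := limitCost_eq (α := α) hρ hρ0 |s|
  refine ⟨by linarith, fun hge => ?_⟩
  have hseq : |s| = s := by
    have : ρ * s = ρ * |s| := by linarith
    exact (mul_left_cancel₀ hρ0.ne' this).symm
  have hss : |s| = s₀ := by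
    have : |s| ∈ limitArgmax ρ α :=
      ⟨hS, fun z hz => le_trans (b := limitCost ρ α s₀) (hmem.2 hz) (by linarith)⟩
    rw [hs₀] at this
    exact this
  refine ⟨hseq.symm.trans hss, ?_⟩
  rw [← hss]
  refine eq_rAlpha_of_margin_eq hα hS (Real.sqrt_nonneg _) ?_
  rcases hκ.eq_or_lt with h0 | hpos
  · -- `ρ = 1`: the maximizer is `1`, where `g_α` vanishes
    have hL1 := limitCost_eq (α := α) hρ hρ0 1
    have h1 : limitCost ρ α 1 ≤ limitCost ρ α s₀ := hmem.2 ⟨zero_le_one, le_rfl⟩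
    rw [← h0] at hL hL1 hge
    have : 1 ≤ |s| := by
      by_contra! hlt
      nlinarith
    rw [le_antisymm hs1 this] at hm ⊢
    rw [gAlpha_one hα]
    exact (sq_nonneg t).trans hm
  · have : √(1 - ρ ^ 2) * √(gAlpha α |s|) ≤ √(1 - ρ ^ 2) * t := by linarith
    have h2 := le_of_mul_le_mul_left this hpos
    have h3 := pow_le_pow_left₀ (Real.sqrt_nonneg _) h2 2
    rw [Real.sq_sqrt (gAlpha_nonneg hα hS)] at h3
    exact h3.trans hm

/-- For large `r` the mean square violation is close to `r²`; half of that suffices, as `α > 2`. -/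
lemma half_sq_le_meanSq {s r : ℝ} (hs : |s| ≤ 1) (hr : 2 ≤ r) :
    r ^ 2 / 2 - 2 * r ≤ meanSq s r := by
  have hr0 : 0 < r := by linarith
  rw [abs_le] at hs
  have key : ∀ u ∈ Set.Icc (0 : ℝ) 2, r ^ 2 * (Real.pi / 4) - 2 * r ≤ sectorFn r u := by
    intro u hu
    have h1 : Real.arctan (u / r) ≤ Real.pi / 4 := by
      rw [← Real.arctan_one]
      exact Real.arctan_mono ((div_le_one hr0).2 (hu.2.trans hr))
    have h2 := Real.pi_pos
    unfold sectorFn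
    have h3 : r ^ 2 * (Real.pi / 4) ≤ (r ^ 2 + u ^ 2) * (Real.pi / 2 - Real.arctan (u / r)) :=
      mul_le_mul (by nlinarith) (by linarith) (by positivity) (by positivity)
    nlinarith [hu.2]
  rw [meanSq_eq hr0, le_inv_mul_iff₀ Real.pi_pos]
  have h1 := key (1 - s) ⟨by linarith [hs.2], by linarith [hs.1]⟩
  have h2 := key (1 + s) ⟨by linarith [hs.1], by linarith [hs.2]⟩
  nlinarith [Real.pi_gt_three]

/-- The limiting feasible set is bounded because `α > 2`. -/
lemma exists_bound_of_feasible (hα : 2 < α) : ∃ R : ℝ, ∀ s t τ : ℝ, 0 ≤ τ →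
    α * rowSq (s, t, τ) ≤ τ ^ 2 → s ^ 2 + t ^ 2 + τ ^ 2 ≤ R := by
  refine ⟨1 + (2 + 4 * α / (α - 2)) ^ 2, fun s t τ hτ h => ?_⟩
  have hs := abs_le_one_of_feasible hα hτ h
  have hs2 : s ^ 2 ≤ 1 := (sq_le_one_iff_abs_le_one s).2 hs
  have hq : 0 < 4 * α / (α - 2) := div_pos (by linarith) (by linarith)
  have hm := (sq_nonneg t).trans (sq_le_margin h)
  set r := √(t ^ 2 + τ ^ 2) with hr
  have hr2 : r ^ 2 = t ^ 2 + τ ^ 2 := Real.sq_sqrt (by positivity)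
  have hr0 : 0 ≤ r := Real.sqrt_nonneg _
  have hbd : r ≤ 2 + 4 * α / (α - 2) := by
    by_contra! hlt
    have h1 := half_sq_le_meanSq hs (by linarith : 2 ≤ r)
    have h2 := mul_le_mul_of_nonneg_left h1 (by linarith : 0 ≤ α)
    rw [margin] at hm
    have h3 : 4 * α < r * (α - 2) := by
      rw [← div_lt_iff₀ (by linarith)]; linarith
    nlinarith
  have := pow_le_pow_left₀ hr0 hbd 2
  linarith

/-- Strictly feasible points of the limiting problem come arbitrarily close to its optimal
value. -/
lemma exists_strictly_feasible (hα : 2 < α) {ρ : ℝ} (hρ : ρ ≤ 1) (hρ0 : 0 < ρ) {s₀ : ℝ}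
    (hs₀ : s₀ ∈ Set.Icc (0 : ℝ) 1) {η : ℝ} (hη : 0 < η) :
    ∃ s t τ : ℝ, 0 < τ ∧ α * rowSq (s, t, τ) < τ ^ 2 ∧
      limitCost ρ α s₀ - η < ρ * s + √(1 - ρ ^ 2) * t := by
  have hpi := Real.pi_pos
  have hα0 : 0 < α := by linarith
  -- a strictly feasible point near the origin
  obtain ⟨τ₀, hτ₀, hτ₀'⟩ : ∃ τ₀ : ℝ, 0 < τ₀ ∧ α * rowSq (0, 0, τ₀) < τ₀ ^ 2 := by
    refine ⟨Real.pi / (4 * α), by positivity, ?_⟩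
    set τ := Real.pi / (4 * α) with hτ
    have hτ0 : 0 < τ := by positivity
    have h1 : rowSq (0, 0, τ) = Real.pi⁻¹ * (2 * sectorFn τ 1) := by
      rw [rowSq_eq_meanSq, zero_pow two_ne_zero, zero_add, Real.sqrt_sq hτ0.le, meanSq_eq hτ0]
      simp; ring
    have h2 : sectorFn τ 1 ≤ τ ^ 3 := by
      unfold sectorFn
      have e : Real.pi / 2 - Real.arctan (1 / τ) = Real.arctan τ := by
        rw [one_div, Real.arctan_inv_of_pos hτ0]; ring
      rw [e]
      have h3 : Real.arctan τ ≤ τ := by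
        have := Real.le_tan (Real.arctan_nonneg.2 hτ0.le) (Real.arctan_lt_pi_div_two τ)
        rwa [Real.tan_arctan] at this
      nlinarith [mul_le_mul_of_nonneg_left h3 (by positivity : 0 ≤ τ ^ 2 + 1 ^ 2)]
    rw [h1]
    have h4 : α * (Real.pi⁻¹ * (2 * τ ^ 3)) = τ ^ 2 / 2 := by
      have : α * τ = Real.pi / 4 := by rw [hτ]; field_simp
      have h5 : α * (Real.pi⁻¹ * (2 * τ ^ 3)) = Real.pi⁻¹ * 2 * τ ^ 2 * (α * τ) := by ring
      rw [h5, this]; field_simp; norm_num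
    have h6 : α * (Real.pi⁻¹ * (2 * sectorFn τ 1)) ≤ α * (Real.pi⁻¹ * (2 * τ ^ 3)) := by gcongr
    have : 0 < τ ^ 2 := by positivity
    linarith
  set κ := √(1 - ρ ^ 2)
  set V := limitCost ρ α s₀ with hV
  -- move from the extreme point towards it
  set b : ℝ := min 1 (η / (2 * (|V| + 1))) with hb
  have hb0 : 0 < b := lt_min one_pos (by positivity)
  have hb1 : b ≤ 1 := min_le_left _ _
  have hbV : b * |V| < η := by
    have h1 : b * (2 * (|V| + 1)) ≤ η := by
      rw [← le_div_iff₀ (by positivity)]; exact min_le_right _ _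
    nlinarith [abs_nonneg V]
  set τ₁ := √(rAlpha α s₀ ^ 2 - gAlpha α s₀)
  have hτ₁ : 0 ≤ τ₁ := Real.sqrt_nonneg _
  refine ⟨(1 - b) * s₀, (1 - b) * √(gAlpha α s₀), (1 - b) * τ₁ + b * τ₀, ?_, ?_, ?_⟩
  · have := mul_pos hb0 hτ₀
    have := mul_nonneg (sub_nonneg.2 hb1) hτ₁
    linarith
  · have h := sqrt_mul_rowSq_combo hα (p := extremePoint α s₀) (p' := (0, 0, τ₀)) (a := 1 - b)
      (b := b) (by linarith) hb0.le (by ring)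
    rw [mul_rowSq_extremePoint hα hs₀, Real.sqrt_sq hτ₁] at h
    have e : (1 - b) • extremePoint α s₀ + b • ((0, 0, τ₀) : ℝ × ℝ × ℝ) =
        ((1 - b) * s₀, (1 - b) * √(gAlpha α s₀), (1 - b) * τ₁ + b * τ₀) := by
      simp [extremePoint, τ₁]
    rw [e] at h
    have h2 : √(α * rowSq (0, 0, τ₀)) < τ₀ := by
      rw [Real.sqrt_lt' hτ₀]; exact hτ₀'
    have h3 := h.trans_lt (add_lt_add_right (mul_lt_mul_of_pos_left h2 hb0) _)
    rwa [Real.sqrt_lt' ((Real.sqrt_nonneg _).trans_lt h3)] at h3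
  · have e : ρ * ((1 - b) * s₀) + κ * ((1 - b) * √(gAlpha α s₀)) = (1 - b) * V := by
      rw [hV, limitCost_eq hρ hρ0]; ring
    rw [e]
    nlinarith [le_abs_self V]

/-- The points `(s, t, τ)` to be excluded: those at distance `R` from the origin, and those which
are nearly optimal but away from the solution of the limiting problem. -/
def badSet (ρ α s₀ ε η R : ℝ) : Set (ℝ × ℝ × ℝ) :=
  {p | 0 ≤ p.2.2 ∧ p.1 ^ 2 + p.2.1 ^ 2 + p.2.2 ^ 2 ≤ R ^ 2 ∧
    (p.1 ^ 2 + p.2.1 ^ 2 + p.2.2 ^ 2 = R ^ 2 ∨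
      (limitCost ρ α s₀ - η ≤ ρ * p.1 + √(1 - ρ ^ 2) * p.2.1 ∧
        (ε ≤ |p.1 - s₀| ∨ ε ≤ |√(p.2.1 ^ 2 + p.2.2 ^ 2) - rAlpha α s₀| ∨
          ε ≤ |ρ * p.1 + √(1 - ρ ^ 2) * p.2.1 - limitCost ρ α s₀|)))}

lemma isCompact_of_isClosed_bounded {S : Set (ℝ × ℝ × ℝ)} (hS : IsClosed S) {R : ℝ} (hR : 0 ≤ R)
    (h : ∀ p ∈ S, p.1 ^ 2 + p.2.1 ^ 2 + p.2.2 ^ 2 ≤ R ^ 2) : IsCompact S := by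
  refine (isCompact_closedBall (0 : ℝ × ℝ × ℝ) R).of_isClosed_subset hS fun p hp => ?_
  have h1 := h p hp
  rw [mem_closedBall_zero_iff, Prod.norm_def, Prod.norm_def]
  refine max_le ?_ (max_le ?_ ?_)
  · exact abs_le_of_sq_le_sq (by nlinarith [sq_nonneg p.1, sq_nonneg p.2.1, sq_nonneg p.2.2]) hR
  · exact abs_le_of_sq_le_sq (by nlinarith [sq_nonneg p.1, sq_nonneg p.2.1, sq_nonneg p.2.2]) hR
  · exact abs_le_of_sq_le_sq (by nlinarith [sq_nonneg p.1, sq_nonneg p.2.1, sq_nonneg p.2.2]) hR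

lemma isCompact_badSet (ρ α s₀ ε η : ℝ) {R : ℝ} (hR : 0 ≤ R) :
    IsCompact (badSet ρ α s₀ ε η R) := by
  refine isCompact_of_isClosed_bounded ?_ hR fun p hp => hp.2.1
  unfold badSet
  simp only [Set.ofPred_and, Set.ofPred_or]
  refine (isClosed_le continuous_const (by fun_prop)).inter
    ((isClosed_le (by fun_prop) continuous_const).inter
      ((isClosed_eq (by fun_prop) continuous_const).union
        ((isClosed_le continuous_const (by fun_prop)).inter
          ((isClosed_le continuous_const (by fun_prop)).union
            ((isClosed_le continuous_const (by fun_prop)).union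
              (isClosed_le continuous_const (by fun_prop)))))))

/-- For `R` large and `η` small the excluded points lie strictly outside the limiting feasible
set. -/
lemma exists_badSet_infeasible (hα : 2 < α) {ρ : ℝ} (hρ : ρ ≤ 1) (hρ0 : 0 < ρ) {s₀ : ℝ}
    (hs₀ : limitArgmax ρ α = {s₀}) {ε : ℝ} (hε : 0 < ε) :
    ∃ η R : ℝ, 0 < η ∧ 0 < R ∧ (∀ p ∈ badSet ρ α s₀ ε η R, p.2.2 ^ 2 < α * rowSq p) ∧
      ∀ s t τ : ℝ, 0 ≤ τ → α * rowSq (s, t, τ) ≤ τ ^ 2 → s ^ 2 + t ^ 2 + τ ^ 2 ≤ R ^ 2 := by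
  obtain ⟨R₀, hR₀⟩ := exists_bound_of_feasible hα
  set R := |R₀| + 1 with hR
  have hR0 : 0 < R := by positivity
  have hRR : R₀ < R ^ 2 := by nlinarith [le_abs_self R₀, abs_nonneg R₀]
  set obj : ℝ × ℝ × ℝ → ℝ := fun p => ρ * p.1 + √(1 - ρ ^ 2) * p.2.1 with hobj
  have hobjc : Continuous obj := by unfold obj; fun_prop
  set S : Set (ℝ × ℝ × ℝ) := {p | 0 ≤ p.2.2 ∧ p.1 ^ 2 + p.2.1 ^ 2 + p.2.2 ^ 2 ≤ R ^ 2 ∧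
    α * rowSq p ≤ p.2.2 ^ 2 ∧ (ε ≤ |p.1 - s₀| ∨ ε ≤ |√(p.2.1 ^ 2 + p.2.2 ^ 2) - rAlpha α s₀| ∨
      ε ≤ |obj p - limitCost ρ α s₀|)} with hS
  have hScl : IsClosed S := by
    simp only [hS, Set.ofPred_and, Set.ofPred_or]
    exact (isClosed_le continuous_const (by fun_prop)).inter
      ((isClosed_le (by fun_prop) continuous_const).inter
        ((isClosed_le (continuous_const.mul continuous_rowSq) (by fun_prop)).inter
          ((isClosed_le continuous_const (by fun_prop)).union
            ((isClosed_le continuous_const (by fun_prop)).union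
              (isClosed_le continuous_const (by fun_prop))))))
  have hSc : IsCompact S := isCompact_of_isClosed_bounded hScl hR0.le fun p hp => hp.2.1
  have hlt : ∀ p ∈ S, obj p < limitCost ρ α s₀ := by
    rintro ⟨s, t, τ⟩ ⟨h1, -, h3, h4⟩
    have h := objective_le hα hρ hρ0 hs₀ h1 h3
    refine lt_of_not_ge fun hge => ?_
    obtain ⟨hs, hr⟩ := h.2 hge
    have h5 : obj (s, t, τ) - limitCost ρ α s₀ = 0 := sub_eq_zero.2 (le_antisymm h.1 hge)
    rcases h4 with h4 | h4 | h4
    · simp only [hs, sub_self, abs_zero] at h4; linarith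
    · simp only [hr, sub_self, abs_zero] at h4; linarith
    · simp only [h5, abs_zero] at h4; linarith
  obtain ⟨η, hη, hηS⟩ : ∃ η > 0, ∀ p ∈ S, obj p < limitCost ρ α s₀ - η := by
    rcases S.eq_empty_or_nonempty with he | hne
    · exact ⟨1, one_pos, by simp [he]⟩
    · obtain ⟨p, hp, hmax⟩ := hSc.exists_isMaxOn hne hobjc.continuousOn
      refine ⟨(limitCost ρ α s₀ - obj p) / 2, by linarith [hlt p hp], fun q hq => ?_⟩
      have h1 : obj q ≤ obj p := hmax hq
      have h2 := hlt p hp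
      linarith
  refine ⟨η, R, hη, hR0, fun p hp => ?_, fun s t τ hτ h => (hR₀ s t τ hτ h).trans hRR.le⟩
  obtain ⟨h1, h2, h3⟩ := hp
  by_contra! hcon
  rcases h3 with h3 | ⟨h3, h4⟩
  · have := hR₀ p.1 p.2.1 p.2.2 h1 hcon
    linarith
  · have := hηS p ⟨h1, h2, hcon, h4⟩
    exact absurd h3 (not_le.2 this)

end LimitProblem

/-! ### Laws of large numbers for the auxiliary problem -/

lemma isClosed_exists_of_isCompact {X Y : Type*} [TopologicalSpace X] [TopologicalSpace Y]
    {K : Set Y} (hK : IsCompact K) {S : Set (X × Y)} (hS : IsClosed S) :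
    IsClosed {x | ∃ y ∈ K, (x, y) ∈ S} := by
  have : CompactSpace K := isCompact_iff_compactSpace.1 hK
  have h1 : IsClosed ((fun z : X × K => (z.1, (z.2 : Y))) ⁻¹' S) :=
    hS.preimage (by fun_prop)
  have h2 := isClosedMap_fst_of_compactSpace (X := X) (Y := K) _ h1
  convert! h2 using 1
  ext x
  simp only [Set.mem_ofPred_eq, Set.mem_image, Set.mem_preimage, Prod.exists]
  constructor
  · rintro ⟨y, hy, h⟩
    exact ⟨x, ⟨y, hy⟩, h, rfl⟩
  · rintro ⟨x', y, h, rfl⟩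
    exact ⟨y, y.2, h⟩

/-- Convergence in probability to a constant for random variables that live on varying
probability spaces. -/
def TendstoProb {Ω : ℕ → Type*} [∀ n, MeasurableSpace (Ω n)] (μ : ∀ n, Measure (Ω n))
    (X : ∀ n, Ω n → ℝ) (c : ℝ) : Prop :=
  ∀ δ : ℝ, 0 < δ → Tendsto (fun n => μ n {ω | δ ≤ |X n ω - c|}) atTop (𝓝 0)

section TendstoProb

variable {Ω : ℕ → Type*} [∀ n, MeasurableSpace (Ω n)] {μ : ∀ n, Measure (Ω n)}

lemma tendsto_measure_zero_of_subset {A B : ∀ n, Set (Ω n)}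
    (hB : Tendsto (fun n => μ n (B n)) atTop (𝓝 0)) (h : ∀ᶠ n in atTop, A n ⊆ B n) :
    Tendsto (fun n => μ n (A n)) atTop (𝓝 0) :=
  tendsto_of_tendsto_of_tendsto_of_le_of_le' tendsto_const_nhds hB
    (Eventually.of_forall fun _ => zero_le)
    (h.mono fun _ hn => measure_mono hn)

lemma tendsto_measure_union_zero {A B : ∀ n, Set (Ω n)}
    (hA : Tendsto (fun n => μ n (A n)) atTop (𝓝 0))
    (hB : Tendsto (fun n => μ n (B n)) atTop (𝓝 0)) :
    Tendsto (fun n => μ n (A n ∪ B n)) atTop (𝓝 0) := by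
  have h := hA.add hB
  rw [add_zero] at h
  exact tendsto_of_tendsto_of_tendsto_of_le_of_le tendsto_const_nhds h
    (fun _ => zero_le) fun _ => measure_union_le _ _

lemma tendsto_measure_biUnion_zero {ι : Type*} {t : Set ι} (ht : t.Finite) {A : ι → ∀ n, Set (Ω n)}
    (hA : ∀ i ∈ t, Tendsto (fun n => μ n (A i n)) atTop (𝓝 0)) :
    Tendsto (fun n => μ n (⋃ i ∈ t, A i n)) atTop (𝓝 0) := by
  have h := tendsto_finsetSum ht.toFinset (f := fun i n => μ n (A i n)) (a := fun _ => 0)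
    fun i hi => hA i (ht.mem_toFinset.1 hi)
  rw [Finset.sum_const_zero] at h
  refine tendsto_of_tendsto_of_tendsto_of_le_of_le tendsto_const_nhds h (fun _ => zero_le)
    fun n => ?_
  refine le_trans (measure_mono ?_) (measure_biUnion_finset_le ht.toFinset fun i => A i n)
  simp

lemma TendstoProb.const {x : ℕ → ℝ} {c : ℝ} (h : Tendsto x atTop (𝓝 c)) :
    TendstoProb μ (fun n _ => x n) c := by
  intro δ hδ
  refine tendsto_measure_zero_of_subset (B := fun _ => ∅) (by simp) ?_
  filter_upwards [Metric.tendsto_atTop'.1 h δ hδ |>.elim fun N hN =>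
    eventually_atTop.2 ⟨N + 1, fun n hn => hN n hn⟩] with n hn
  intro ω hω
  rw [Real.dist_eq] at hn
  exact absurd hω (not_le.2 hn)

lemma TendstoProb.map₂ {X Y : ∀ n, Ω n → ℝ} {c d : ℝ} (hX : TendstoProb μ X c)
    (hY : TendstoProb μ Y d) (φ : ℝ × ℝ → ℝ) (hφ : ContinuousAt φ (c, d)) :
    TendstoProb μ (fun n ω => φ (X n ω, Y n ω)) (φ (c, d)) := by
  intro δ hδ
  obtain ⟨η, hη, h⟩ := Metric.continuousAt_iff.1 hφ δ hδ
  refine tendsto_measure_zero_of_subset (tendsto_measure_union_zero (hX η hη) (hY η hη))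
    (Eventually.of_forall fun n ω hω => ?_)
  by_contra hcon
  simp only [Set.mem_union, Set.mem_ofPred_eq, not_or, not_le] at hcon
  have : dist (X n ω, Y n ω) (c, d) < η := by
    rw [Prod.dist_eq]
    exact max_lt hcon.1 hcon.2
  exact absurd hω (not_le.2 (h this))

lemma TendstoProb.tendsto_le {X : ∀ n, Ω n → ℝ} {c b : ℝ} (hX : TendstoProb μ X c) (h : b < c) :
    Tendsto (fun n => μ n {ω | X n ω ≤ b}) atTop (𝓝 0) := by
  refine tendsto_measure_zero_of_subset (hX (c - b) (by linarith))
    (Eventually.of_forall fun n ω (hω : X n ω ≤ b) => ?_)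
  change c - b ≤ |X n ω - c|
  rw [abs_sub_comm]
  exact le_trans (by linarith) (le_abs_self _)

lemma TendstoProb.tendsto_ge {X : ∀ n, Ω n → ℝ} {c b : ℝ} (hX : TendstoProb μ X c) (h : c < b) :
    Tendsto (fun n => μ n {ω | b ≤ X n ω}) atTop (𝓝 0) := by
  refine tendsto_measure_zero_of_subset (hX (b - c) (by linarith))
    (Eventually.of_forall fun n ω (hω : b ≤ X n ω) => ?_)
  change b - c ≤ |X n ω - c|
  exact le_trans (by linarith) (le_abs_self _)

end TendstoProb

/-- Chebyshev's weak law of large numbers for a triangular array. -/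
lemma tendstoProb_average {X : Type*} [MeasurableSpace X] (ν : Measure X) [IsProbabilityMeasure ν]
    {f : X → ℝ} (hf : MemLp f 2 ν) {m : ℕ → ℕ} (hm : Tendsto m atTop atTop) :
    TendstoProb (fun n => Measure.pi fun _ : Fin (m n) => ν)
      (fun n x => (∑ i, f (x i)) / m n) (∫ x, f x ∂ν) := by
  intro δ hδ
  have key : ∀ k : ℕ, 0 < k → (Measure.pi fun _ : Fin k => ν)
      {x | δ ≤ |(∑ i, f (x i)) / k - ∫ x, f x ∂ν|} ≤
        ENNReal.ofReal (Var[f; ν] / (k * δ ^ 2)) := by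
    intro k hk
    have hk' : (0 : ℝ) < k := by exact_mod_cast hk
    have mp : ∀ i : Fin k, MeasurePreserving (fun x : Fin k → X => x i)
        (Measure.pi fun _ : Fin k => ν) ν := fun i => measurePreserving_eval (fun _ => ν) i
    have hfi : ∀ i : Fin k, MemLp (fun x : Fin k → X => f (x i)) 2
        (Measure.pi fun _ : Fin k => ν) := fun i => hf.comp_measurePreserving (mp i)
    have hS : MemLp (∑ i : Fin k, fun x : Fin k → X => f (x i)) 2
        (Measure.pi fun _ : Fin k => ν) := memLp_finsetSum' _ fun i _ => hfi i
    have hind : iIndepFun (fun (i : Fin k) (x : Fin k → X) => f (x i))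
        (Measure.pi fun _ : Fin k => ν) :=
      iIndepFun_pi (X := fun _ : Fin k => f) fun _ => hf.aestronglyMeasurable.aemeasurable
    have hvar : Var[∑ i : Fin k, fun x : Fin k → X => f (x i); Measure.pi fun _ : Fin k => ν] =
        k * Var[f; ν] := by
      rw [IndepFun.variance_sum (fun i _ => hfi i) fun i _ j _ hij => hind.indepFun hij]
      have : ∀ i : Fin k, Var[fun x : Fin k → X => f (x i); Measure.pi fun _ : Fin k => ν] =
          Var[f; ν] := fun i =>
        (mp i).variance_fun_comp hf.aestronglyMeasurable.aemeasurable
      simp [this]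
    have hmean : ∫ x, (∑ i : Fin k, fun x : Fin k → X => f (x i)) x
        ∂(Measure.pi fun _ : Fin k => ν) = k * ∫ x, f x ∂ν := by
      simp only [Finset.sum_apply]
      rw [integral_finsetSum _ fun i _ => (hfi i).integrable (by norm_num)]
      have : ∀ i : Fin k, ∫ x : Fin k → X, f (x i) ∂(Measure.pi fun _ : Fin k => ν) =
          ∫ x, f x ∂ν := by
        intro i
        have h := integral_map (mp i).aemeasurable
          (f := f) (by rw [(mp i).map_eq]; exact hf.aestronglyMeasurable)
        rw [(mp i).map_eq] at h
        exact h.symm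
      simp [this]
    have h := meas_ge_le_variance_div_sq hS (c := k * δ) (by positivity)
    rw [hvar, hmean] at h
    have e : k * Var[f; ν] / (k * δ) ^ 2 = Var[f; ν] / (k * δ ^ 2) := by
      field_simp
    rw [e] at h
    refine le_trans (measure_mono fun x hx => ?_) h
    have hx' : δ ≤ |(∑ i, f (x i)) / k - ∫ x, f x ∂ν| := hx
    change k * δ ≤ |(∑ i : Fin k, fun x : Fin k → X => f (x i)) x - k * ∫ x, f x ∂ν|
    rw [Finset.sum_apply]
    have e2 : (∑ i, f (x i)) - k * ∫ x, f x ∂ν = k * ((∑ i, f (x i)) / k - ∫ x, f x ∂ν) := by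
      field_simp
    rw [e2, abs_mul, abs_of_pos hk']
    gcongr
  have hlim : Tendsto (fun n => ENNReal.ofReal (Var[f; ν] / (m n * δ ^ 2))) atTop (𝓝 0) := by
    rw [← ENNReal.ofReal_zero]
    refine ENNReal.tendsto_ofReal (Tendsto.div_atTop tendsto_const_nhds ?_)
    exact (tendsto_natCast_atTop_atTop.comp hm).atTop_mul_const (by positivity)
  refine tendsto_of_tendsto_of_tendsto_of_le_of_le' tendsto_const_nhds hlim
    (Eventually.of_forall fun _ => zero_le) ?_
  filter_upwards [hm.eventually_gt_atTop 0] with n hn using key (m n) hn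

lemma TendstoProb.comp_measurePreserving {Ω Ω' : ℕ → Type*} [∀ n, MeasurableSpace (Ω n)]
    [∀ n, MeasurableSpace (Ω' n)] {μ : ∀ n, Measure (Ω n)} {μ' : ∀ n, Measure (Ω' n)}
    {X : ∀ n, Ω n → ℝ} {c : ℝ} (hX : TendstoProb μ X c) {T : ∀ n, Ω' n → Ω n}
    (hT : ∀ n, MeasurePreserving (T n) (μ' n) (μ n)) (hm : ∀ n, Measurable (X n)) :
    TendstoProb μ' (fun n ω => X n (T n ω)) c := by
  intro δ hδ
  refine (hX δ hδ).congr fun n => ?_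
  rw [← (hT n).measure_preimage]
  · rfl
  · exact (measurableSet_le measurable_const ((hm n).sub_const c).norm).nullMeasurableSet

/-- The space of the Gaussian data `((q, g), (h, k))` of the auxiliary problem. -/
abbrev AuxSpace (m k : ℕ) : Type :=
  ((Fin m → ℝ) × (Fin m → ℝ)) × ((Fin m → ℝ) × (Fin k → ℝ))

/-- The law of the Gaussian data of the auxiliary problem. -/
noncomputable abbrev auxMeasure (m k : ℕ) : Measure (AuxSpace m k) :=
  ((gaussPi (Fin m)).prod (gaussPi (Fin m))).prod ((gaussPi (Fin m)).prod (gaussPi (Fin k)))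

/-- The `i`-th row `(qᵢ, gᵢ, hᵢ)`. -/
def auxRow {m k : ℕ} (z : AuxSpace m k) (i : Fin m) : ℝ × ℝ × ℝ := (z.1.1 i, z.1.2 i, z.2.1 i)

lemma measurePreserving_auxRow (m k : ℕ) :
    MeasurePreserving (auxRow (m := m) (k := k)) (auxMeasure m k)
      (Measure.pi fun _ : Fin m => gauss3) := by
  have h1 : MeasurePreserving (fun z : AuxSpace m k => (z.1, z.2.1)) (auxMeasure m k)
      (((gaussPi (Fin m)).prod (gaussPi (Fin m))).prod (gaussPi (Fin m))) :=
    (MeasurePreserving.id _).prod measurePreserving_fst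
  have h2 := measurePreserving_prodAssoc (gaussPi (Fin m)) (gaussPi (Fin m)) (gaussPi (Fin m))
  have h3 := (measurePreserving_arrowProdEquivProdArrow ℝ ℝ (Fin m) (fun _ => gaussianReal 0 1)
    (fun _ => gaussianReal 0 1)).symm
  have h4 := (measurePreserving_arrowProdEquivProdArrow ℝ (ℝ × ℝ) (Fin m)
    (fun _ => gaussianReal 0 1)
    (fun _ => (gaussianReal 0 1).prod (gaussianReal 0 1))).symm
  exact h4.comp (((MeasurePreserving.id (gaussPi (Fin m))).prod h3).comp (h2.comp h1))

lemma measurePreserving_auxTail (m k : ℕ) :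
    MeasurePreserving (fun z : AuxSpace m k => z.2.2) (auxMeasure m k)
      (Measure.pi fun _ : Fin k => gaussianReal 0 1) :=
  (measurePreserving_snd (μ := gaussPi (Fin m)) (ν := gaussPi (Fin k))).comp
    (measurePreserving_snd (μ := (gaussPi (Fin m)).prod (gaussPi (Fin m)))
      (ν := (gaussPi (Fin m)).prod (gaussPi (Fin k))))

/-- The vector of the violations of the constraints of the auxiliary problem at `p`. -/
noncomputable def overVec {m k : ℕ} (p : ℝ × ℝ × ℝ) (z : AuxSpace m k) :
    EuclideanSpace ℝ (Fin m) :=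
  WithLp.toLp 2 fun i => rowOver p (auxRow z i)

/-- The Gaussian vector `k` as an element of the Euclidean space. -/
noncomputable def tailVec {m k : ℕ} (z : AuxSpace m k) : EuclideanSpace ℝ (Fin k) :=
  WithLp.toLp 2 z.2.2

/-- The Euclidean norm of all the row entries `qᵢ, gᵢ, hᵢ`, up to a factor `√3`. -/
noncomputable def rowsNorm {m k : ℕ} (z : AuxSpace m k) : ℝ :=
  √(3 * ∑ i, ((auxRow z i).1 ^ 2 + (auxRow z i).2.1 ^ 2 + (auxRow z i).2.2 ^ 2))

lemma norm_overVec {m k : ℕ} (p : ℝ × ℝ × ℝ) (z : AuxSpace m k) :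
    ‖overVec p z‖ = √(∑ i, rowOver p (auxRow z i) ^ 2) := by
  simp [EuclideanSpace.norm_eq, overVec]

lemma norm_tailVec {m k : ℕ} (z : AuxSpace m k) : ‖tailVec z‖ = √(∑ i, z.2.2 i ^ 2) := by
  simp [EuclideanSpace.norm_eq, tailVec]

lemma norm_overVec_sub_le {m k : ℕ} (p p' : ℝ × ℝ × ℝ) (z : AuxSpace m k) :
    ‖overVec p z - overVec p' z‖ ≤ ‖p - p'‖ * rowsNorm z := by
  rw [EuclideanSpace.norm_eq, rowsNorm, Real.sqrt_le_left (by positivity), mul_pow,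
    Real.sq_sqrt (by positivity), Finset.mul_sum, Finset.mul_sum]
  refine Finset.sum_le_sum fun i _ => ?_
  simp only [overVec, PiLp.sub_apply, Real.norm_eq_abs, rowOver]
  set w := auxRow z i
  have h1 := abs_overshoot_sub_le w.1 (rowVal p w) (rowVal p' w)
  have h2 : |rowVal p w - rowVal p' w| ≤ ‖p - p'‖ * (|w.1| + |w.2.1| + |w.2.2|) := by
    have e : rowVal p w - rowVal p' w =
        (p - p').1 * w.1 + (p - p').2.1 * w.2.1 + (p - p').2.2 * w.2.2 := by
      simp only [rowVal, Prod.fst_sub, Prod.snd_sub]; ring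
    rw [e]
    have n1 : |(p - p').1| ≤ ‖p - p'‖ := norm_fst_le (p - p')
    have n2 : |(p - p').2.1| ≤ ‖p - p'‖ := (norm_fst_le (p - p').2).trans (norm_snd_le _)
    have n3 : |(p - p').2.2| ≤ ‖p - p'‖ := (norm_snd_le (p - p').2).trans (norm_snd_le _)
    refine (abs_add_three _ _ _).trans ?_
    rw [abs_mul, abs_mul, abs_mul, mul_add, mul_add]
    gcongr
  have h3 := h1.trans h2
  refine (pow_le_pow_left₀ (abs_nonneg _) h3 2).trans ?_
  rw [mul_pow]
  refine mul_le_mul_of_nonneg_left ?_ (sq_nonneg _)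
  rw [← sq_abs w.1, ← sq_abs w.2.1, ← sq_abs w.2.2]
  nlinarith [sq_nonneg (|w.1| - |w.2.1|), sq_nonneg (|w.1| - |w.2.2|),
    sq_nonneg (|w.2.1| - |w.2.2|)]

section Limits

variable {α : ℝ} {m : ℕ → ℕ}

lemma tendsto_atTop_of_ratio (hα : 0 < α)
    (hm : Tendsto (fun n => (m n : ℝ) / (n : ℝ)) atTop (𝓝 α)) : Tendsto m atTop atTop := by
  have h := hm.pos_mul_atTop hα tendsto_natCast_atTop_atTop
  rw [← tendsto_natCast_atTop_iff (R := ℝ)]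
  refine h.congr' ?_
  filter_upwards [eventually_gt_atTop 0] with n hn
  have : (n : ℝ) ≠ 0 := by exact_mod_cast hn.ne'
  field_simp

lemma tendsto_sub_two_div : Tendsto (fun n : ℕ => ((n - 2 : ℕ) : ℝ) / (n : ℝ)) atTop (𝓝 1) := by
  have h : Tendsto (fun n : ℕ => 1 - 2 / (n : ℝ)) atTop (𝓝 (1 - 0)) :=
    tendsto_const_nhds.sub (tendsto_const_div_atTop_nhds_zero_nat 2)
  rw [sub_zero] at h
  refine h.congr' ?_
  filter_upwards [eventually_ge_atTop 2] with n hn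
  have : (n : ℝ) ≠ 0 := by
    have : 0 < n := by omega
    exact_mod_cast this.ne'
  rw [Nat.cast_sub hn]
  field_simp
  norm_num

lemma TendstoProb.sqrt_sum_div {k : ℕ → ℕ} {c β : ℝ} {S : ∀ n, AuxSpace (m n) (k n) → ℝ}
    {N : ℕ → ℕ} (hN : Tendsto N atTop atTop)
    (hratio : Tendsto (fun n => (N n : ℝ) / (n : ℝ)) atTop (𝓝 β))
    (hS : TendstoProb (fun n => auxMeasure (m n) (k n)) (fun n z => S n z / N n) c) :
    TendstoProb (fun n => auxMeasure (m n) (k n)) (fun n z => √(S n z) / √n) √(c * β) := by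
  have h := hS.map₂ (TendstoProb.const hratio) (fun x => √(x.1 * x.2))
    (Continuous.continuousAt (by fun_prop))
  intro δ hδ
  refine tendsto_measure_zero_of_subset (h δ hδ) ?_
  filter_upwards [hN.eventually_gt_atTop 0] with n hn
  have hn' : (N n : ℝ) ≠ 0 := by exact_mod_cast hn.ne'
  intro z hz
  have e : S n z / N n * (N n / n) = S n z / n := by field_simp
  have hz' : δ ≤ |√(S n z) / √n - √(c * β)| := hz
  rw [← Real.sqrt_div' _ (Nat.cast_nonneg n)] at hz'
  change δ ≤ |√(S n z / N n * (N n / n)) - √(c * β)|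
  rwa [e]

lemma tendstoProb_overVec (hα : 0 < α)
    (hm : Tendsto (fun n => (m n : ℝ) / (n : ℝ)) atTop (𝓝 α)) (p : ℝ × ℝ × ℝ) :
    TendstoProb (fun n => auxMeasure (m n) (n - 2)) (fun n z => ‖overVec p z‖ / √n)
      √(rowSq p * α) := by
  have h1 := (tendstoProb_average gauss3 (memLp_rowOver_sq p)
    (tendsto_atTop_of_ratio hα hm)).comp_measurePreserving
    (fun n => measurePreserving_auxRow (m n) (n - 2)) fun n => by
      have := (continuous_rowOver p).measurable
      fun_prop
  simp only [norm_overVec]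
  exact h1.sqrt_sum_div (tendsto_atTop_of_ratio hα hm) hm

lemma memLp_sq_gaussian : MemLp (fun x : ℝ => x ^ 2) 2 (gaussianReal 0 1) := by
  have h2 := (memLp_id_gaussianReal (μ := 0) (v := 1) 4).integrable_norm_pow (p := 4) (by norm_num)
  refine (memLp_two_iff_integrable_sq (by fun_prop)).2 (h2.congr (ae_of_all _ fun z => ?_))
  change ‖z‖ ^ 4 = (z ^ 2) ^ 2
  rw [Real.norm_eq_abs, ← pow_mul, ← abs_pow, abs_of_nonneg (by positivity)]

lemma tendstoProb_tailVec (m : ℕ → ℕ) :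
    TendstoProb (fun n => auxMeasure (m n) (n - 2)) (fun n z => ‖tailVec z‖ / √n) 1 := by
  have hk : Tendsto (fun n : ℕ => n - 2) atTop atTop := tendsto_sub_atTop_nat 2
  have h1 := (tendstoProb_average (gaussianReal 0 1) memLp_sq_gaussian hk).comp_measurePreserving
    (fun n => measurePreserving_auxTail (m n) (n - 2)) fun n => by fun_prop
  have h2 := h1.sqrt_sum_div hk tendsto_sub_two_div
  rw [integral_sq_gaussian, one_mul, Real.sqrt_one] at h2
  simpa only [norm_tailVec] using h2

/-- The Lipschitz constant of `overVec` is of the order `√n`. -/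
lemma exists_tendstoProb_rowsNorm (hα : 0 < α)
    (hm : Tendsto (fun n => (m n : ℝ) / (n : ℝ)) atTop (𝓝 α)) :
    ∃ C : ℝ, 0 ≤ C ∧
      TendstoProb (fun n => auxMeasure (m n) (n - 2)) (fun n z => rowsNorm z / √n) C := by
  have hL : MemLp (fun z : ℝ × ℝ × ℝ => 3 * (z.1 ^ 2 + z.2.1 ^ 2 + z.2.2 ^ 2)) 2 gauss3 := by
    have e1 : MemLp (fun z : ℝ × ℝ × ℝ => z.1 ^ 2) 2 gauss3 :=
      memLp_sq_gaussian.comp_measurePreserving measurePreserving_fst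
    have e2 : MemLp (fun z : ℝ × ℝ × ℝ => z.2.1 ^ 2) 2 gauss3 :=
      memLp_sq_gaussian.comp_measurePreserving
        ((measurePreserving_fst (μ := gaussianReal 0 1) (ν := gaussianReal 0 1)).comp
          measurePreserving_snd)
    have e3 : MemLp (fun z : ℝ × ℝ × ℝ => z.2.2 ^ 2) 2 gauss3 :=
      memLp_sq_gaussian.comp_measurePreserving
        ((measurePreserving_snd (μ := gaussianReal 0 1) (ν := gaussianReal 0 1)).comp
          measurePreserving_snd)
    exact ((e1.add e2).add e3).const_mul 3
  have h1 := (tendstoProb_average gauss3 hL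
    (tendsto_atTop_of_ratio hα hm)).comp_measurePreserving
    (fun n => measurePreserving_auxRow (m n) (n - 2)) fun n => by fun_prop
  have h2 := h1.sqrt_sum_div (tendsto_atTop_of_ratio hα hm) hm
  simp only [rowsNorm, Finset.mul_sum]
  exact ⟨_, Real.sqrt_nonneg _, h2⟩

lemma tendsto_sqrt_natCast : Tendsto (fun n : ℕ => √(n : ℝ)) atTop atTop :=
  Real.tendsto_sqrt_atTop.comp tendsto_natCast_atTop_atTop

/-- Strict infeasibility in the limit carries over to the auxiliary problem, uniformly over a
compact set of points. -/
theorem tendsto_auxMeasure_exists_feasible (hα : 0 < α)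
    (hm : Tendsto (fun n => (m n : ℝ) / (n : ℝ)) atTop (𝓝 α)) {K : Set (ℝ × ℝ × ℝ)}
    (hK : IsCompact K) (hKF : ∀ p ∈ K, p.2.2 ^ 2 < α * rowSq p) :
    Tendsto (fun n => auxMeasure (m n) (n - 2)
      {z | ∃ p ∈ K, ‖overVec p z‖ ≤ p.2.2 * ‖tailVec z‖ + 1}) atTop (𝓝 0) := by
  rcases K.eq_empty_or_nonempty with rfl | hne
  · simp
  set gap : ℝ × ℝ × ℝ → ℝ := fun p => √(rowSq p * α) - p.2.2 with hgap
  have hgapc : Continuous gap :=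
    (Real.continuous_sqrt.comp (continuous_rowSq.mul continuous_const)).sub (by fun_prop)
  obtain ⟨δ, hδ, hδK⟩ : ∃ δ > 0, ∀ p ∈ K, 3 * δ ≤ gap p := by
    obtain ⟨p, hp, hmin⟩ := hK.exists_isMinOn hne hgapc.continuousOn
    have hpos : 0 < gap p := by
      rw [hgap, sub_pos]
      refine Real.lt_sqrt_of_sq_lt ?_
      rw [mul_comm]
      exact hKF p hp
    exact ⟨gap p / 3, by positivity, fun q hq => le_trans (by linarith) (hmin hq)⟩
  -- the constraint depends on `p` in a Lipschitz way, so that a finite net of `K` suffices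
  obtain ⟨C, hC0, hC⟩ := exists_tendstoProb_rowsNorm hα hm
  have hB := (hC.map₂ (tendstoProb_tailVec m) (fun x => x.1 + x.2)
    (Continuous.continuousAt (by fun_prop))).tendsto_ge (b := C + 2) (by simp)
  obtain ⟨t, htK, htfin, htcov⟩ := hK.finite_cover_balls (e := δ / (C + 2)) (by positivity)
  have hnet : ∀ p ∈ t, Tendsto (fun n => auxMeasure (m n) (n - 2)
      {z | ‖overVec p z‖ / √n - p.2.2 * (‖tailVec z‖ / √n) ≤ 2 * δ}) atTop (𝓝 0) := by
    intro p hp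
    refine ((tendstoProb_overVec hα hm p).map₂ (tendstoProb_tailVec m)
      (fun x => x.1 - p.2.2 * x.2) (Continuous.continuousAt (by fun_prop))).tendsto_le ?_
    have := hδK p (htK hp)
    simp only [hgap] at this
    simp only [mul_one]
    linarith
  refine tendsto_measure_zero_of_subset
    (tendsto_measure_union_zero hB (tendsto_measure_biUnion_zero htfin hnet)) ?_
  filter_upwards [tendsto_sqrt_natCast.eventually_ge_atTop (1 / δ),
    tendsto_sqrt_natCast.eventually_gt_atTop 0] with n hn hn0
  rintro z ⟨p, hp, hpz⟩
  by_contra hcon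
  simp only [Set.mem_union, Set.mem_iUnion, Set.mem_ofPred_eq, not_or, not_exists, not_le] at hcon
  obtain ⟨h1, h2⟩ := hcon
  obtain ⟨p', hp't, hp'⟩ := Set.mem_iUnion₂.1 (htcov hp)
  have h3 := h2 p' hp't
  rw [Metric.mem_ball, dist_eq_norm] at hp'
  have h1' : rowsNorm z + ‖tailVec z‖ < (C + 2) * √n := by
    rw [← add_div, div_lt_iff₀ hn0] at h1
    exact h1
  have h3' : 2 * δ * √n < ‖overVec p' z‖ - p'.2.2 * ‖tailVec z‖ := by
    rw [← mul_div_assoc, ← sub_div, lt_div_iff₀ hn0] at h3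
    exact h3
  have h4 : ‖overVec p' z‖ - ‖overVec p z‖ ≤ ‖p - p'‖ * rowsNorm z := by
    rw [norm_sub_rev p p']
    exact (norm_sub_norm_le _ _).trans (norm_overVec_sub_le p' p z)
  have h5 : (p.2.2 - p'.2.2) * ‖tailVec z‖ ≤ ‖p - p'‖ * ‖tailVec z‖ :=
    mul_le_mul_of_nonneg_right ((le_abs_self _).trans
      ((norm_snd_le (p - p').2).trans (norm_snd_le _))) (norm_nonneg _)
  have h6 : ‖p - p'‖ * (rowsNorm z + ‖tailVec z‖) ≤ δ * √n := by
    have hR : 0 ≤ rowsNorm z := Real.sqrt_nonneg _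
    refine (mul_le_mul hp'.le h1'.le (by positivity) (by positivity)).trans (le_of_eq ?_)
    field_simp
  have h7 : 1 ≤ δ * √n := by
    rw [div_le_iff₀ hδ] at hn; linarith
  linarith

/-- Strict feasibility in the limit carries over to the auxiliary problem. -/
theorem tendsto_auxMeasure_infeasible (hα : 0 < α)
    (hm : Tendsto (fun n => (m n : ℝ) / (n : ℝ)) atTop (𝓝 α)) {p : ℝ × ℝ × ℝ} {τ : ℝ}
    (hτ : 0 < τ) (hp : α * rowSq p < τ ^ 2) :
    Tendsto (fun n => auxMeasure (m n) (n - 2)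
      {z | τ * ‖tailVec z‖ ≤ ‖overVec p z‖ + 1}) atTop (𝓝 0) := by
  set δ := τ - √(rowSq p * α) with hδ
  have hδ0 : 0 < δ := by
    rw [hδ, sub_pos, Real.sqrt_lt' hτ, mul_comm]
    exact hp
  have h := ((tendstoProb_overVec hα hm p).map₂ (tendstoProb_tailVec m)
      (fun x => τ * x.2 - x.1) (Continuous.continuousAt (by fun_prop))).tendsto_le (b := δ / 2)
      (by simp only [mul_one]; linarith)
  refine tendsto_measure_zero_of_subset h ?_
  filter_upwards [tendsto_sqrt_natCast.eventually_ge_atTop (1 / (δ / 2)),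
    tendsto_sqrt_natCast.eventually_gt_atTop 0] with n hn hn0
  intro z hz
  have hz' : τ * ‖tailVec z‖ ≤ ‖overVec p z‖ + 1 := hz
  change τ * (‖tailVec z‖ / √n) - ‖overVec p z‖ / √n ≤ δ / 2
  rw [← mul_div_assoc, ← sub_div, div_le_iff₀ hn0]
  rw [div_le_iff₀ (by positivity)] at hn
  linarith

end Limits

/-! ### Gordon's inequality for the feasible set -/

/-- The space of the sensing matrix in coordinates adapted to the signal and the initial guess:
the two distinguished columns `q`, `g` and the remaining block `G`. -/
abbrev PrimSpace (m k : ℕ) : Type :=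
  ((Fin m → ℝ) × (Fin m → ℝ)) × (Fin m × Fin k → ℝ)

/-- The law of the sensing matrix in adapted coordinates. -/
noncomputable abbrev primMeasure (m k : ℕ) : Measure (PrimSpace m k) :=
  ((gaussPi (Fin m)).prod (gaussPi (Fin m))).prod (gaussPi (Fin m × Fin k))

section Primal

variable {m k : ℕ}

/-- The measurement vector `s q + t g + G w`. -/
noncomputable def primVec (θ : PrimSpace m k) (s t : ℝ) (w : EuclideanSpace ℝ (Fin k)) :
    EuclideanSpace ℝ (Fin m) :=
  WithLp.toLp 2 fun i => s * θ.1.1 i + t * θ.1.2 i + ∑ b, w b * θ.2 (i, b)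

/-- The constraints `|s q + t g + G w| ≤ |q|`. -/
def PrimFeasible (θ : PrimSpace m k) (s t : ℝ) (w : EuclideanSpace ℝ (Fin k)) : Prop :=
  ∀ i, |primVec θ s t w i| ≤ |θ.1.1 i|

lemma continuous_primVec : Continuous
    fun x : PrimSpace m k × ℝ × ℝ × EuclideanSpace ℝ (Fin k) =>
      primVec x.1 x.2.1 x.2.2.1 x.2.2.2 := by
  unfold primVec
  fun_prop

lemma isClosed_primFeasible : IsClosed
    {x : PrimSpace m k × ℝ × ℝ × EuclideanSpace ℝ (Fin k) |
      PrimFeasible x.1 x.2.1 x.2.2.1 x.2.2.2} := by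
  unfold PrimFeasible
  simp only [Set.ofPred_forall]
  refine isClosed_iInter fun i => isClosed_le ?_ (by fun_prop)
  have h := continuous_primVec (m := m) (k := k)
  have h2 : Continuous fun x : PrimSpace m k × ℝ × ℝ × EuclideanSpace ℝ (Fin k) =>
      primVec x.1 x.2.1 x.2.2.1 x.2.2.2 i := by fun_prop
  exact h2.abs

/-- The linear part of the Lagrangian: `lᵀ v - |l|ᵀ |q|`. -/
noncomputable def dualGap (q : Fin m → ℝ) (v l : EuclideanSpace ℝ (Fin m)) : ℝ :=
  ∑ i, (l i * v i - |l i| * |q i|)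

lemma continuous_dualGap (q : Fin m → ℝ) (v : EuclideanSpace ℝ (Fin m)) :
    Continuous (dualGap q v) := by
  unfold dualGap; fun_prop

lemma dualGap_nonpos {q : Fin m → ℝ} {v : EuclideanSpace ℝ (Fin m)} (h : ∀ i, |v i| ≤ |q i|)
    (l : EuclideanSpace ℝ (Fin m)) : dualGap q v l ≤ 0 := by
  refine Finset.sum_nonpos fun i _ => ?_
  have h1 : l i * v i ≤ |l i| * |v i| := by rw [← abs_mul]; exact le_abs_self _
  have h2 := mul_le_mul_of_nonneg_left (h i) (abs_nonneg (l i))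
  linarith

lemma dualGap_add (q : Fin m → ℝ) (v v' l : EuclideanSpace ℝ (Fin m)) :
    dualGap q (v + v') l = dualGap q v l + ⟪l, v'⟫ := by
  rw [inner_eq_sum, dualGap, dualGap, ← Finset.sum_add_distrib]
  refine Finset.sum_congr rfl fun i _ => ?_
  rw [PiLp.add_apply]; ring

/-- The vector of the amounts by which `|v|` exceeds `|q|`. -/
noncomputable def excess (q : Fin m → ℝ) (v : EuclideanSpace ℝ (Fin m)) :
    EuclideanSpace ℝ (Fin m) :=
  WithLp.toLp 2 fun i => overshoot (q i) (v i)

lemma dualGap_le (q : Fin m → ℝ) (v l : EuclideanSpace ℝ (Fin m)) :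
    dualGap q v l ≤ ‖l‖ * ‖excess q v‖ := by
  have h1 : dualGap q v l ≤ ∑ i, |l i| * |excess q v i| := by
    refine Finset.sum_le_sum fun i _ => ?_
    have h1 : l i * v i ≤ |l i| * |v i| := by rw [← abs_mul]; exact le_abs_self _
    have h2 : |v i| - |q i| ≤ |excess q v i| := (le_max_left _ _).trans (le_abs_self _)
    have h3 := mul_le_mul_of_nonneg_left h2 (abs_nonneg (l i))
    linarith
  have h2 := Real.sum_mul_le_sqrt_mul_sqrt Finset.univ (fun i => |l i|) fun i => |excess q v i|
  simp only [sq_abs] at h2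
  refine h1.trans (h2.trans (le_of_eq ?_))
  simp [EuclideanSpace.norm_eq]

/-- The bound `dualGap_le` is attained, at the normalized signed excess. -/
lemma exists_dualGap_eq (q : Fin m → ℝ) (v : EuclideanSpace ℝ (Fin m)) :
    ∃ l : EuclideanSpace ℝ (Fin m), ‖l‖ ≤ 1 ∧ dualGap q v l = ‖excess q v‖ := by
  set o := excess q v with ho
  by_cases h0 : o = 0
  · exact ⟨0, by simp, by simp [h0, dualGap]⟩
  have hn : 0 < ‖o‖ := norm_pos_iff.2 h0
  have hoi : ∀ i, o i = overshoot (q i) (v i) := fun i => rfl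
  have hterm : ∀ i, o i * SignType.sign (v i) * v i - |o i * SignType.sign (v i)| * |q i| =
      o i ^ 2 := by
    intro i
    rw [mul_assoc, sign_mul_self, abs_mul,
      abs_of_nonneg (a := o i) (by rw [hoi]; exact overshoot_nonneg _ _)]
    by_cases hv : v i = 0
    · have : o i = 0 := by
        rw [hoi, hv, overshoot, abs_zero, zero_sub, max_eq_right (neg_nonpos.2 (abs_nonneg _))]
      simp [this]
    · have hs : |((SignType.sign (v i) : SignType) : ℝ)| = 1 := by
        rcases lt_or_gt_of_ne hv with h | h <;> simp [h]
      rw [hs, mul_one, ← mul_sub, sq]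
      rcases le_total (|v i| - |q i|) 0 with h | h
      · have : o i = 0 := by rw [hoi, overshoot, max_eq_right h]
        simp [this]
      · rw [hoi, overshoot, max_eq_left h]
  refine ⟨WithLp.toLp 2 fun i => ‖o‖⁻¹ * (o i * SignType.sign (v i)), ?_, ?_⟩
  · rw [EuclideanSpace.norm_eq, Real.sqrt_le_one]
    have h1 : ∑ i, ‖‖o‖⁻¹ * (o i * SignType.sign (v i))‖ ^ 2 ≤ ∑ i, (‖o‖ ^ 2)⁻¹ * o i ^ 2 := by
      refine Finset.sum_le_sum fun i _ => ?_
      rw [Real.norm_eq_abs, sq_abs, mul_pow, inv_pow, mul_pow]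
      refine mul_le_mul_of_nonneg_left ?_ (by positivity)
      refine mul_le_of_le_one_right (sq_nonneg _) ?_
      rcases SignType.sign (v i) with _ | _ | _ <;> simp
    refine h1.trans (le_of_eq ?_)
    rw [← Finset.mul_sum, ← EuclideanSpace.real_norm_sq_eq, inv_mul_cancel₀ (by positivity)]
  · have h1 : ∀ i, ‖o‖⁻¹ * (o i * SignType.sign (v i)) * v i -
        |‖o‖⁻¹ * (o i * SignType.sign (v i))| * |q i| = ‖o‖⁻¹ * o i ^ 2 := by
      intro i
      rw [abs_mul, abs_of_nonneg (inv_nonneg.2 hn.le), ← hterm i]; ring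
    simp only [dualGap, h1]
    rw [← Finset.mul_sum, ← EuclideanSpace.real_norm_sq_eq]
    field_simp

/-- The measurement vector `s q + t g + τ h` of the auxiliary problem. -/
noncomputable def auxVec (z : AuxSpace m k) (p : ℝ × ℝ × ℝ) : EuclideanSpace ℝ (Fin m) :=
  WithLp.toLp 2 fun i => p.1 * z.1.1 i + p.2.1 * z.1.2 i + p.2.2 * z.2.1 i

/-- The contribution `s q + t g` of the distinguished columns. -/
noncomputable def headVec (x : (Fin m → ℝ) × (Fin m → ℝ)) (s t : ℝ) : EuclideanSpace ℝ (Fin m) :=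
  WithLp.toLp 2 fun i => s * x.1 i + t * x.2 i

/-- The product `G w`. -/
noncomputable def blockVec (G : Fin m × Fin k → ℝ) (w : EuclideanSpace ℝ (Fin k)) :
    EuclideanSpace ℝ (Fin m) :=
  WithLp.toLp 2 fun i => ∑ b, w b * G (i, b)

lemma primVec_eq (θ : PrimSpace m k) (s t : ℝ) (w : EuclideanSpace ℝ (Fin k)) :
    primVec θ s t w = headVec θ.1 s t + blockVec θ.2 w := rfl

lemma inner_blockVec (G : Fin m × Fin k → ℝ) (l : EuclideanSpace ℝ (Fin m))
    (w : EuclideanSpace ℝ (Fin k)) : ⟪l, blockVec G w⟫ = bilin G l w := by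
  rw [inner_eq_sum, bilin, Fintype.sum_prod_type]
  refine Finset.sum_congr rfl fun i _ => ?_
  simp only [blockVec, Finset.mul_sum, mul_assoc]

lemma auxVec_eq (z : AuxSpace m k) (s t τ : ℝ) :
    auxVec z (s, t, τ) = headVec z.1 s t + τ • (WithLp.toLp 2 z.2.1 : EuclideanSpace ℝ (Fin m)) :=
  rfl

lemma auxForm_eq (z : AuxSpace m k) (l : EuclideanSpace ℝ (Fin m))
    (w : EuclideanSpace ℝ (Fin k)) : auxForm z.2.1 z.2.2 l w =
      ⟪l, ‖w‖ • (WithLp.toLp 2 z.2.1 : EuclideanSpace ℝ (Fin m))⟫ + ‖l‖ * ⟪w, tailVec z⟫ := by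
  rw [real_inner_smul_right, inner_eq_sum, inner_eq_sum]
  rfl

/-- Transfer of a conditional bound, given the columns `q` and `g`, to the joint laws. -/
lemma primMeasure_le_of_conditional {A : Set (PrimSpace m k)} {B : Set (AuxSpace m k)}
    (hA : MeasurableSet A) (hB : MeasurableSet B)
    (h : ∀ x, gaussPi (Fin m × Fin k) {G | (x, G) ∈ A} ≤
      2 * ((gaussPi (Fin m)).prod (gaussPi (Fin k))) {hk | (x, hk) ∈ B}) :
    primMeasure m k A ≤ 2 * auxMeasure m k B := by
  rw [Measure.prod_apply hA, Measure.prod_apply hB, ← lintegral_const_mul' _ _ (by simp)]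
  exact lintegral_mono h

lemma isCompact_index {K : Set (ℝ × ℝ × ℝ)} (hK : IsCompact K) :
    IsCompact {x : ℝ × ℝ × EuclideanSpace ℝ (Fin k) | (x.1, x.2.1, ‖x.2.2‖) ∈ K} := by
  have hcl : IsClosed {x : ℝ × ℝ × EuclideanSpace ℝ (Fin k) | (x.1, x.2.1, ‖x.2.2‖) ∈ K} :=
    hK.isClosed.preimage (by fun_prop)
  obtain ⟨R, hR⟩ := hK.isBounded.subset_closedBall 0
  refine (isCompact_closedBall (0 : ℝ × ℝ × EuclideanSpace ℝ (Fin k)) R).of_isClosed_subset hcl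
    fun x hx => ?_
  have h := hR hx
  rw [mem_closedBall_zero_iff] at h ⊢
  refine le_trans (le_of_eq ?_) h
  simp [Prod.norm_def]

lemma continuous_overVec : Continuous fun x : AuxSpace m k × ℝ × ℝ × ℝ => overVec x.2 x.1 := by
  unfold overVec rowOver overshoot rowVal auxRow
  fun_prop

lemma continuous_tailVec : Continuous (tailVec (m := m) (k := k)) := by
  unfold tailVec; fun_prop

/-- Gordon's inequality bounds the probability that some feasible point has parameters in `K`:
feasibility of `x` means that `dualGap` at `x` is nonpositive for all `l`, so that the event is of
the form `∃ x ∀ l`, with the bilinear form `lᵀ G w`. Dense sequences of `x` and `l` replace the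
compact sets at the price of the constant `1`. -/
theorem primMeasure_exists_feasible_le {K : Set (ℝ × ℝ × ℝ)} (hK : IsCompact K) :
    primMeasure m k {θ | ∃ x : ℝ × ℝ × EuclideanSpace ℝ (Fin k),
        (x.1, x.2.1, ‖x.2.2‖) ∈ K ∧ PrimFeasible θ x.1 x.2.1 x.2.2} ≤
      2 * auxMeasure m k {z | ∃ p ∈ K, ‖overVec p z‖ ≤ p.2.2 * ‖tailVec z‖ + 1} := by
  set T : Set (ℝ × ℝ × EuclideanSpace ℝ (Fin k)) := {x | (x.1, x.2.1, ‖x.2.2‖) ∈ K} with hT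
  have hA : MeasurableSet {θ : PrimSpace m k | ∃ x : ℝ × ℝ × EuclideanSpace ℝ (Fin k),
      (x.1, x.2.1, ‖x.2.2‖) ∈ K ∧ PrimFeasible θ x.1 x.2.1 x.2.2} :=
    (isClosed_exists_of_isCompact (isCompact_index hK) isClosed_primFeasible).measurableSet
  have hB : MeasurableSet {z : AuxSpace m k |
      ∃ p ∈ K, ‖overVec p z‖ ≤ p.2.2 * ‖tailVec z‖ + 1} := by
    refine (isClosed_exists_of_isCompact hK (S := {x : AuxSpace m k × ℝ × ℝ × ℝ |
      ‖overVec x.2 x.1‖ ≤ x.2.2.2 * ‖tailVec x.1‖ + 1}) ?_).measurableSet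
    have h1 := continuous_overVec (m := m) (k := k)
    have h2 := continuous_tailVec (m := m) (k := k)
    exact isClosed_le (by fun_prop) (by fun_prop)
  refine primMeasure_le_of_conditional hA hB fun x => ?_
  rcases T.eq_empty_or_nonempty with hTe | hTne
  · have : {G : Fin m × Fin k → ℝ | (x, G) ∈ {θ : PrimSpace m k |
        ∃ x : ℝ × ℝ × EuclideanSpace ℝ (Fin k),
        (x.1, x.2.1, ‖x.2.2‖) ∈ K ∧ PrimFeasible θ x.1 x.2.1 x.2.2}} = ∅ := by
      refine Set.eq_empty_of_forall_notMem fun G ⟨y, hy, _⟩ => ?_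
      exact Set.eq_empty_iff_forall_notMem.1 hTe y hy
    rw [this, measure_empty]
    exact zero_le
  have : Nonempty T := hTne.to_subtype
  have : Nonempty (Metric.closedBall (0 : EuclideanSpace ℝ (Fin m)) 1) := ⟨⟨0, by simp⟩⟩
  set u : ℕ → T := TopologicalSpace.denseSeq T
  have hu : DenseRange u := TopologicalSpace.denseRange_denseSeq T
  set l : ℕ → Metric.closedBall (0 : EuclideanSpace ℝ (Fin m)) 1 :=
    TopologicalSpace.denseSeq _
  have hl : DenseRange l := TopologicalSpace.denseRange_denseSeq _
  have hlnorm : ∀ j, ‖(l j : EuclideanSpace ℝ (Fin m))‖ ≤ 1 := fun j =>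
    mem_closedBall_zero_iff.1 (l j).2
  set c : ℕ → ℕ → ℝ := fun i j =>
    1 / 2 - dualGap x.1 (headVec x (u i : ℝ × ℝ × EuclideanSpace ℝ (Fin k)).1 (u i).1.2.1) (l j)
  have key := gordon_bilinear (fun _ j => (l j : EuclideanSpace ℝ (Fin m)))
    (fun i _ => (u i : ℝ × ℝ × EuclideanSpace ℝ (Fin k)).2.2) (fun i j l => Or.inr rfl) c
    (by norm_num : (0 : ℝ) < 1 / 2)
  refine (measure_mono ?_).trans (key.trans ?_)
  · rintro G ⟨y, hy, hfeas⟩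
    -- approximate the feasible point by the dense sequence, up to `1 / 2` in the measurements
    have hcont : Continuous fun y' : T =>
        ‖primVec (x, G) (y' : ℝ × ℝ × EuclideanSpace ℝ (Fin k)).1 y'.1.2.1 y'.1.2.2 -
          primVec (x, G) y.1 y.2.1 y.2.2‖ := by
      have h := continuous_primVec (m := m) (k := k)
      refine (Continuous.sub ?_ continuous_const).norm
      exact h.comp (by fun_prop :
        Continuous fun y' : T => ((x, G), (y' : ℝ × ℝ × EuclideanSpace ℝ (Fin k))))
    obtain ⟨i, hi⟩ := hu.exists_mem_open (isOpen_lt hcont continuous_const)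
      ⟨⟨y, hy⟩, (by simp : ‖_ - _‖ < (1 / 2 : ℝ))⟩
    refine ⟨i, fun j => ?_⟩
    have h1 := dualGap_nonpos (q := x.1) hfeas (l j)
    have h2 : dualGap x.1 (primVec (x, G) (u i).1.1 (u i).1.2.1 (u i).1.2.2) (l j) =
        dualGap x.1 (primVec (x, G) y.1 y.2.1 y.2.2) (l j) +
        ⟪(l j : EuclideanSpace ℝ (Fin m)), primVec (x, G) (u i).1.1 (u i).1.2.1 (u i).1.2.2 -
          primVec (x, G) y.1 y.2.1 y.2.2⟫ := by
      rw [← dualGap_add, add_sub_cancel]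
    have h3 := real_inner_le_norm (l j : EuclideanSpace ℝ (Fin m))
      (primVec (x, G) (u i).1.1 (u i).1.2.1 (u i).1.2.2 - primVec (x, G) y.1 y.2.1 y.2.2)
    have h4 := mul_le_mul_of_nonneg_right (hlnorm j) (norm_nonneg
      (primVec (x, G) (u i).1.1 (u i).1.2.1 (u i).1.2.2 - primVec (x, G) y.1 y.2.1 y.2.2))
    rw [one_mul] at h4
    have h5 : ‖primVec (x, G) (u i).1.1 (u i).1.2.1 (u i).1.2.2 -
      primVec (x, G) y.1 y.2.1 y.2.2‖ < 1 / 2 := hi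
    have h6 : dualGap x.1 (primVec (x, G) (u i).1.1 (u i).1.2.1 (u i).1.2.2) (l j) =
        dualGap x.1 (headVec x (u i).1.1 (u i).1.2.1) (l j) + bilin G (l j) (u i).1.2.2 := by
      rw [primVec_eq, dualGap_add, inner_blockVec]
    change bilin G (l j) (u i).1.2.2 < 1 / 2 - dualGap x.1 (headVec x (u i).1.1 (u i).1.2.1) (l j)
    linarith
  · refine mul_le_mul_right (measure_mono ?_) _
    rintro hk ⟨i, hi⟩
    set z : AuxSpace m k := (x, hk)
    set y := (u i : ℝ × ℝ × EuclideanSpace ℝ (Fin k)) with hy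
    refine ⟨(y.1, y.2.1, ‖y.2.2‖), (u i).2, ?_⟩
    obtain ⟨l₀, hl₀, hgap⟩ := exists_dualGap_eq x.1 (auxVec z (y.1, y.2.1, ‖y.2.2‖))
    -- pass from the dense sequence to the whole ball
    have hall : ∀ l' : Metric.closedBall (0 : EuclideanSpace ℝ (Fin m)) 1,
        dualGap x.1 (auxVec z (y.1, y.2.1, ‖y.2.2‖)) l' +
          ‖(l' : EuclideanSpace ℝ (Fin m))‖ * ⟪y.2.2, tailVec z⟫ ≤ 1 := by
      have hcl : IsClosed {l' : Metric.closedBall (0 : EuclideanSpace ℝ (Fin m)) 1 |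
          dualGap x.1 (auxVec z (y.1, y.2.1, ‖y.2.2‖)) l' +
          ‖(l' : EuclideanSpace ℝ (Fin m))‖ * ⟪y.2.2, tailVec z⟫ ≤ 1} := by
        refine isClosed_le ?_ continuous_const
        exact ((continuous_dualGap _ _).comp continuous_subtype_val).add
          (continuous_subtype_val.norm.mul continuous_const)
      intro l'
      refine hl.induction_on l' hcl fun j => ?_
      have h1 := hi j
      have h2 := auxForm_eq z (l j : EuclideanSpace ℝ (Fin m)) y.2.2
      rw [auxVec_eq, dualGap_add]
      change auxForm z.2.1 z.2.2 (l j) y.2.2 <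
        1 / 2 - dualGap x.1 (headVec x y.1 y.2.1) (l j) + 1 / 2 at h1
      linarith
    have h1 := hall ⟨l₀, mem_closedBall_zero_iff.2 hl₀⟩
    simp only [hgap] at h1
    have h2 := abs_real_inner_le_norm y.2.2 (tailVec z)
    have h3 : -(‖y.2.2‖ * ‖tailVec z‖) ≤ ‖l₀‖ * ⟪y.2.2, tailVec z⟫ := by
      have h4 := neg_le_of_abs_le h2
      have h5 : 0 ≤ ‖y.2.2‖ * ‖tailVec z‖ := by positivity
      nlinarith [norm_nonneg l₀]
    change ‖overVec (y.1, y.2.1, ‖y.2.2‖) z‖ + ‖l₀‖ * ⟪y.2.2, tailVec z⟫ ≤ 1 at h1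
    change ‖overVec (y.1, y.2.1, ‖y.2.2‖) z‖ ≤ ‖y.2.2‖ * ‖tailVec z‖ + 1
    linarith

/-- The product `Gᵀ l`. -/
noncomputable def blockVecT (G : Fin m × Fin k → ℝ) (l : EuclideanSpace ℝ (Fin m)) :
    EuclideanSpace ℝ (Fin k) :=
  WithLp.toLp 2 fun b => ∑ i, l i * G (i, b)

lemma inner_blockVecT (G : Fin m × Fin k → ℝ) (l : EuclideanSpace ℝ (Fin m))
    (w : EuclideanSpace ℝ (Fin k)) : ⟪w, blockVecT G l⟫ = bilin G l w := by
  rw [inner_eq_sum, bilin, Fintype.sum_prod_type_right]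
  refine Finset.sum_congr rfl fun b _ => ?_
  simp only [blockVecT, Finset.mul_sum]
  exact Finset.sum_congr rfl fun i _ => by ring

/-- If no `w` with `‖w‖ ≤ τ` is feasible, a unit vector separates the image of the ball from the
box of the constraints. -/
lemma exists_separating (θ : PrimSpace m k) (s t : ℝ) {τ : ℝ} (hτ : 0 ≤ τ)
    (h : ¬ ∃ w : EuclideanSpace ℝ (Fin k), ‖w‖ ≤ τ ∧ PrimFeasible θ s t w) :
    ∃ l : EuclideanSpace ℝ (Fin m), ‖l‖ = 1 ∧
      τ * ‖blockVecT θ.2 l‖ < dualGap θ.1.1 (headVec θ.1 s t) l := by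
  let box : Set (EuclideanSpace ℝ (Fin m)) := {v | ∀ i, |v i| ≤ |θ.1.1 i|}
  let img : Set (EuclideanSpace ℝ (Fin m)) := (fun w => primVec θ s t w) '' Metric.closedBall 0 τ
  have hbox_closed : IsClosed box := by
    simp only [box, Set.ofPred_forall]
    exact isClosed_iInter fun i => isClosed_le (by fun_prop) continuous_const
  have hbox_convex : Convex ℝ box := by
    intro v hv w hw a b ha hb hab i
    have h1 : (a • v + b • w) i = a * v i + b * w i := rfl
    rw [h1]
    refine (abs_add_le _ _).trans ?_
    rw [abs_mul, abs_mul, abs_of_nonneg ha, abs_of_nonneg hb]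
    have h2 := mul_le_mul_of_nonneg_left (hv i) ha
    have h3 := mul_le_mul_of_nonneg_left (hw i) hb
    have h4 : |θ.1.1 i| = a * |θ.1.1 i| + b * |θ.1.1 i| := by rw [← add_mul, hab, one_mul]
    linarith
  have himg_compact : IsCompact img := by
    refine (isCompact_closedBall _ _).image ?_
    unfold primVec
    fun_prop
  have himg_convex : Convex ℝ img := by
    rintro _ ⟨w, hw, rfl⟩ _ ⟨w', hw', rfl⟩ a b ha hb hab
    refine ⟨a • w + b • w', convex_closedBall _ _ hw hw' ha hb hab, ?_⟩
    ext i
    change s * θ.1.1 i + t * θ.1.2 i + ∑ j, (a * w j + b * w' j) * θ.2 (i, j) =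
      a * (s * θ.1.1 i + t * θ.1.2 i + ∑ j, w j * θ.2 (i, j)) +
        b * (s * θ.1.1 i + t * θ.1.2 i + ∑ j, w' j * θ.2 (i, j))
    have h1 : ∑ j, (a * w j + b * w' j) * θ.2 (i, j) =
        a * ∑ j, w j * θ.2 (i, j) + b * ∑ j, w' j * θ.2 (i, j) := by
      rw [Finset.mul_sum, Finset.mul_sum, ← Finset.sum_add_distrib]
      exact Finset.sum_congr rfl fun j _ => by ring
    rw [h1]
    linear_combination -(s * θ.1.1 i + t * θ.1.2 i) * hab
  have hdisj : Disjoint img box := by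
    rw [Set.disjoint_left]
    rintro _ ⟨w, hw, rfl⟩ hv
    exact h ⟨w, mem_closedBall_zero_iff.1 hw, hv⟩
  obtain ⟨f, u, v, hfu, huv, hfv⟩ := geometric_hahn_banach_compact_closed himg_convex himg_compact
    hbox_convex hbox_closed hdisj
  set l' : EuclideanSpace ℝ (Fin m) := -(InnerProductSpace.toDual ℝ (EuclideanSpace ℝ (Fin m))).symm f with hl'
  have hf : ∀ x, f x = -⟪l', x⟫ := by
    intro x
    rw [hl', inner_neg_left, neg_neg, InnerProductSpace.toDual_symm_apply]
  -- the largest value of the linear form on the box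
  have hmax : v < -∑ i, |l' i| * |θ.1.1 i| := by
    have hb : (WithLp.toLp 2 fun i => SignType.sign (l' i) * |θ.1.1 i| :
        EuclideanSpace ℝ (Fin m)) ∈ box := by
      intro i
      change |SignType.sign (l' i) * (|θ.1.1 i|)| ≤ |θ.1.1 i|
      rw [abs_mul, abs_abs]
      refine mul_le_of_le_one_left (abs_nonneg _) ?_
      rcases SignType.sign (l' i) with _ | _ | _ <;> simp
    have h1 := hfv _ hb
    rw [hf, inner_eq_sum] at h1
    refine h1.trans_le (le_of_eq ?_)
    congr 1
    refine Finset.sum_congr rfl fun i _ => ?_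
    change l' i * (SignType.sign (l' i) * |θ.1.1 i|) = _
    rw [← mul_assoc, self_mul_sign]
  have hpos : ∀ w : EuclideanSpace ℝ (Fin k), ‖w‖ ≤ τ →
      0 < dualGap θ.1.1 (headVec θ.1 s t) l' + bilin θ.2 l' w := by
    intro w hw
    have h1 := hfu _ ⟨w, mem_closedBall_zero_iff.2 hw, rfl⟩
    rw [hf] at h1
    rw [← inner_blockVec, ← dualGap_add, ← primVec_eq]
    rw [dualGap, Finset.sum_sub_distrib, ← inner_eq_sum]
    linarith
  have hl0 : l' ≠ 0 := by
    intro h0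
    have h1 := hpos 0 (by simpa using hτ)
    simp [h0, dualGap, bilin] at h1
  have hn : 0 < ‖l'‖ := norm_pos_iff.2 hl0
  have hmain : τ * ‖blockVecT θ.2 l'‖ < dualGap θ.1.1 (headVec θ.1 s t) l' := by
    set b := blockVecT θ.2 l' with hb
    by_cases hb0 : b = 0
    · have h1 := hpos 0 (by simpa using hτ)
      rw [← inner_blockVecT, inner_zero_left] at h1
      rw [hb0, norm_zero]
      linarith
    have hbn : 0 < ‖b‖ := norm_pos_iff.2 hb0
    have h1 := hpos (-(τ / ‖b‖) • b) (by
      rw [norm_smul, norm_neg, Real.norm_of_nonneg (by positivity), div_mul_cancel₀ _ hbn.ne'])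
    rw [← inner_blockVecT, ← hb, real_inner_smul_left, real_inner_self_eq_norm_sq] at h1
    have h2 : -(τ / ‖b‖) * ‖b‖ ^ 2 = -(τ * ‖b‖) := by field_simp
    linarith
  refine ⟨‖l'‖⁻¹ • l', by rw [norm_smul, norm_inv, norm_norm, inv_mul_cancel₀ hn.ne'], ?_⟩
  have h1 : blockVecT θ.2 (‖l'‖⁻¹ • l') = ‖l'‖⁻¹ • blockVecT θ.2 l' := by
    ext b
    change ∑ i, ‖l'‖⁻¹ * l' i * θ.2 (i, b) = ‖l'‖⁻¹ * ∑ i, l' i * θ.2 (i, b)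
    rw [Finset.mul_sum]
    exact Finset.sum_congr rfl fun i _ => by ring
  have h2 : dualGap θ.1.1 (headVec θ.1 s t) (‖l'‖⁻¹ • l') =
      ‖l'‖⁻¹ * dualGap θ.1.1 (headVec θ.1 s t) l' := by
    rw [dualGap, dualGap, Finset.mul_sum]
    refine Finset.sum_congr rfl fun i _ => ?_
    change ‖l'‖⁻¹ * l' i * _ - |‖l'‖⁻¹ * l' i| * _ = _
    rw [abs_mul, abs_of_pos (inv_pos.2 hn)]
    ring
  rw [h1, h2, norm_smul, norm_inv, norm_norm, mul_left_comm]
  exact mul_lt_mul_of_pos_left hmain (inv_pos.2 hn)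

/-- Gordon's inequality bounds the probability that no point with the head `(s, t)` and a tail of
norm at most `τ` is feasible: by `exists_separating` the event is of the form `∃ l ∀ w`, with the
bilinear form `lᵀ G w`. The roles of the two vectors are exchanged, which changes the sign of `τ`
on the auxiliary side. -/
theorem primMeasure_infeasible_le (s t : ℝ) {τ : ℝ} (hτ : 0 < τ) :
    primMeasure m k {θ | ¬ ∃ w : EuclideanSpace ℝ (Fin k), ‖w‖ ≤ τ ∧ PrimFeasible θ s t w} ≤
      2 * auxMeasure m k {z | τ * ‖tailVec z‖ ≤ ‖overVec (s, t, -τ) z‖ + 1} := by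
  have hA : MeasurableSet {θ : PrimSpace m k |
      ¬ ∃ w : EuclideanSpace ℝ (Fin k), ‖w‖ ≤ τ ∧ PrimFeasible θ s t w} := by
    have h1 : IsClosed {x : PrimSpace m k × EuclideanSpace ℝ (Fin k) |
        PrimFeasible x.1 s t x.2} :=
      isClosed_primFeasible.preimage (by fun_prop :
        Continuous fun x : PrimSpace m k × EuclideanSpace ℝ (Fin k) => (x.1, s, t, x.2))
    have h2 := isClosed_exists_of_isCompact
      (isCompact_closedBall (0 : EuclideanSpace ℝ (Fin k)) τ) h1
    simp only [mem_closedBall_zero_iff] at h2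
    exact h2.measurableSet.compl
  have hB : MeasurableSet {z : AuxSpace m k | τ * ‖tailVec z‖ ≤ ‖overVec (s, t, -τ) z‖ + 1} := by
    have h1 : Continuous fun z : AuxSpace m k => overVec (s, t, -τ) z :=
      continuous_overVec.comp (by fun_prop : Continuous fun z : AuxSpace m k => (z, s, t, -τ))
    have h2 := continuous_tailVec (m := m) (k := k)
    exact (isClosed_le (by fun_prop) (by fun_prop)).measurableSet
  refine primMeasure_le_of_conditional hA hB fun x => ?_
  rcases isEmpty_or_nonempty (Metric.sphere (0 : EuclideanSpace ℝ (Fin m)) 1) with hemp | hne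
  · have : {G : Fin m × Fin k → ℝ | (x, G) ∈ {θ : PrimSpace m k |
        ¬ ∃ w : EuclideanSpace ℝ (Fin k), ‖w‖ ≤ τ ∧ PrimFeasible θ s t w}} = ∅ := by
      refine Set.eq_empty_of_forall_notMem fun G hG => ?_
      obtain ⟨l, hl, _⟩ := exists_separating (x, G) s t hτ.le hG
      exact hemp.false ⟨l, mem_sphere_zero_iff_norm.2 hl⟩
    rw [this, measure_empty]
    exact zero_le
  have : Nonempty (Metric.closedBall (0 : EuclideanSpace ℝ (Fin k)) τ) := ⟨⟨0, by simpa using hτ.le⟩⟩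
  set l : ℕ → Metric.sphere (0 : EuclideanSpace ℝ (Fin m)) 1 := TopologicalSpace.denseSeq _
  have hl : DenseRange l := TopologicalSpace.denseRange_denseSeq _
  set w : ℕ → Metric.closedBall (0 : EuclideanSpace ℝ (Fin k)) τ := TopologicalSpace.denseSeq _
  have hw : DenseRange w := TopologicalSpace.denseRange_denseSeq _
  have key := gordon_bilinear (fun i _ => (l i : EuclideanSpace ℝ (Fin m)))
    (fun _ j => (w j : EuclideanSpace ℝ (Fin k))) (fun i j l => Or.inl rfl)
    (fun i _ => dualGap x.1 (headVec x s t) (l i)) one_pos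
  refine (measure_mono ?_).trans (key.trans ?_)
  · intro G hG
    obtain ⟨l₀, hl₀, hgap⟩ := exists_separating (x, G) s t hτ.le hG
    have hcont : Continuous fun l' : Metric.sphere (0 : EuclideanSpace ℝ (Fin m)) 1 =>
        dualGap x.1 (headVec x s t) l' - τ * ‖blockVecT G l'‖ := by
      have h1 := continuous_dualGap x.1 (headVec x s t)
      have h2 : Continuous (blockVecT G) := by unfold blockVecT; fun_prop
      fun_prop
    obtain ⟨i, hi⟩ := hl.exists_mem_open (isOpen_lt continuous_const hcont)
      ⟨⟨l₀, mem_sphere_zero_iff_norm.2 hl₀⟩, sub_pos.2 hgap⟩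
    refine ⟨i, fun j => ?_⟩
    have h1 : 0 < dualGap x.1 (headVec x s t) (l i) - τ * ‖blockVecT G (l i)‖ := hi
    have h2 := real_inner_le_norm (w j : EuclideanSpace ℝ (Fin k)) (blockVecT G (l i))
    have h3 := mul_le_mul_of_nonneg_right (mem_closedBall_zero_iff.1 (w j).2)
      (norm_nonneg (blockVecT G (l i)))
    rw [inner_blockVecT] at h2
    linarith
  · refine mul_le_mul_right (measure_mono ?_) _
    rintro hk ⟨i, hi⟩
    let z : AuxSpace m k := (x, hk)
    change τ * ‖tailVec z‖ ≤ ‖overVec (s, t, -τ) z‖ + 1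
    by_cases hz : tailVec z = 0
    · rw [hz, norm_zero, mul_zero]
      positivity
    have hzn : 0 < ‖tailVec z‖ := norm_pos_iff.2 hz
    have hli : ‖(l i : EuclideanSpace ℝ (Fin m))‖ = 1 := mem_sphere_zero_iff_norm.1 (l i).2
    have hall : ∀ w' : Metric.closedBall (0 : EuclideanSpace ℝ (Fin k)) τ,
        ⟪(l i : EuclideanSpace ℝ (Fin m)),
          ‖(w' : EuclideanSpace ℝ (Fin k))‖ • (WithLp.toLp 2 z.2.1 : EuclideanSpace ℝ (Fin m))⟫ +
          ⟪(w' : EuclideanSpace ℝ (Fin k)), tailVec z⟫ ≤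
          dualGap x.1 (headVec x s t) (l i) + 1 := by
      intro w'
      refine hw.induction_on w' ?_ fun j => ?_
      · exact isClosed_le (by fun_prop) continuous_const
      · have h1 := auxForm_eq z (l i : EuclideanSpace ℝ (Fin m)) (w j)
        rw [hli, one_mul] at h1
        rw [← h1]
        exact (hi j).le
    have hnorm : ‖(τ / ‖tailVec z‖) • tailVec z‖ = τ := by
      rw [norm_smul, Real.norm_of_nonneg (by positivity), div_mul_cancel₀ _ hzn.ne']
    have h1 := hall ⟨(τ / ‖tailVec z‖) • tailVec z, mem_closedBall_zero_iff.2 hnorm.le⟩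
    simp only [hnorm] at h1
    rw [real_inner_smul_left, real_inner_self_eq_norm_sq] at h1
    have h2 : τ / ‖tailVec z‖ * ‖tailVec z‖ ^ 2 = τ * ‖tailVec z‖ := by field_simp
    have h3 := dualGap_le x.1 (auxVec z (s, t, -τ)) (l i)
    rw [auxVec_eq, dualGap_add, hli, one_mul, neg_smul, inner_neg_right, ← neg_smul,
      ← auxVec_eq] at h3
    change dualGap x.1 (headVec x s t) (l i) - _ ≤ ‖overVec (s, t, -τ) z‖ at h3
    linarith

end Primal

/-- With probability tending to one, no feasible point has its parameters in a compact set on which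
the auxiliary constraint fails. -/
theorem tendsto_primMeasure_exists_feasible {α : ℝ} (hα : 0 < α) {m : ℕ → ℕ}
    (hm : Tendsto (fun n => (m n : ℝ) / (n : ℝ)) atTop (𝓝 α)) {K : Set (ℝ × ℝ × ℝ)}
    (hK : IsCompact K) (hKF : ∀ p ∈ K, p.2.2 ^ 2 < α * rowSq p) :
    Tendsto (fun n => primMeasure (m n) (n - 2)
      {θ | ∃ x : ℝ × ℝ × EuclideanSpace ℝ (Fin (n - 2)),
        (x.1, x.2.1, ‖x.2.2‖) ∈ K ∧ PrimFeasible θ x.1 x.2.1 x.2.2}) atTop (𝓝 0) := by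
  have h := ENNReal.Tendsto.const_mul (tendsto_auxMeasure_exists_feasible hα hm hK hKF)
    (Or.inr (by simp : (2 : ENNReal) ≠ ⊤))
  rw [mul_zero] at h
  exact tendsto_of_tendsto_of_tendsto_of_le_of_le tendsto_const_nhds h (fun _ => zero_le)
    fun n => primMeasure_exists_feasible_le hK

/-- With probability tending to one, there are feasible points with the parameters of a strictly
feasible point of the auxiliary problem. -/
theorem tendsto_primMeasure_infeasible {α : ℝ} (hα : 0 < α) {m : ℕ → ℕ}
    (hm : Tendsto (fun n => (m n : ℝ) / (n : ℝ)) atTop (𝓝 α)) {s t τ : ℝ} (hτ : 0 < τ)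
    (h : α * rowSq (s, t, τ) < τ ^ 2) :
    Tendsto (fun n => primMeasure (m n) (n - 2)
      {θ | ¬ ∃ w : EuclideanSpace ℝ (Fin (n - 2)), ‖w‖ ≤ τ ∧ PrimFeasible θ s t w})
      atTop (𝓝 0) := by
  have h' : α * rowSq (s, t, -τ) < τ ^ 2 := by
    rw [rowSq_eq_meanSq, neg_sq, ← rowSq_eq_meanSq]; exact h
  have h := ENNReal.Tendsto.const_mul (tendsto_auxMeasure_infeasible hα hm hτ h')
    (Or.inr (by simp : (2 : ENNReal) ≠ ⊤))
  rw [mul_zero] at h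
  exact tendsto_of_tendsto_of_tendsto_of_le_of_le tendsto_const_nhds h (fun _ => zero_le)
    fun n => primMeasure_infeasible_le s t hτ

/-! ### Coordinates adapted to the signal and the initial guess -/

section Signal

variable {n : ℕ}

lemma head_eq_inner (hn : 0 < n) (x : EuclideanSpace ℝ (Fin n)) : head x = ⟪signal n, x⟫ := by
  rw [inner_eq_sum, Finset.sum_eq_single ⟨0, hn⟩]
  · simp [head, hn, signal]
  · intro i _ hi
    have : (i : ℕ) ≠ 0 := fun h => hi (Fin.ext h)
    simp [signal, this]
  · simp

lemma norm_signal (hn : 0 < n) : ‖signal n‖ = 1 := by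
  have h1 : ‖signal n‖ ^ 2 = 1 := by
    rw [← real_inner_self_eq_norm_sq, ← head_eq_inner hn]
    simp [head, hn, signal]
  exact (pow_eq_one_iff_of_nonneg (norm_nonneg _) two_ne_zero).1 h1

lemma tailNorm_eq (hn : 0 < n) (x : EuclideanSpace ℝ (Fin n)) :
    tailNorm x = √(‖x‖ ^ 2 - head x ^ 2) := by
  rw [tailNorm, EuclideanSpace.real_norm_sq_eq]
  congr 1
  rw [eq_sub_iff_add_eq]
  have h1 : head x ^ 2 = ∑ i : Fin n, if (i : ℕ) = 0 then x i ^ 2 else 0 := by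
    rw [Finset.sum_eq_single ⟨0, hn⟩]
    · simp [head, hn]
    · intro i _ hi
      have : (i : ℕ) ≠ 0 := fun h => hi (Fin.ext h)
      simp [this]
    · simp
  rw [h1, ← Finset.sum_add_distrib]
  refine Finset.sum_congr rfl fun i _ => ?_
  split_ifs <;> simp

lemma head_sq_le (hn : 0 < n) (x : EuclideanSpace ℝ (Fin n)) : head x ^ 2 ≤ ‖x‖ ^ 2 := by
  have h1 := abs_real_inner_le_norm (signal n) x
  rw [norm_signal hn, one_mul, ← head_eq_inner hn] at h1
  exact sq_le_sq' (neg_le_of_abs_le h1) (le_of_abs_le h1)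

lemma nmse_eq (hn : 0 < n) (x : EuclideanSpace ℝ (Fin n)) :
    nmse (signal n) x = 1 + head x ^ 2 + tailNorm x ^ 2 - 2 * |head x| := by
  rw [tailNorm_eq hn, Real.sq_sqrt (sub_nonneg.2 (head_sq_le hn x)), nmse, norm_signal hn,
    norm_add_sq_real, norm_sub_sq_real, norm_signal hn, ← head_eq_inner hn]
  rcases le_total 0 (head x) with h | h
  · rw [abs_of_nonneg h, min_eq_left (by linarith)]; ring
  · rw [abs_of_nonpos h, min_eq_right (by linarith)]; ring

lemma continuous_head (hn : 0 < n) : Continuous (head : EuclideanSpace ℝ (Fin n) → ℝ) := by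
  rw [funext (head_eq_inner hn)]; fun_prop

lemma continuous_tailNorm (hn : 0 < n) :
    Continuous (tailNorm : EuclideanSpace ℝ (Fin n) → ℝ) := by
  have h := continuous_head hn
  rw [funext (tailNorm_eq hn)]; fun_prop

end Signal

/-- The index type of a basis adapted to the signal and the initial guess. -/
abbrev BasisIndex (k : ℕ) : Type := (Unit ⊕ Unit) ⊕ Fin k

lemma exists_basis_of_orthonormal_pair {n : ℕ} (hn : 2 ≤ n) {e u : EuclideanSpace ℝ (Fin n)}
    (he : ‖e‖ = 1) (hu : ‖u‖ = 1) (heu : ⟪e, u⟫ = 0) :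
    ∃ b : OrthonormalBasis (BasisIndex (n - 2)) ℝ (EuclideanSpace ℝ (Fin n)),
      b (Sum.inl (Sum.inl ())) = e ∧ b (Sum.inl (Sum.inr ())) = u := by
  have hcard : Module.finrank ℝ (EuclideanSpace ℝ (Fin n)) =
      Fintype.card (BasisIndex (n - 2)) := by
    simp; omega
  let v : BasisIndex (n - 2) → EuclideanSpace ℝ (Fin n) :=
    Sum.elim (Sum.elim (fun _ => e) fun _ => u) fun _ => 0
  obtain ⟨b, hb⟩ := Orthonormal.exists_orthonormalBasis_extension_of_card_eq hcard (v := v)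
    (s := Set.range Sum.inl) ⟨by
      rintro ⟨_, i, rfl⟩
      rcases i with i | i
      · exact he
      · exact hu, by
      rintro ⟨_, i, rfl⟩ ⟨_, j, rfl⟩ hij
      rcases i with i | i <;> rcases j with j | j
      · exact absurd rfl hij
      · exact heu
      · exact (real_inner_comm _ _).trans heu
      · exact absurd rfl hij⟩
  exact ⟨b, hb _ ⟨_, rfl⟩, hb _ ⟨_, rfl⟩⟩

/-- An orthonormal basis that starts with the signal and the direction of the component of the
initial guess orthogonal to the signal. -/
lemma exists_adapted_basis {n : ℕ} (hn : 2 ≤ n) {ρ : ℝ} {v : EuclideanSpace ℝ (Fin n)}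
    (hv : ‖v‖ = 1) (hρ : ⟪signal n, v⟫ = ρ) :
    ∃ b : OrthonormalBasis (BasisIndex (n - 2)) ℝ (EuclideanSpace ℝ (Fin n)),
      b (Sum.inl (Sum.inl ())) = signal n ∧
        v = ρ • signal n + √(1 - ρ ^ 2) • b (Sum.inl (Sum.inr ())) := by
  have he := norm_signal (n := n) (by omega)
  have h1 : ‖v - ρ • signal n‖ ^ 2 = 1 - ρ ^ 2 := by
    rw [norm_sub_sq_real, hv, real_inner_smul_right, real_inner_comm, hρ, norm_smul, he,
      Real.norm_eq_abs, mul_one, sq_abs]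
    ring
  have h2 : ‖v - ρ • signal n‖ = √(1 - ρ ^ 2) := by
    rw [← h1, Real.sqrt_sq (norm_nonneg _)]
  by_cases h0 : v - ρ • signal n = 0
  · -- the guess is parallel to the signal: any second direction serves
    obtain ⟨b, hb0, -⟩ := exists_basis_of_orthonormal_pair hn he
      (u := EuclideanSpace.single ⟨1, by omega⟩ 1) (by simp) (by
        rw [inner_eq_sum, Finset.sum_eq_single ⟨1, by omega⟩]
        · simp [signal]
        · intro i _ hi
          simp [hi]
        · simp)
    refine ⟨b, hb0, ?_⟩
    rw [← h2, h0, norm_zero, zero_smul, add_zero]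
    exact sub_eq_zero.1 h0
  · have hpos : 0 < √(1 - ρ ^ 2) := h2 ▸ norm_pos_iff.2 h0
    obtain ⟨b, hb0, hb1⟩ := exists_basis_of_orthonormal_pair hn he
      (u := (√(1 - ρ ^ 2))⁻¹ • (v - ρ • signal n))
      (by rw [norm_smul, h2, norm_inv, Real.norm_of_nonneg hpos.le, inv_mul_cancel₀ hpos.ne'])
      (by
        rw [real_inner_smul_right, inner_sub_right, hρ, real_inner_smul_right,
          real_inner_self_eq_norm_sq, he]
        ring)
    refine ⟨b, hb0, ?_⟩
    rw [hb1, smul_smul, mul_inv_cancel₀ hpos.ne', one_smul, add_sub_cancel]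

lemma measurePreserving_gaussPi_reindex {ι κ : Type*} [Fintype ι] [Fintype κ] (e : ι ≃ κ) :
    MeasurePreserving (fun (x : κ → ℝ) a => x (e a)) (gaussPi κ) (gaussPi ι) := by
  have h := measurePreserving_piCongrLeft (fun _ : ι => gaussianReal 0 1) e.symm
  refine ⟨by fun_prop, ?_⟩
  rw [gaussPi, gaussPi, ← h.map_eq]
  congr 1
  ext x a
  simpa using (MeasurableEquiv.piCongrLeft_apply_apply e.symm (β := fun _ => ℝ) x (e a)).symm

/-- The bijection that sorts the entries of a matrix by the type of their columns. -/
def entryEquiv (m k : ℕ) :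
    (Fin m ⊕ Fin m) ⊕ (Fin m × Fin k) ≃ Fin m × BasisIndex k where
  toFun
    | Sum.inl (Sum.inl i) => (i, Sum.inl (Sum.inl ()))
    | Sum.inl (Sum.inr i) => (i, Sum.inl (Sum.inr ()))
    | Sum.inr (i, j) => (i, Sum.inr j)
  invFun
    | (i, Sum.inl (Sum.inl ())) => Sum.inl (Sum.inl i)
    | (i, Sum.inl (Sum.inr ())) => Sum.inl (Sum.inr i)
    | (i, Sum.inr j) => Sum.inr (i, j)
  left_inv := by rintro ((i | i) | ⟨i, j⟩) <;> rfl
  right_inv := by rintro ⟨i, (⟨⟩ | ⟨⟩) | j⟩ <;> rfl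

/-- The entries of a matrix, sorted by the type of their columns. -/
def sortEntries {m k : ℕ} (X : Fin m → BasisIndex k → ℝ) : PrimSpace m k :=
  ((fun i => X i (Sum.inl (Sum.inl ())), fun i => X i (Sum.inl (Sum.inr ()))),
    fun p => X p.1 (Sum.inr p.2))

lemma measurePreserving_sortEntries (m k : ℕ) :
    MeasurePreserving (sortEntries (m := m) (k := k))
      (Measure.pi fun _ : Fin m => gaussPi (BasisIndex k)) (primMeasure m k) := by
  have h1 : MeasurePreserving (MeasurableEquiv.curry (Fin m) (BasisIndex k) ℝ).symm
      (Measure.pi fun _ : Fin m => gaussPi (BasisIndex k)) (gaussPi (Fin m × BasisIndex k)) := by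
    refine ⟨MeasurableEquiv.measurable _, ?_⟩
    have h := Measure.infinitePi_map_curry_symm
      (fun (_ : Fin m) (_ : BasisIndex k) => gaussianReal 0 1)
    simp only [Measure.infinitePi_eq_pi] at h
    exact h
  have h2 := measurePreserving_gaussPi_reindex (entryEquiv m k)
  have h3 := measurePreserving_gaussPi_sum (Fin m ⊕ Fin m) (Fin m × Fin k)
  have h4 := (measurePreserving_gaussPi_sum (Fin m) (Fin m)).prod
    (MeasurePreserving.id (gaussPi (Fin m × Fin k)))
  exact h4.comp (h3.comp (h2.comp h1))

section Basis

variable {m n : ℕ} (b : OrthonormalBasis (BasisIndex (n - 2)) ℝ (EuclideanSpace ℝ (Fin n)))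

/-- The sensing vectors with the given coordinates. -/
noncomputable def sensing (X : Fin m → BasisIndex (n - 2) → ℝ) (i : Fin m) :
    EuclideanSpace ℝ (Fin n) :=
  ∑ j, X i j • b j

lemma measurePreserving_sensing :
    MeasurePreserving (sensing (m := m) b)
      (Measure.pi fun _ : Fin m => gaussPi (BasisIndex (n - 2)))
      (Measure.pi fun _ : Fin m => stdGaussian (EuclideanSpace ℝ (Fin n))) := by
  have h : MeasurePreserving (fun x : BasisIndex (n - 2) → ℝ => ∑ j, x j • b j)
      (gaussPi (BasisIndex (n - 2))) (stdGaussian (EuclideanSpace ℝ (Fin n))) :=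
    ⟨by fun_prop, (stdGaussian_eq_map_pi_orthonormalBasis b).symm⟩
  exact measurePreserving_pi (fun _ : Fin m => gaussPi (BasisIndex (n - 2)))
    (fun _ => stdGaussian (EuclideanSpace ℝ (Fin n))) fun _ => h

lemma inner_sensing (X : Fin m → BasisIndex (n - 2) → ℝ) (i : Fin m)
    (x : EuclideanSpace ℝ (Fin n)) : ⟪sensing b X i, x⟫ = ∑ j, X i j * ⟪b j, x⟫ := by
  rw [sensing, sum_inner]
  simp only [real_inner_smul_left]

/-- The coordinates of `x` along the basis vectors other than the two distinguished ones. -/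
noncomputable def tailCoord (x : EuclideanSpace ℝ (Fin n)) : EuclideanSpace ℝ (Fin (n - 2)) :=
  WithLp.toLp 2 fun j => ⟪b (Sum.inr j), x⟫

lemma primVec_sortEntries (X : Fin m → BasisIndex (n - 2) → ℝ) (x : EuclideanSpace ℝ (Fin n))
    (i : Fin m) : primVec (sortEntries X) ⟪b (Sum.inl (Sum.inl ())), x⟫
      ⟪b (Sum.inl (Sum.inr ())), x⟫ (tailCoord b x) i = ⟪sensing b X i, x⟫ := by
  rw [inner_sensing, Fintype.sum_sum_type, Fintype.sum_sum_type]
  simp [primVec, sortEntries, tailCoord, mul_comm]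

lemma norm_sq_eq_coord (x : EuclideanSpace ℝ (Fin n)) : ‖x‖ ^ 2 =
    ⟪b (Sum.inl (Sum.inl ())), x⟫ ^ 2 + ⟪b (Sum.inl (Sum.inr ())), x⟫ ^ 2 +
      ‖tailCoord b x‖ ^ 2 := by
  rw [← b.sum_sq_inner_right x, Fintype.sum_sum_type, Fintype.sum_sum_type,
    EuclideanSpace.real_norm_sq_eq]
  simp [tailCoord]

lemma exists_coord (s t : ℝ) (w : EuclideanSpace ℝ (Fin (n - 2))) :
    ∃ x : EuclideanSpace ℝ (Fin n), ⟪b (Sum.inl (Sum.inl ())), x⟫ = s ∧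
      ⟪b (Sum.inl (Sum.inr ())), x⟫ = t ∧ tailCoord b x = w := by
  let y : EuclideanSpace ℝ (BasisIndex (n - 2)) :=
    WithLp.toLp 2 (Sum.elim (Sum.elim (fun _ => s) fun _ => t) fun j => w j)
  have h : ∀ i, ⟪b i, b.repr.symm y⟫ = y i := fun i => by
    rw [← b.repr_apply_apply, LinearIsometryEquiv.apply_symm_apply]
  refine ⟨b.repr.symm y, h _, h _, ?_⟩
  ext j
  exact h _

variable {b}

lemma mem_feasible_sensing_iff (hb : b (Sum.inl (Sum.inl ())) = signal n)
    (X : Fin m → BasisIndex (n - 2) → ℝ) (x : EuclideanSpace ℝ (Fin n)) :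
    x ∈ feasible (sensing b X) (measurements (sensing b X) (signal n)) ↔
      PrimFeasible (sortEntries X) ⟪b (Sum.inl (Sum.inl ())), x⟫
        ⟪b (Sum.inl (Sum.inr ())), x⟫ (tailCoord b x) := by
  refine forall_congr' fun i => ?_
  have h1 : ⟪sensing b X i, signal n⟫ = (sortEntries X).1.1 i := by
    rw [← hb, inner_sensing]
    simp only [orthonormal_iff_ite.1 b.orthonormal]
    simp [sortEntries]
  rw [primVec_sortEntries, measurements, h1]

end Basis

/-! ### The two bad events of the linear program -/

/-- The pairs of an initial guess `v` and sensing vectors `A` with a feasible point that has norm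
`R`, or that has an almost optimal value but is away from the predicted limits. -/
def exceptional (m n : ℕ) (ρ α s₀ ε η R : ℝ) :
    Set (EuclideanSpace ℝ (Fin n) × (Fin m → EuclideanSpace ℝ (Fin n))) :=
  {z | ∃ x ∈ Metric.closedBall (0 : EuclideanSpace ℝ (Fin n)) R,
    x ∈ feasible z.2 (measurements z.2 (signal n)) ∧
      (‖x‖ = R ∨ (limitCost ρ α s₀ - η ≤ ⟪z.1, x⟫ ∧
        (ε ≤ |head x - s₀| ∨ ε ≤ |tailNorm x - rAlpha α s₀| ∨
          ε ≤ |⟪z.1, x⟫ - limitCost ρ α s₀|)))}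

/-- The pairs of an initial guess `v` and sensing vectors `A` without a feasible point of almost
optimal value in the ball of radius `R`. -/
def deficient (m n : ℕ) (ρ α s₀ η R : ℝ) :
    Set (EuclideanSpace ℝ (Fin n) × (Fin m → EuclideanSpace ℝ (Fin n))) :=
  {z | ¬ ∃ x ∈ Metric.closedBall (0 : EuclideanSpace ℝ (Fin n)) R,
    x ∈ feasible z.2 (measurements z.2 (signal n)) ∧ limitCost ρ α s₀ - η ≤ ⟪z.1, x⟫}

section Measurability

variable {m n : ℕ} {ρ α s₀ ε η R : ℝ}

lemma isClosed_feasible_graph : IsClosed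
    {p : (EuclideanSpace ℝ (Fin n) × (Fin m → EuclideanSpace ℝ (Fin n))) ×
      EuclideanSpace ℝ (Fin n) | p.2 ∈ feasible p.1.2 (measurements p.1.2 (signal n))} := by
  have h : ∀ p : (EuclideanSpace ℝ (Fin n) × (Fin m → EuclideanSpace ℝ (Fin n))) ×
      EuclideanSpace ℝ (Fin n), p.2 ∈ feasible p.1.2 (measurements p.1.2 (signal n)) ↔
        ∀ i, |⟪p.1.2 i, p.2⟫| ≤ |⟪p.1.2 i, signal n⟫| := fun _ => Iff.rfl
  simp only [h, Set.ofPred_forall]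
  exact isClosed_iInter fun i => isClosed_le (by fun_prop) (by fun_prop)

lemma measurableSet_exceptional (hn : 0 < n) :
    MeasurableSet (exceptional m n ρ α s₀ ε η R) := by
  have h1 := isClosed_feasible_graph (m := m) (n := n)
  have h2 := continuous_head hn
  have h3 := continuous_tailNorm hn
  refine (isClosed_exists_of_isCompact (isCompact_closedBall (0 : EuclideanSpace ℝ (Fin n)) R)
    (S := {p : (EuclideanSpace ℝ (Fin n) × (Fin m → EuclideanSpace ℝ (Fin n))) ×
      EuclideanSpace ℝ (Fin n) | p.2 ∈ feasible p.1.2 (measurements p.1.2 (signal n)) ∧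
      (‖p.2‖ = R ∨ (limitCost ρ α s₀ - η ≤ ⟪p.1.1, p.2⟫ ∧
        (ε ≤ |head p.2 - s₀| ∨ ε ≤ |tailNorm p.2 - rAlpha α s₀| ∨
          ε ≤ |⟪p.1.1, p.2⟫ - limitCost ρ α s₀|)))}) ?_).measurableSet
  rw [Set.ofPred_and]
  refine h1.inter ?_
  simp only [Set.ofPred_and, Set.ofPred_or]
  exact (isClosed_eq (by fun_prop) continuous_const).union
    ((isClosed_le continuous_const (by fun_prop)).inter
      ((isClosed_le continuous_const (by fun_prop)).union
        ((isClosed_le continuous_const (by fun_prop)).union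
          (isClosed_le continuous_const (by fun_prop)))))

lemma measurableSet_deficient : MeasurableSet (deficient m n ρ α s₀ η R) := by
  refine ((isClosed_exists_of_isCompact (isCompact_closedBall (0 : EuclideanSpace ℝ (Fin n)) R)
    (S := {p : (EuclideanSpace ℝ (Fin n) × (Fin m → EuclideanSpace ℝ (Fin n))) ×
      EuclideanSpace ℝ (Fin n) | p.2 ∈ feasible p.1.2 (measurements p.1.2 (signal n)) ∧
      limitCost ρ α s₀ - η ≤ ⟪p.1.1, p.2⟫}) ?_).measurableSet).compl
  rw [Set.ofPred_and]
  exact isClosed_feasible_graph.inter (isClosed_le continuous_const (by fun_prop))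

end Measurability

section Deterministic

variable {m n : ℕ} {ρ α s₀ ε η R : ℝ} {v : EuclideanSpace ℝ (Fin n)}
  {A : Fin m → EuclideanSpace ℝ (Fin n)}

lemma smul_mem_feasible {y : Fin m → ℝ} {x : EuclideanSpace ℝ (Fin n)} (hx : x ∈ feasible A y)
    {c : ℝ} (hc0 : 0 ≤ c) (hc1 : c ≤ 1) : c • x ∈ feasible A y := by
  intro i
  rw [real_inner_smul_right, abs_mul, abs_of_nonneg hc0]
  exact (mul_le_of_le_one_left (abs_nonneg _) hc1).trans (hx i)

/-- The feasible set is star-shaped around the origin, so that it lies in the ball of radius `R` if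
it does not meet the sphere of radius `R`. -/
lemma norm_lt_of_mem_feasible (hR : 0 < R) (h : (v, A) ∉ exceptional m n ρ α s₀ ε η R)
    {x : EuclideanSpace ℝ (Fin n)} (hx : x ∈ feasible A (measurements A (signal n))) :
    ‖x‖ < R := by
  by_contra! hge
  have hpos : 0 < ‖x‖ := hR.trans_le hge
  have hnorm : ‖(R / ‖x‖) • x‖ = R := by
    rw [norm_smul, Real.norm_of_nonneg (by positivity), div_mul_cancel₀ _ hpos.ne']
  exact h ⟨_, mem_closedBall_zero_iff.2 hnorm.le,
    smul_mem_feasible hx (by positivity) ((div_le_one hpos).2 hge), Or.inl hnorm⟩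

lemma solutions_nonempty (hR : 0 < R) (h : (v, A) ∉ exceptional m n ρ α s₀ ε η R) :
    (solutions A (measurements A (signal n)) v).Nonempty := by
  set F := feasible A (measurements A (signal n)) with hF
  have hcl : IsClosed F :=
    (isClosed_feasible_graph (m := m) (n := n)).preimage
      (by fun_prop : Continuous fun x : EuclideanSpace ℝ (Fin n) => ((v, A), x))
  have hcpt : IsCompact F :=
    (isCompact_closedBall (0 : EuclideanSpace ℝ (Fin n)) R).of_isClosed_subset hcl fun x hx =>
      mem_closedBall_zero_iff.2 (norm_lt_of_mem_feasible hR h hx).le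
  have hne : F.Nonempty := ⟨0, fun i => by simp [measurements]⟩
  obtain ⟨x, hx, hmax⟩ := hcpt.exists_isMaxOn hne
    (f := fun z => ⟪v, z⟫) (by fun_prop)
  exact ⟨x, hx, hmax⟩

lemma close_of_mem_solutions (hR : 0 < R) (h : (v, A) ∉ exceptional m n ρ α s₀ ε η R)
    (h' : (v, A) ∉ deficient m n ρ α s₀ η R) {x : EuclideanSpace ℝ (Fin n)}
    (hx : x ∈ solutions A (measurements A (signal n)) v) :
    |head x - s₀| < ε ∧ |tailNorm x - rAlpha α s₀| < ε ∧ |⟪v, x⟫ - limitCost ρ α s₀| < ε := by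
  obtain ⟨y, -, hyF, hy⟩ := not_not.1 h'
  have h1 : ⟪v, y⟫ ≤ ⟪v, x⟫ := hx.2 hyF
  by_contra hcon
  refine h ⟨x, mem_closedBall_zero_iff.2 (norm_lt_of_mem_feasible hR h hx.1).le, hx.1,
    Or.inr ⟨hy.trans h1, ?_⟩⟩
  by_contra! hcon'
  exact hcon hcon'

end Deterministic

section Fixed

variable {n : ℕ} {ρ α s₀ ε η R : ℝ} {v : EuclideanSpace ℝ (Fin n)}

lemma pi_exceptional_le (hn : 2 ≤ n) (m : ℕ) (hv : ‖v‖ = 1) (hvρ : ⟪signal n, v⟫ = ρ) :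
    (Measure.pi fun _ : Fin m => stdGaussian (EuclideanSpace ℝ (Fin n)))
      {A | (v, A) ∈ exceptional m n ρ α s₀ ε η R} ≤
    primMeasure m (n - 2) {θ | ∃ x : ℝ × ℝ × EuclideanSpace ℝ (Fin (n - 2)),
      (x.1, x.2.1, ‖x.2.2‖) ∈ badSet ρ α s₀ ε η R ∧ PrimFeasible θ x.1 x.2.1 x.2.2} := by
  obtain ⟨b, hb0, hb1⟩ := exists_adapted_basis hn hv hvρ
  have hmeas : MeasurableSet {A : Fin m → EuclideanSpace ℝ (Fin n) |
      (v, A) ∈ exceptional m n ρ α s₀ ε η R} :=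
    measurable_prodMk_left (measurableSet_exceptional (by omega))
  rw [← (measurePreserving_sensing b).measure_preimage hmeas.nullMeasurableSet,
    ← (measurePreserving_sortEntries m (n - 2)).map_eq]
  refine le_trans (measure_mono ?_) (Measure.le_map_apply
    (measurePreserving_sortEntries m (n - 2)).aemeasurable _)
  rintro X ⟨x, hxR, hxF, hx⟩
  refine ⟨(⟪b (Sum.inl (Sum.inl ())), x⟫, ⟪b (Sum.inl (Sum.inr ())), x⟫, tailCoord b x), ?_,
    (mem_feasible_sensing_iff hb0 X x).1 hxF⟩
  have hnorm := norm_sq_eq_coord b x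
  have hhead : head x = ⟪b (Sum.inl (Sum.inl ())), x⟫ := by
    rw [hb0, head_eq_inner (by omega)]
  have htail : tailNorm x = √(⟪b (Sum.inl (Sum.inr ())), x⟫ ^ 2 + ‖tailCoord b x‖ ^ 2) := by
    rw [tailNorm_eq (by omega), hhead, hnorm]
    congr 1
    ring
  have hval : ⟪v, x⟫ = ρ * ⟪b (Sum.inl (Sum.inl ())), x⟫ +
      √(1 - ρ ^ 2) * ⟪b (Sum.inl (Sum.inr ())), x⟫ := by
    conv_lhs => rw [hb1]
    rw [inner_add_left, real_inner_smul_left, real_inner_smul_left, hb0]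
  refine ⟨norm_nonneg _, ?_, ?_⟩
  · rw [← hnorm]
    exact pow_le_pow_left₀ (norm_nonneg _) (mem_closedBall_zero_iff.1 hxR) 2
  · simp only
    rw [← hnorm, ← hval, ← htail, ← hhead]
    exact hx.imp_left fun h => by rw [h]

lemma pi_deficient_le (hn : 2 ≤ n) (m : ℕ) (hR : 0 ≤ R) (hv : ‖v‖ = 1)
    (hvρ : ⟪signal n, v⟫ = ρ) {s t τ : ℝ} (hnorm : s ^ 2 + t ^ 2 + τ ^ 2 ≤ R ^ 2)
    (hval : limitCost ρ α s₀ - η ≤ ρ * s + √(1 - ρ ^ 2) * t) :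
    (Measure.pi fun _ : Fin m => stdGaussian (EuclideanSpace ℝ (Fin n)))
      {A | (v, A) ∈ deficient m n ρ α s₀ η R} ≤
    primMeasure m (n - 2) {θ | ¬ ∃ w : EuclideanSpace ℝ (Fin (n - 2)),
      ‖w‖ ≤ τ ∧ PrimFeasible θ s t w} := by
  obtain ⟨b, hb0, hb1⟩ := exists_adapted_basis hn hv hvρ
  have hmeas : MeasurableSet {A : Fin m → EuclideanSpace ℝ (Fin n) |
      (v, A) ∈ deficient m n ρ α s₀ η R} :=
    measurable_prodMk_left measurableSet_deficient
  rw [← (measurePreserving_sensing b).measure_preimage hmeas.nullMeasurableSet,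
    ← (measurePreserving_sortEntries m (n - 2)).map_eq]
  refine le_trans (measure_mono ?_) (Measure.le_map_apply
    (measurePreserving_sortEntries m (n - 2)).aemeasurable _)
  rintro X hX ⟨w, hw, hfeas⟩
  obtain ⟨x, hx0, hx1, hxw⟩ := exists_coord b s t w
  refine hX ⟨x, ?_, (mem_feasible_sensing_iff hb0 X x).2 (by rwa [hx0, hx1, hxw]), ?_⟩
  · rw [mem_closedBall_zero_iff, ← sq_le_sq₀ (norm_nonneg _) hR, norm_sq_eq_coord b, hx0, hx1, hxw]
    have := pow_le_pow_left₀ (norm_nonneg w) hw 2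
    linarith
  · simp only
    conv_rhs => rw [hb1]
    rw [inner_add_left, real_inner_smul_left, real_inner_smul_left, ← hb0, hx0, hx1]
    exact hval

end Fixed

/-- A bound on the conditional probabilities given `X` bounds the probability of an event for the
independent pair `(X, A)`. -/
lemma measure_le_of_indepFun {Ω E F : Type*} [MeasurableSpace Ω] [MeasurableSpace E]
    [MeasurableSpace F] {P : Measure Ω} [IsProbabilityMeasure P] {X : Ω → E} {A : Ω → F}
    (hX : AEMeasurable X P) (hA : AEMeasurable A P) (hind : IndepFun X A P) {N : Set (E × F)}
    (hN : MeasurableSet N) {c : ENNReal}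
    (h : ∀ᵐ v ∂(P.map X), (P.map A) {y | (v, y) ∈ N} ≤ c) : P {ω | (X ω, A ω) ∈ N} ≤ c := by
  have : IsProbabilityMeasure (P.map X) := Measure.isProbabilityMeasure_map hX
  have : IsProbabilityMeasure (P.map A) := Measure.isProbabilityMeasure_map hA
  have h1 : P {ω | (X ω, A ω) ∈ N} = P.map (fun ω => (X ω, A ω)) N :=
    (Measure.map_apply_of_aemeasurable (hX.prodMk hA) hN).symm
  rw [h1, (indepFun_iff_map_prod_eq_prod_map_map hX hA).1 hind, Measure.prod_apply hN]
  calc ∫⁻ v, (P.map A) (Prod.mk v ⁻¹' N) ∂(P.map X) ≤ ∫⁻ _, c ∂(P.map X) := lintegral_mono_ae h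
    _ = c := by simp

/-! ### Probabilities of the bad events -/

section Random

variable {Ω : Type*} [MeasurableSpace Ω] {P : Measure Ω}

lemma map_sensing_eq_pi {m n : ℕ} {a : Fin m → Ω → EuclideanSpace ℝ (Fin n)}
    (ha_law : ∀ i, HasLaw (a i) (stdGaussian (EuclideanSpace ℝ (Fin n))) P)
    (ha_indep : iIndepFun a P) : P.map (fun ω i => a i ω) =
      Measure.pi fun _ : Fin m => stdGaussian (EuclideanSpace ℝ (Fin n)) := by
  rw [ha_indep.map_fun_eq_pi_map fun i => (ha_law i).aemeasurable]
  simp only [fun i => (ha_law i).map_eq]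

variable {α ρ s₀ : ℝ} {m : ℕ → ℕ} {a : (n : ℕ) → Fin (m n) → Ω → EuclideanSpace ℝ (Fin n)}
  {x₀ : (n : ℕ) → Ω → EuclideanSpace ℝ (Fin n)}

/-- Outside of events of vanishing probability, the linear program has a solution and every
solution is close to the predicted limits. -/
theorem exists_good_event [IsProbabilityMeasure P] (hα : 2 < α) (hρ : ρ ≤ 1) (hρ0 : 0 < ρ)
    (hs₀ : limitArgmax ρ α = {s₀})
    (hm : Tendsto (fun n => (m n : ℝ) / (n : ℝ)) atTop (𝓝 α))
    (ha_law : ∀ n i, HasLaw (a n i) (stdGaussian (EuclideanSpace ℝ (Fin n))) P)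
    (ha_indep : ∀ n, iIndepFun (a n) P) (hx₀_meas : ∀ n, Measurable (x₀ n))
    (hx₀_indep : ∀ n, IndepFun (x₀ n) (fun ω i => a n i ω) P)
    (hx₀_norm : ∀ n, 2 ≤ n → ∀ᵐ ω ∂P, ‖x₀ n ω‖ = 1)
    (hx₀_inner : ∀ n, 2 ≤ n → ∀ᵐ ω ∂P, ⟪signal n, x₀ n ω⟫ = ρ) {ε : ℝ} (hε : 0 < ε) :
    ∃ B : ℕ → Set Ω, Tendsto (fun n => P (B n)) atTop (𝓝 0) ∧ ∀ n, ∀ ω ∉ B n,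
      (solutions (fun i => a n i ω) (measurements (fun i => a n i ω) (signal n))
        (x₀ n ω)).Nonempty ∧
      ∀ x ∈ solutions (fun i => a n i ω) (measurements (fun i => a n i ω) (signal n)) (x₀ n ω),
        |head x - s₀| < ε ∧ |tailNorm x - rAlpha α s₀| < ε ∧
          |⟪x₀ n ω, x⟫ - limitCost ρ α s₀| < ε := by
  have hα0 : 0 < α := by linarith
  have hs₀_mem : s₀ ∈ limitArgmax ρ α := by rw [hs₀]; rfl
  -- `R` bounds the limiting feasible set, so that the strictly feasible point lies in the ball
  obtain ⟨η, R, hη, hR, hbad, hball⟩ := exists_badSet_infeasible hα hρ hρ0 hs₀ hε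
  obtain ⟨s, t, τ, hτ, hfeas, hval⟩ := exists_strictly_feasible hα hρ hρ0 hs₀_mem.1 hη
  let N₁ : ∀ n, Set Ω := fun n =>
    {ω | (x₀ n ω, fun i => a n i ω) ∈ exceptional (m n) n ρ α s₀ ε η R}
  let N₂ : ∀ n, Set Ω := fun n => {ω | (x₀ n ω, fun i => a n i ω) ∈ deficient (m n) n ρ α s₀ η R}
  have ha_meas : ∀ n, AEMeasurable (fun ω i => a n i ω) P := fun n =>
    aemeasurable_pi_lambda _ fun i => (ha_law n i).aemeasurable
  have hgood : ∀ n, 2 ≤ n → ∀ᵐ v ∂(P.map (x₀ n)), ‖v‖ = 1 ∧ ⟪signal n, v⟫ = ρ := by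
    intro n hn
    have hcl : MeasurableSet {v : EuclideanSpace ℝ (Fin n) | ‖v‖ = 1 ∧ ⟪signal n, v⟫ = ρ} :=
      ((isClosed_eq (by fun_prop) continuous_const).inter
        (isClosed_eq (by fun_prop) continuous_const)).measurableSet
    rw [ae_map_iff (hx₀_meas n).aemeasurable hcl]
    exact (hx₀_norm n hn).and (hx₀_inner n hn)
  have hN₁ : Tendsto (fun n => P (N₁ n)) atTop (𝓝 0) := by
    refine tendsto_of_tendsto_of_tendsto_of_le_of_le' tendsto_const_nhds
      (tendsto_primMeasure_exists_feasible hα0 hm (isCompact_badSet ρ α s₀ ε η hR.le)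
        hbad) (Eventually.of_forall fun _ => zero_le) ?_
    filter_upwards [eventually_ge_atTop 2] with n hn
    refine measure_le_of_indepFun (hx₀_meas n).aemeasurable (ha_meas n) (hx₀_indep n)
      (measurableSet_exceptional (by omega)) ?_
    filter_upwards [hgood n hn] with v hv
    rw [map_sensing_eq_pi (ha_law n) (ha_indep n)]
    exact pi_exceptional_le hn (m n) hv.1 hv.2
  have hN₂ : Tendsto (fun n => P (N₂ n)) atTop (𝓝 0) := by
    refine tendsto_of_tendsto_of_tendsto_of_le_of_le' tendsto_const_nhds
      (tendsto_primMeasure_infeasible hα0 hm hτ hfeas) (Eventually.of_forall fun _ => zero_le) ?_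
    filter_upwards [eventually_ge_atTop 2] with n hn
    refine measure_le_of_indepFun (hx₀_meas n).aemeasurable (ha_meas n) (hx₀_indep n)
      measurableSet_deficient ?_
    filter_upwards [hgood n hn] with v hv
    rw [map_sensing_eq_pi (ha_law n) (ha_indep n)]
    exact pi_deficient_le hn (m n) hR.le hv.1 hv.2 (hball s t τ hτ.le hfeas.le) hval.le
  refine ⟨fun n => N₁ n ∪ N₂ n, tendsto_measure_union_zero hN₁ hN₂, fun n ω hω => ?_⟩
  obtain ⟨h1, h2⟩ := not_or.1 hω
  exact ⟨solutions_nonempty hR h1, fun x hx => close_of_mem_solutions hR h1 h2 hx⟩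

lemma TendstoProb.tendstoInMeasure {X : ℕ → Ω → ℝ} {c : ℝ} (h : TendstoProb (fun _ => P) X c) :
    TendstoInMeasure P X atTop fun _ => c := by
  rw [tendstoInMeasure_iff_norm]
  exact h

end Random

end PhaseMax

theorem theorem2
    {Ω : Type*} [MeasurableSpace Ω] (P : Measure Ω) [IsProbabilityMeasure P]
    (α ρ : ℝ) (hα : 2 < α) (hρ : 0 < ρ)
    -- the number of measurements
    (m : ℕ → ℕ) (hm : Tendsto (fun n => (m n : ℝ) / (n : ℝ)) atTop (𝓝 α))
    -- the sensing vectors: independent, with law `N(0, Iₙ)`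
    (a : (n : ℕ) → Fin (m n) → Ω → EuclideanSpace ℝ (Fin n))
    (ha_law : ∀ n i, HasLaw (a n i) (stdGaussian (EuclideanSpace ℝ (Fin n))) P)
    (ha_indep : ∀ n, iIndepFun (a n) P)
    -- the initial guess: a unit vector, independent of the sensing vectors, with cosine `ρ`
    (x₀ : (n : ℕ) → Ω → EuclideanSpace ℝ (Fin n))
    (hx₀_meas : ∀ n, Measurable (x₀ n))
    (hx₀_indep : ∀ n, IndepFun (x₀ n) (fun ω i => a n i ω) P)
    (hx₀_norm : ∀ n, 2 ≤ n → ∀ᵐ ω ∂P, ‖x₀ n ω‖ = 1)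
    (hx₀_pos : ∀ n, 2 ≤ n → ∀ᵐ ω ∂P, 0 < ⟪PhaseMax.signal n, x₀ n ω⟫)
    (hx₀_cos : ∀ n, 2 ≤ n → ∀ᵐ ω ∂P, PhaseMax.cosSim (x₀ n ω) (PhaseMax.signal n) = ρ) :
    -- the limiting problem has exactly one maximizer
    ∃ s : ℝ, PhaseMax.limitArgmax ρ α = {s} ∧
      -- the linear program is solvable with probability tending to one
      Tendsto (fun n => P {ω | ¬ (PhaseMax.solutions (fun i => a n i ω)
        (PhaseMax.measurements (fun i => a n i ω) (PhaseMax.signal n)) (x₀ n ω)).Nonempty})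
        atTop (𝓝 0) ∧
      -- every choice of optimal solutions has the stated limits in probability
      ∀ x : (n : ℕ) → Ω → EuclideanSpace ℝ (Fin n),
        (∀ n, ∀ᵐ ω ∂P,
          (PhaseMax.solutions (fun i => a n i ω)
            (PhaseMax.measurements (fun i => a n i ω) (PhaseMax.signal n)) (x₀ n ω)).Nonempty →
          x n ω ∈ PhaseMax.solutions (fun i => a n i ω)
            (PhaseMax.measurements (fun i => a n i ω) (PhaseMax.signal n)) (x₀ n ω)) →
        TendstoInMeasure P (fun n ω => PhaseMax.nmse (PhaseMax.signal n) (x n ω)) atTop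
          (fun _ => 1 + s ^ 2 + PhaseMax.rAlpha α s ^ 2 - 2 * |s|) ∧
        TendstoInMeasure P (fun n ω => PhaseMax.head (x n ω)) atTop (fun _ => s) ∧
        TendstoInMeasure P (fun n ω => PhaseMax.tailNorm (x n ω)) atTop
          (fun _ => PhaseMax.rAlpha α s) ∧
        TendstoInMeasure P (fun n ω => ⟪x₀ n ω, x n ω⟫) atTop
          (fun _ => ρ * s + √((1 - ρ ^ 2) * PhaseMax.gAlpha α s)) := by
  have hx₀_inner : ∀ n, 2 ≤ n → ∀ᵐ ω ∂P, ⟪PhaseMax.signal n, x₀ n ω⟫ = ρ := by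
    intro n hn
    filter_upwards [hx₀_norm n hn, hx₀_pos n hn, hx₀_cos n hn] with ω h1 h2 h3
    rw [PhaseMax.cosSim, h1, PhaseMax.norm_signal (by omega), mul_one, div_one, real_inner_comm,
      abs_of_pos h2] at h3
    exact h3
  have hρ1 : ρ ≤ 1 := by
    obtain ⟨ω, h1, h2⟩ := ((hx₀_norm 2 le_rfl).and (hx₀_inner 2 le_rfl)).exists
    have h3 := real_inner_le_norm (PhaseMax.signal 2) (x₀ 2 ω)
    rwa [h1, h2, PhaseMax.norm_signal (by omega), mul_one] at h3
  obtain ⟨s, hs⟩ := PhaseMax.exists_limitArgmax_eq hα hρ1 hρ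
  have good := fun {ε : ℝ} (hε : 0 < ε) => PhaseMax.exists_good_event hα hρ1 hρ hs hm ha_law
    ha_indep hx₀_meas hx₀_indep hx₀_norm hx₀_inner hε
  refine ⟨s, hs, ?_, fun x hx => ?_⟩
  · obtain ⟨B, hB, hB'⟩ := good one_pos
    exact PhaseMax.tendsto_measure_zero_of_subset hB
      (Eventually.of_forall fun n ω hω => by_contra fun h => hω (hB' n ω h).1)
  have key : ∀ X : ℕ → Ω → ℝ, ∀ c : ℝ,
      (∀ ε n ω, (|PhaseMax.head (x n ω) - s| < ε ∧
        |PhaseMax.tailNorm (x n ω) - PhaseMax.rAlpha α s| < ε ∧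
        |⟪x₀ n ω, x n ω⟫ - PhaseMax.limitCost ρ α s| < ε) → |X n ω - c| < ε) →
      PhaseMax.TendstoProb (fun _ => P) X c := by
    intro X c hX δ hδ
    obtain ⟨B, hB, hB'⟩ := good hδ
    refine tendsto_of_tendsto_of_tendsto_of_le_of_le tendsto_const_nhds hB
      (fun _ => zero_le) fun n => measure_mono_ae ?_
    filter_upwards [hx n] with ω hω hbad
    by_contra hωB
    obtain ⟨h1, h2⟩ := hB' n ω hωB
    exact absurd hbad (not_le.2 (hX δ n ω (h2 _ (hω h1))))
  have hhead := key (fun n ω => PhaseMax.head (x n ω)) s fun ε n ω h => h.1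
  have htail := key (fun n ω => PhaseMax.tailNorm (x n ω)) (PhaseMax.rAlpha α s)
    fun ε n ω h => h.2.1
  have hcost := key (fun n ω => ⟪x₀ n ω, x n ω⟫) (PhaseMax.limitCost ρ α s) fun ε n ω h => h.2.2
  have hnmse : PhaseMax.TendstoProb (fun _ => P)
      (fun n ω => PhaseMax.nmse (PhaseMax.signal n) (x n ω))
      (1 + s ^ 2 + PhaseMax.rAlpha α s ^ 2 - 2 * |s|) := by
    intro δ hδ
    have h := hhead.map₂ htail (fun p => 1 + p.1 ^ 2 + p.2 ^ 2 - 2 * |p.1|)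
      (Continuous.continuousAt (by fun_prop)) δ hδ
    refine PhaseMax.tendsto_measure_zero_of_subset h ?_
    filter_upwards [eventually_gt_atTop 0] with n hn ω hω
    rwa [Set.mem_ofPred_eq, PhaseMax.nmse_eq hn] at hω
  exact ⟨hnmse.tendstoInMeasure, hhead.tendstoInMeasure, htail.tendstoInMeasure,
    hcost.tendstoInMeasure⟩
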